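/- **Setting.** Let $\mathbb T=\mathbb R/2\pi\mathbb Z$ and, for $\sigma>0$, $\Omega_\sigma=\{z\in\mathbb C: |\Im z|<\min\{\sigma\Re z,\sigma\}\}$. For $f(x,z)=\sum_{\alpha\in\mathbb Z}f_\alpha(z)e^{i\alpha x}$ on $\mathbb T\times\Omega_\sigma$ (continuous, holomorphic in $z$), $\beta>0$, $P>1$, $\nu>0$, $t\ge 0$, $\rho>0$, put $\phi_P(z)=(1+|\Re z|^P)^{-1}$, $\delta=\sqrt\nu$, $\delta_t=\sqrt{\nu t}$, $\psi(z)=z/(1+z)$, $$\|f\|_{\rho,\sigma,\delta(t)}=\sum_{\alpha}e^{\rho|\alpha|}\sup_{z\in\Omega_\sigma}|f_\alpha(z)|e^{\beta\Re z}\Bigl(1+\delta_t^{-1}\phi_P(\delta_t^{-1}z)+\delta^{-1}\phi_P(\delta^{-1}z)\Bigr)^{-1},$$ where for $t=0$ the term with $\delta_t$ is omitted, and $$\|f\|_{\mathcal L^1_{\rho,\sigma}}=\sum_\alpha e^{\rho|\alpha|}\sup_{0\le\theta<\sigma}\int_{\partial\Omega_\theta}|f_\alpha(z)|\,|dz|$$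 (for $\theta=0$, $\partial\Omega_0$ is the half-line $\mathbb R_+$ counted twice, as the limit of the two branches of $\partial\Omega_\theta$). Let $|||f|||_{\rho,\sigma,\delta(t),k}=\sum_{j+\ell\le k}\|\partial_x^j(\psi\partial_z)^\ell f\|_{\rho,\sigma,\delta(t)}$ and $|||f|||_{\mathcal W^{k,1}_{\rho,\sigma}}=\sum_{j+\ell\le k}\|\partial_x^j(\psi\partial_z)^\ell f\|_{\mathcal L^1_{\rho,\sigma}}$. For continuous $g=g(x)$ on $\mathbb T$ let $\|g\|_\rho=\sum_\alpha e^{\rho|\alpha|}|g_\alpha|$ and $|||g|||_{\rho,k}=\sum_{j\le k}\|\partial_x^jg\|_\rho$. Let $G_\alpha(t,y;z)$ be the Green function of the Stokes problem in the Fourier mode $\alpha$: for $y\ge0$, $(\partial_t-\nu(\partial_z^2-\alpha^2))G_\alpha=0$, $\nu(\partial_z+|\alpha|)G_\alpha|_{z=0}=0$, $G_\alpha|_{t=0}=\delta_y$, $G_\alpha(t,y;\cdot)\in L^1(\mathbb R_+)$; explicitly, with $K(\tau,x)=(4\pi\tau)^{-1/2}e^{-x^2/4\tau}$, $$G_\alpha(t,y;z)=e^{-\alpha^2\nu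 t}\bigl(K(\nu t,y-z)+K(\nu t,y+z)\bigr)+2|\alpha|e^{-\alpha^2\nu t}\int_0^\infty e^{|\alpha|w}K(\nu t,y+z+w)\,dw ,$$ which is entire in $z$. For $t>0$ define the Stokes semigroup and the boundary operator by $$e^{\nu tB}f=\sum_\alpha e^{i\alpha x}\int_0^\infty G_\alpha(t,y;z)f_\alpha(y)\,dy,\qquad \Gamma(\nu t)g=\sum_\alpha e^{i\alpha x}G_\alpha(t,0;z)g_\alpha .$$ **Proposition.** (0) The explicit kernel above has the properties just listed (it is a Green function of the Stokes problem). (1) Let $0<\sigma<1$, $\rho>0$, $\nu,t>0$. If $f$ has finite norm $\|f\|_{\mathcal L^1_{\rho,\sigma}}$ or $\|f\|_{\rho,\sigma,\delta(s)}$ for some $s\ge0$ (and some $\beta>0$, $P>1$), and if $\|g\|_\rho<\infty$, then $e^{\nu tB}f$ and $\Gamma(\nu t)g$ are continuous on $\mathbb T\times\Omega_\sigma$, holomorphic in $z$, differentiable in $x$, and $\partial_xe^{\nu tB}f=e^{\nu tB}\partial_xf$, $\partial_x\Gamma(\nu t)g=\Gamma(\nu t)\partial_xg$. (2) For all $\beta>0$,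 $P>1$, $T>0$, $\nu_0>0$, $\sigma_0\in(0,1)$ and $k\ge0$ there is a constant $C$ such that for all $0<\nu\le\nu_0$, $\rho>0$, $0<\sigma\le\sigma_0$, all $0<t\le T$, and all $f$, $g$ as in the setting, $$|||e^{\nu tB}f|||_{\rho,\sigma,\delta(t),k}\le C|||f|||_{\rho,\sigma,\delta(0),k},$$ $$|||e^{\nu(t-s)B}f|||_{\rho,\sigma,\delta(t),k}\le C\sqrt{\tfrac ts}\,|||f|||_{\rho,\sigma,\delta(s),k}\qquad(0<s<t),$$ $$|||\Gamma(\nu(t-s))g|||_{\rho,\sigma,\delta(t),k}\le C\sqrt{\tfrac t{t-s}}\,|||g|||_{\rho,k}+C\sqrt\nu\,|||g|||_{\rho,k+1}\qquad(0\le s<t),$$ $$|||e^{\nu tB}f|||_{\mathcal W^{k,1}_{\rho,\sigma}}\le C|||f|||_{\mathcal W^{k,1}_{\rho,\sigma}},\qquad |||\Gamma(\nu t)g|||_{\mathcal W^{k,1}_{\rho,\sigma}}\le C|||g|||_{\rho,k}.$$ (The bounds hold in $[0,\infty]$: they are void when the right-hand side is infinite.) -/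

import Mathlib

open Real Set Filter Topology MeasureTheory
open scoped ENNReal

noncomputable section

/-! ### Domains, derivatives and Fourier coefficients -/

/-- The pencil-like domain `Ω_σ = {z : |Im z| < min (σ Re z) σ}`. -/
def pencil (σ : ℝ) : Set ℂ := {z | |z.im| < min (σ * z.re) σ}

/-- `f(x,z)` is a function on `𝕋 × Ω_σ` with `𝕋 = ℝ/2πℤ`: it is `2π`-periodic in `x`, jointly
continuous, and holomorphic in `z`. (Analyticity in `x` is encoded by finiteness of the norms
below, which carry the weight `e^{ρ|α|}`, `ρ > 0`.) -/
structure IsHoloOn (σ : ℝ) (f : ℝ → ℂ → ℂ) : Prop where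
  periodic : ∀ z ∈ pencil σ, Function.Periodic (fun x => f x z) (2 * π)
  cont : ContinuousOn (Function.uncurry f) (univ ×ˢ pencil σ)
  holo : ∀ x, DifferentiableOn ℂ (f x) (pencil σ)

/-- `∂_x f`. -/
def dX (f : ℝ → ℂ → ℂ) : ℝ → ℂ → ℂ := fun x z => deriv (fun x' => f x' z) x

/-- `ψ(z) = z / (1 + z)`. -/
def psi (z : ℂ) : ℂ := z / (1 + z)

/-- The conormal derivative `ψ(z) ∂_z f`. -/
def conormal (f : ℝ → ℂ → ℂ) : ℝ → ℂ → ℂ := fun x z => psi z * deriv (f x) z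

/-- The Fourier coefficient `g_α = (2π)⁻¹ ∫_0^{2π} g(x) e^{-iαx} dx`. -/
def coeff (g : ℝ → ℂ) (α : ℤ) : ℂ :=
  (2 * (π : ℂ))⁻¹ * ∫ x in (0 : ℝ)..(2 * π), g x * Complex.exp (-(Complex.I * α * x))

/-- The partial Fourier coefficient in `x`: `f_α(z)`. -/
def mode (f : ℝ → ℂ → ℂ) (α : ℤ) (z : ℂ) : ℂ := coeff (fun x => f x z) α

/-! ### Norms, with values in `[0, ∞]` -/

/-- The boundary layer weight `φ_P(z) = 1 / (1 + |Re z|^P)`. -/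
def phiP (P : ℝ) (z : ℂ) : ℝ := 1 / (1 + |z.re| ^ P)

/-- One layer `δ⁻¹ φ_P(δ⁻¹ z)` of thickness `δ`. -/
def layer (P δ : ℝ) (z : ℂ) : ℝ := δ⁻¹ * phiP P (((δ⁻¹ : ℝ) : ℂ) * z)

/-- `1 + δ_t⁻¹ φ_P(δ_t⁻¹ z) + δ⁻¹ φ_P(δ⁻¹ z)` with `δ_t = √(νt)`, `δ = √ν`; at `t = 0` only the
layer of thickness `δ` is kept. -/
def blWeight (P ν t : ℝ) (z : ℂ) : ℝ :=
  1 + (if t = 0 then 0 else layer P √(ν * t) z) + layer P √ν z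

/-- `‖h‖_{σ,δ(t)}` for a function `h` on `Ω_σ`. -/
def blModeNorm (β P ν t σ : ℝ) (h : ℂ → ℂ) : ℝ≥0∞ :=
  ⨆ z ∈ pencil σ, ENNReal.ofReal (‖h z‖ * exp (β * z.re) * (blWeight P ν t z)⁻¹)

/-- The point of the upper branch of `∂Ω_θ` with real part `r` (lower branch: `-θ`). -/
def branch (θ r : ℝ) : ℂ := ⟨r, θ * min r 1⟩

/-- The arc length density of a branch of `∂Ω_θ` with respect to `r = Re z`. -/
def arcDensity (θ r : ℝ) : ℝ := if r < 1 then √(1 + θ ^ 2) else 1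

/-- `‖h‖_{L¹_σ} = sup_{0 ≤ θ < σ} ∫_{∂Ω_θ} |h(z)| |dz|`. -/
def l1ModeNorm (σ : ℝ) (h : ℂ → ℂ) : ℝ≥0∞ :=
  ⨆ θ ∈ Ico 0 σ, ∫⁻ r in Ioi (0 : ℝ),
    ENNReal.ofReal ((‖h (branch θ r)‖ + ‖h (branch (-θ) r)‖) * arcDensity θ r)

/-- `∑_{α ∈ ℤ} e^{ρ|α|} n_α`. -/
def expSum (ρ : ℝ) (n : ℤ → ℝ≥0∞) : ℝ≥0∞ :=
  ∑' α : ℤ, ENNReal.ofReal (exp (ρ * |(α : ℝ)|)) * n α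

/-- `‖f‖_{ρ,σ,δ(t)}`. -/
def blNorm (β P ν t ρ σ : ℝ) (f : ℝ → ℂ → ℂ) : ℝ≥0∞ :=
  expSum ρ fun α => blModeNorm β P ν t σ (mode f α)

/-- `‖f‖_{𝓛¹_{ρ,σ}}`. -/
def l1Norm (ρ σ : ℝ) (f : ℝ → ℂ → ℂ) : ℝ≥0∞ :=
  expSum ρ fun α => l1ModeNorm σ (mode f α)

/-- `∑_{j+ℓ ≤ k} N(∂_x^j (ψ ∂_z)^ℓ f)`. -/
def conormalSum (k : ℕ) (N : (ℝ → ℂ → ℂ) → ℝ≥0∞) (f : ℝ → ℂ → ℂ) : ℝ≥0∞ :=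
  ∑ m ∈ Finset.range (k + 1), ∑ p ∈ Finset.HasAntidiagonal.antidiagonal m, N (dX^[p.1] (conormal^[p.2] f))

/-- `|||f|||_{ρ,σ,δ(t),k}`. -/
def blNormK (β P ν t ρ σ : ℝ) (k : ℕ) (f : ℝ → ℂ → ℂ) : ℝ≥0∞ :=
  conormalSum k (blNorm β P ν t ρ σ) f

/-- `|||f|||_{𝓦^{k,1}_{ρ,σ}}`. -/
def wNorm (ρ σ : ℝ) (k : ℕ) (f : ℝ → ℂ → ℂ) : ℝ≥0∞ :=
  conormalSum k (l1Norm ρ σ) f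

/-- `‖g‖_ρ = ∑_α e^{ρ|α|} |g_α|` for `g = g(x)`. -/
def bdryNorm (ρ : ℝ) (g : ℝ → ℂ) : ℝ≥0∞ :=
  expSum ρ fun α => ENNReal.ofReal ‖coeff g α‖

/-- `|||g|||_{ρ,k} = ∑_{j ≤ k} ‖∂_x^j g‖_ρ`. -/
def bdryNormK (ρ : ℝ) (k : ℕ) (g : ℝ → ℂ) : ℝ≥0∞ :=
  ∑ j ∈ Finset.range (k + 1), bdryNorm ρ (deriv^[j] g)

/-! ### The Stokes problem -/

/-- `G(t, y, z)` is the Green function of the Stokes problem for the Fourier mode `α`: for each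
source point `y ≥ 0`, the function `z ↦ G(t, y, z)` extends holomorphically, is integrable on
`ℝ₊`, solves `(∂_t - ν(∂_z² - α²)) G = 0` with `ν(∂_z + |α|) G = 0` on `z = 0`, and has initial
data `δ_y` (as a measure on `[0, ∞)`). -/
structure IsStokesGreen (ν : ℝ) (α : ℤ) (G : ℝ → ℂ → ℂ → ℂ) : Prop where
  holo : ∀ t > 0, ∀ y : ℝ, 0 ≤ y → Differentiable ℂ (G t y)
  integrable : ∀ t > 0, ∀ y : ℝ, 0 ≤ y → IntegrableOn (fun z : ℝ => G t y z) (Ioi 0)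
  heat : ∀ t > 0, ∀ y : ℝ, 0 ≤ y → ∀ z : ℂ,
    HasDerivAt (fun t' => G t' y z)
      (ν * (deriv (deriv (G t y)) z - (α : ℂ) ^ 2 * G t y z)) t
  boundary : ∀ t > 0, ∀ y : ℝ, 0 ≤ y →
    (ν : ℂ) * (deriv (G t y) 0 + ((|α| : ℤ) : ℂ) * G t y 0) = 0
  initial : ∀ y : ℝ, 0 ≤ y → ∀ φ : BoundedContinuousFunction ℝ ℂ,
    Tendsto (fun t : ℝ => ∫ z in Ioi (0 : ℝ), G t y z * φ z) (𝓝[>] 0) (𝓝 (φ y))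

/-- The heat kernel `(4πτ)^{-1/2} e^{-x²/(4τ)}`, for complex `x`. -/
def heatKernel (τ : ℝ) (x : ℂ) : ℂ :=
  ((√(4 * π * τ))⁻¹ : ℝ) * Complex.exp (-(x ^ 2) / (4 * (τ : ℂ)))

/-- The heat kernel of mode `α` with homogeneous Neumann condition. -/
def neumannKernel (ν : ℝ) (α : ℤ) (t : ℝ) (y z : ℂ) : ℂ :=
  Complex.exp (-((α : ℂ) ^ 2 * ν * t)) * (heatKernel (ν * t) (y - z) + heatKernel (ν * t) (y + z))

/-- The residual kernel due to the term `|α|` in the boundary condition,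
`2|α| e^{-α²νt} ∫_0^∞ e^{|α|w} (4πνt)^{-1/2} e^{-(y+z+w)²/(4νt)} dw`, the inverse Laplace transform
of `|α|(|α|+μ) e^{-μ(y+z)} / (λμ)`, where `μ = √(λ/ν + α²)`. -/
def residualKernel (ν : ℝ) (α : ℤ) (t : ℝ) (y z : ℂ) : ℂ :=
  2 * ((|α| : ℤ) : ℂ) * Complex.exp (-((α : ℂ) ^ 2 * ν * t)) *
    ∫ w in Ioi (0 : ℝ), Complex.exp (((|α| : ℤ) : ℂ) * w) * heatKernel (ν * t) (y + z + w)

/-- The Green function `G_α(t, y; z)` of the Stokes problem with viscosity `ν`. -/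
def stokesGreen (ν : ℝ) (α : ℤ) (t : ℝ) (y z : ℂ) : ℂ :=
  neumannKernel ν α t y z + residualKernel ν α t y z

/-- The Stokes semigroup `e^{νtB}`, `t > 0`:
`(e^{νtB} f)(x, z) = ∑_α e^{iαx} ∫_0^∞ G_α(t, y; z) f_α(y) dy`. -/
def stokesSemigroup (ν t : ℝ) (f : ℝ → ℂ → ℂ) : ℝ → ℂ → ℂ := fun x z =>
  ∑' α : ℤ, Complex.exp (Complex.I * α * x) *
    ∫ y in Ioi (0 : ℝ), stokesGreen ν α t y z * mode f α y

/-- The boundary operator `Γ(νt)`, i.e. the semigroup applied to the measure `g 𝓗¹` on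
`𝕋 × {y = 0}`: `(Γ(νt) g)(x, z) = ∑_α e^{iαx} G_α(t, 0; z) g_α`. -/
def stokesBoundary (ν t : ℝ) (g : ℝ → ℂ) : ℝ → ℂ → ℂ := fun x z =>
  ∑' α : ℤ, Complex.exp (Complex.I * α * x) * (stokesGreen ν α t 0 z * coeff g α)

end

noncomputable section

/-! ### Fourier series of periodic functions -/

/-! The Green function is a sum of three kernels that see y and z only through a phase: the heat
kernel H at y − z and at y + z, and a residual kernel R at y + z. Completing the square writes R as
e^{-|α|ζ} times a complementary error function (`resE_eq`), so that R' = −|α|R − 2|α|H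
(`hasDerivAt_resE`). The Stokes equation and the boundary condition are then algebra, and since the
mass of R is O(|α|√(νt)), the initial datum comes from the heat kernels alone.

The estimates are proved one Fourier mode at a time. If z lies on a branch of ∂Ω_θ, Cauchy's theorem
moves the contour ℝ₊ to that very branch (`integral_eq_integral_branch`). Because r ↦ min(r,1) is
1-Lipschitz, y − z and y + z then stay in the cone |Im ζ| ≤ σ|Re ζ| with σ < 1, where Gaussians
still decay in Re ζ. There R is bounded by (|α| + 1/δ) exp(−c((|α| + 1/δ) Re ζ + (Re ζ)²/(νt))) for
every δ ≥ √(νt) (`norm_resE_cone_le'`).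

Conormal derivatives pass through the integral operators. Integration by parts, with no boundary
term because ψ(0) = 0, trades ψ(z)∂_z for the derivation ψ(y)∂_y + ψ(z)∂_z on the kernel plus a
conormal derivative of the datum (`conD_intOp`). As ψ(y) ± ψ(z) is y ± z times a bounded coefficient
(`exists_phase_coef`), this derivation acts on E(y ± z) as the Euler operator ζ∂_ζ, and Euler
derivatives keep the bounds of E on cones by Cauchy's estimate on discs of radius comparable to Re ζ
(`norm_eul_le`). By induction every conormal derivative is dominated by positive majorant kernels
acting on conormal derivatives of the datum along a single branch.

What remains is Schur's test for the majorants. In L¹ they have bounded mass, uniformly in ν, t and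
α. In the weighted sup norm the Gaussian moves the boundary layer weight from r to x, and the
residual majorant creates a layer by its own exponential decay. For a source at y = 0 the factor |α|
in the residual bound is only compensated by a layer of thickness √ν; this is the term √ν |α|, hence
the derivative lost in the boundary estimate. The sup estimates are proved with the same weight time
t on both sides and any kernel time t' ≤ t; the two semigroup bounds then follow by comparing
weights at times 0, s and t.

The weight e^{ρ|α|} with ρ > 0 justifies all manipulations of Fourier series, and `IsModeNorm`
isolates what the passage from single modes to the full norms needs. -/

/-- The character `e^{iαx}`. -/
def chr (α : ℤ) (x : ℝ) : ℂ := Complex.exp (Complex.I * α * x)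

lemma norm_chr (α : ℤ) (x : ℝ) : ‖chr α x‖ = 1 := by
  have : Complex.I * α * x = ((α * x : ℝ) : ℂ) * Complex.I := by push_cast; ring
  rw [chr, this, Complex.norm_exp_ofReal_mul_I]

lemma hasDerivAt_chr (α : ℤ) (x : ℝ) : HasDerivAt (chr α) (Complex.I * α * chr α x) x := by
  have h : HasDerivAt (fun w : ℂ => Complex.exp (Complex.I * α * w))
      (Complex.exp (Complex.I * α * x) * (Complex.I * α)) (x : ℂ) := by
    simpa using ((hasDerivAt_id (x : ℂ)).const_mul (Complex.I * α)).cexp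
  refine h.comp_ofReal.congr_deriv ?_
  rw [chr]; ring

lemma continuous_chr (α : ℤ) : Continuous (chr α) := by
  unfold chr; fun_prop

lemma periodic_chr (α : ℤ) : Function.Periodic (chr α) (2 * π) := by
  intro x
  have : Complex.I * α * ((x + 2 * π : ℝ) : ℂ) = Complex.I * α * x + α * (2 * π * Complex.I) := by
    push_cast; ring
  rw [chr, this, Complex.exp_add, Complex.exp_int_mul_two_pi_mul_I, mul_one, chr]

lemma coeff_congr {g h : ℝ → ℂ} (e : ∀ x, g x = h x) (α : ℤ) : coeff g α = coeff h α := by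
  rw [funext e]

lemma integral_chr (n : ℤ) :
    ∫ x in (0 : ℝ)..(2 * π), chr n x = if n = 0 then (2 * π : ℂ) else 0 := by
  split_ifs with h
  · simp [chr, h]
  · have hc : Complex.I * n ≠ 0 := by simp [h]
    have := integral_exp_mul_complex (a := 0) (b := 2 * π) hc
    unfold chr
    rw [this]
    have h2 : Complex.I * n * ((2 * π : ℝ) : ℂ) = n * (2 * π * Complex.I) := by push_cast; ring
    rw [h2, Complex.exp_int_mul_two_pi_mul_I]; simp

lemma coeff_tsum_chr {c : ℤ → ℂ} (hc : Summable fun α => ‖c α‖) (α : ℤ) :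
    coeff (fun x => ∑' γ : ℤ, chr γ x * c γ) α = c α := by
  let F : ℤ → C(ℝ, ℂ) := fun γ => ⟨fun x => c γ * chr (γ - α) x, by
    have := continuous_chr (γ - α); fun_prop⟩
  have hs : Summable fun γ => ‖(F γ).restrict (⟨uIcc 0 (2 * π), isCompact_uIcc⟩ : TopologicalSpace.Compacts ℝ)‖ := by
    refine Summable.of_nonneg_of_le (fun _ => norm_nonneg _) (fun γ => ?_) hc
    rw [ContinuousMap.norm_le _ (norm_nonneg _)]
    intro x
    simp [F, norm_chr]
  have h := intervalIntegral.hasSum_intervalIntegral_of_summable_norm hs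
  have h1 : ∀ γ, ∫ x in (0 : ℝ)..(2 * π), F γ x = if γ = α then 2 * π * c α else 0 := by
    intro γ
    simp only [F, ContinuousMap.coe_mk, intervalIntegral.integral_const_mul, integral_chr]
    by_cases hγ : γ = α
    · simp [hγ, mul_comm]
    · simp [hγ, sub_eq_zero]
  have h2 := h.tsum_eq
  simp only [h1, tsum_ite_eq] at h2
  have h3 : ∀ x : ℝ, (∑' γ : ℤ, chr γ x * c γ) * Complex.exp (-(Complex.I * α * x))
      = ∑' γ, F γ x := by
    intro x
    rw [← tsum_mul_right]
    refine tsum_congr fun γ => ?_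
    simp only [F, ContinuousMap.coe_mk, chr]
    rw [mul_comm (Complex.exp _), mul_assoc, ← Complex.exp_add]
    congr 2; push_cast; ring
  simp only [coeff, h3]
  rw [← h2]
  have : (2 * π : ℂ) ≠ 0 := by simp [Real.pi_ne_zero]
  field_simp

/-- Fourier inversion on the circle `AddCircle (2 * π)`, transported to periodic functions on the
line. -/
lemma hasSum_coeff {g : ℝ → ℂ} (hg : Continuous g) (hp : Function.Periodic g (2 * π))
    (hs : Summable fun α => ‖coeff g α‖) (x : ℝ) : g x = ∑' γ : ℤ, chr γ x * coeff g γ := by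
  have : Fact (0 < 2 * π) := ⟨Real.two_pi_pos⟩
  let f : C(AddCircle (2 * π), ℂ) := ⟨hp.lift, continuous_coinduced_dom.mpr hg⟩
  have hf : ∀ y : ℝ, f (y : AddCircle (2 * π)) = g y := fun y => hp.lift_coe y
  have hfour : ∀ (n : ℤ) (y : ℝ), fourier n (y : AddCircle (2 * π)) = chr n y := by
    intro n y
    rw [fourier_coe_apply, chr]
    congr 1
    have : (π : ℂ) ≠ 0 := by simp [Real.pi_ne_zero]
    push_cast; field_simp
  have hco : ∀ n, fourierCoeff f n = coeff g n := by
    intro n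
    rw [fourierCoeff_eq_intervalIntegral _ _ 0, coeff]
    simp only [hf, hfour, zero_add, smul_eq_mul, Complex.real_smul]
    push_cast
    rw [one_div]
    congr 1
    refine intervalIntegral.integral_congr fun y _ => ?_
    simp only [chr]
    rw [mul_comm]; congr 2; push_cast; ring
  have h := has_pointwise_sum_fourier_series_of_summable (f := f)
    (by simpa only [funext hco] using hs.of_norm) (x : AddCircle (2 * π))
  rw [← hf x, ← h.tsum_eq]
  refine tsum_congr fun n => ?_
  rw [hfour, hco, smul_eq_mul, mul_comm]

/-- All weighted sums `∑ |α|^j |c_α|` are finite. -/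
def RapidDecay (c : ℤ → ℂ) : Prop := ∀ j : ℕ, Summable fun α : ℤ => |(α : ℝ)| ^ j * ‖c α‖

lemma RapidDecay.summable {c : ℤ → ℂ} (h : RapidDecay c) : Summable fun α => ‖c α‖ := by
  simpa using h 0

lemma RapidDecay.mul {c : ℤ → ℂ} (h : RapidDecay c) :
    RapidDecay fun α => Complex.I * α * c α := by
  intro j
  refine (h (j + 1)).congr fun α => ?_
  simp [pow_succ]; ring

lemma hasDerivAt_tsum_chr {c : ℤ → ℂ} (h : Summable fun α : ℤ => |(α : ℝ)| * ‖c α‖)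
    (h0 : Summable fun α => ‖c α‖) (x : ℝ) :
    HasDerivAt (fun x => ∑' γ : ℤ, chr γ x * c γ)
      (∑' γ : ℤ, chr γ x * (Complex.I * γ * c γ)) x := by
  refine hasDerivAt_tsum (g' := fun γ y => chr γ y * (Complex.I * γ * c γ)) (y₀ := 0) h
    (fun γ y => ?_) (fun γ y => ?_) ?_ x
  · refine ((hasDerivAt_chr γ y).mul_const (c γ)).congr_deriv (by ring)
  · simp [norm_chr]
  · exact Summable.of_norm (by simpa [norm_chr] using h0)

lemma continuous_tsum_chr {c : ℤ → ℂ} (h : Summable fun α => ‖c α‖) :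
    Continuous fun x => ∑' γ : ℤ, chr γ x * c γ :=
  continuous_tsum (fun γ => (continuous_chr γ).mul continuous_const) h
    fun γ x => by simp [norm_chr]

lemma periodic_tsum_chr (c : ℤ → ℂ) :
    Function.Periodic (fun x => ∑' γ : ℤ, chr γ x * c γ) (2 * π) := fun x =>
  tsum_congr fun γ => by rw [periodic_chr γ x]

/-- No smoothness is assumed: the decay of the coefficients makes the inverted series differentiable
term by term. Thus `deriv` below is a true derivative and not a default value. -/
lemma RapidDecay.hasDerivAt {g : ℝ → ℂ} (hg : Continuous g) (hp : Function.Periodic g (2 * π))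
    (h : RapidDecay (coeff g)) (x : ℝ) :
    HasDerivAt g (∑' γ : ℤ, chr γ x * (Complex.I * γ * coeff g γ)) x := by
  have := hasDerivAt_tsum_chr (by simpa using h 1) h.summable x
  exact this.congr_of_eventuallyEq (Eventually.of_forall (hasSum_coeff hg hp h.summable))

lemma RapidDecay.coeff_deriv {g : ℝ → ℂ} (hg : Continuous g) (hp : Function.Periodic g (2 * π))
    (h : RapidDecay (coeff g)) (α : ℤ) : coeff (deriv g) α = Complex.I * α * coeff g α := by
  rw [coeff_congr fun x => (RapidDecay.hasDerivAt hg hp h x).deriv]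
  exact coeff_tsum_chr h.mul.summable α

lemma RapidDecay.coeff_iterate_deriv (j : ℕ) :
    ∀ {g : ℝ → ℂ}, Continuous g → Function.Periodic g (2 * π) → RapidDecay (coeff g) →
      ∀ α, coeff (deriv^[j] g) α = (Complex.I * α) ^ j * coeff g α := by
  induction j with
  | zero => intro g _ _ _ α; simp
  | succ j ih =>
    intro g hg hp h α
    have hd : deriv g = fun x => ∑' γ : ℤ, chr γ x * (Complex.I * γ * coeff g γ) :=
      funext fun x => (RapidDecay.hasDerivAt hg hp h x).deriv
    have hc := RapidDecay.coeff_deriv hg hp h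
    rw [Function.iterate_succ_apply, ih, hc]
    · ring
    · rw [hd]; exact continuous_tsum_chr h.mul.summable
    · rw [hd]; exact periodic_tsum_chr _
    · rw [funext hc]; exact h.mul

lemma pow_le_exp_mul {ρ : ℝ} (hρ : 0 < ρ) (j : ℕ) :
    ∃ C : ℝ, 0 < C ∧ ∀ x : ℝ, 0 ≤ x → x ^ j ≤ C * exp (ρ * x) := by
  refine ⟨j.factorial / ρ ^ j, by positivity, fun x hx => ?_⟩
  have h := Real.pow_div_factorial_le_exp (ρ * x) (by positivity) j
  rw [div_le_iff₀ (by positivity), mul_pow] at h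
  rw [div_mul_eq_mul_div, le_div_iff₀ (by positivity)]
  linarith

/-- This is where ρ > 0 enters: e^{ρ|α|} dominates every power of |α|. -/
lemma rapidDecay_of_expSum {ρ : ℝ} (hρ : 0 < ρ) {c : ℤ → ℂ}
    (h : expSum ρ (fun α => ENNReal.ofReal ‖c α‖) < ⊤) : RapidDecay c := by
  intro j
  obtain ⟨C, hC, hb⟩ := pow_le_exp_mul hρ j
  have hs : Summable fun α : ℤ => exp (ρ * |(α : ℝ)|) * ‖c α‖ := by
    have := ENNReal.summable_toReal h.ne
    refine this.congr fun α => ?_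
    rw [← ENNReal.ofReal_mul (exp_nonneg _), ENNReal.toReal_ofReal (by positivity)]
  refine Summable.of_nonneg_of_le (fun _ => by positivity) (fun α => ?_) (hs.mul_left C)
  rw [← mul_assoc]
  exact mul_le_mul_of_nonneg_right (hb _ (abs_nonneg _)) (norm_nonneg _)

/-! ### The pencil domain -/

lemma isOpen_pencil (σ : ℝ) : IsOpen (pencil σ) := by
  unfold pencil
  exact isOpen_lt (Complex.continuous_im.abs)
    ((continuous_const.mul Complex.continuous_re).min continuous_const)

lemma pencil_re_pos {σ : ℝ} (hσ : 0 < σ) {z : ℂ} (hz : z ∈ pencil σ) : 0 < z.re := by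
  have h1 : |z.im| < σ * z.re := lt_of_lt_of_le hz (min_le_left _ _)
  have := lt_of_le_of_lt (abs_nonneg _) h1
  exact pos_of_mul_pos_right this hσ.le

lemma ofReal_mem_pencil {σ : ℝ} (hσ : 0 < σ) {r : ℝ} (hr : 0 < r) : (r : ℂ) ∈ pencil σ := by
  simp [pencil, hσ, hr]

lemma branch_mem_pencil {σ θ r : ℝ} (hθ : |θ| < σ) (hr : 0 < r) : branch θ r ∈ pencil σ := by
  have hσ := lt_of_le_of_lt (abs_nonneg _) hθ
  have hm : 0 < min r 1 := lt_min hr one_pos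
  have : σ * min r 1 = min (σ * r) σ := by rw [mul_min_of_nonneg _ _ hσ.le, mul_one]
  simp only [pencil, branch, mem_ofPred_eq, abs_mul, abs_of_pos hm, ← this]
  exact mul_lt_mul_of_pos_right hθ hm

/-- Since min(σx, σ) = σ min(x,1), the branches with |θ| < σ foliate the pencil. A pointwise bound
can therefore be proved with the contour through the given point. -/
lemma exists_branch {σ : ℝ} (hσ : 0 < σ) {z : ℂ} (hz : z ∈ pencil σ) :
    ∃ θ, |θ| < σ ∧ z = branch θ z.re := by
  have hr := pencil_re_pos hσ hz
  have hm : 0 < min z.re 1 := lt_min hr one_pos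
  have : σ * min z.re 1 = min (σ * z.re) σ := by rw [mul_min_of_nonneg _ _ hσ.le, mul_one]
  refine ⟨z.im / min z.re 1, ?_, ?_⟩
  · rw [abs_div, abs_of_pos hm, div_lt_iff₀ hm, this]; exact hz
  · apply Complex.ext
    · simp [branch]
    · simp only [branch]; field_simp

lemma one_add_ne_zero {z : ℂ} (hz : 0 ≤ z.re) : 1 + z ≠ 0 := by
  intro h
  have := congrArg Complex.re h
  simp at this; linarith

lemma hasDerivAt_psi {z : ℂ} (hz : 0 ≤ z.re) : HasDerivAt psi (((1 + z)⁻¹) ^ 2) z := by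
  have h1 := one_add_ne_zero hz
  have := (hasDerivAt_id z).div ((hasDerivAt_id z).const_add 1) h1
  refine this.congr_deriv ?_
  simp only [id]; field_simp; ring

lemma differentiableOn_psi {σ : ℝ} (hσ : 0 < σ) : DifferentiableOn ℂ psi (pencil σ) := fun _ hz =>
  (hasDerivAt_psi (pencil_re_pos hσ hz).le).differentiableAt.differentiableWithinAt

/-! ### Conormal derivatives and modes -/

/-- The operator `ψ(z) ∂_z` on functions of `z`. -/
def conD (h : ℂ → ℂ) : ℂ → ℂ := fun z => psi z * deriv h z

lemma conD_differentiableOn {σ : ℝ} (hσ : 0 < σ) {h : ℂ → ℂ}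
    (hh : DifferentiableOn ℂ h (pencil σ)) : DifferentiableOn ℂ (conD h) (pencil σ) :=
  (differentiableOn_psi hσ).mul (hh.deriv (isOpen_pencil σ))

lemma conD_eqOn {σ : ℝ} {g h : ℂ → ℂ} (e : EqOn g h (pencil σ)) :
    EqOn (conD g) (conD h) (pencil σ) := fun z hz => by
  have : g =ᶠ[𝓝 z] h := e.eventuallyEq_of_mem ((isOpen_pencil σ).mem_nhds hz)
  simp only [conD, this.deriv_eq]

lemma iterate_conD_eqOn {σ : ℝ} (l : ℕ) : ∀ {g h : ℂ → ℂ}, EqOn g h (pencil σ) →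
    EqOn (conD^[l] g) (conD^[l] h) (pencil σ) := by
  induction l with
  | zero => intro g h e; simpa using e
  | succ l ih => intro g h e; exact ih (conD_eqOn e)

lemma iterate_conD_differentiableOn {σ : ℝ} (hσ : 0 < σ) (l : ℕ) : ∀ {h : ℂ → ℂ},
    DifferentiableOn ℂ h (pencil σ) → DifferentiableOn ℂ (conD^[l] h) (pencil σ) := by
  induction l with
  | zero => intro h hh; simpa using hh
  | succ l ih => intro h hh; exact ih (conD_differentiableOn hσ hh)

lemma conD_add {σ : ℝ} {g h : ℂ → ℂ} (hg : DifferentiableOn ℂ g (pencil σ))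
    (hh : DifferentiableOn ℂ h (pencil σ)) :
    EqOn (conD (fun z => g z + h z)) (fun z => conD g z + conD h z) (pencil σ) := fun z hz => by
  have hn := (isOpen_pencil σ).mem_nhds hz
  simp only [conD]
  rw [deriv_fun_add (hg.differentiableAt hn) (hh.differentiableAt hn)]
  ring

lemma iterate_conD_add {σ : ℝ} (hσ : 0 < σ) (l : ℕ) : ∀ {g h : ℂ → ℂ},
    DifferentiableOn ℂ g (pencil σ) → DifferentiableOn ℂ h (pencil σ) →
    EqOn (conD^[l] (fun z => g z + h z)) (fun z => conD^[l] g z + conD^[l] h z) (pencil σ) := by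
  induction l with
  | zero => intro g h _ _ z _; simp
  | succ l ih =>
    intro g h hg hh z hz
    simp only [Function.iterate_succ_apply]
    rw [iterate_conD_eqOn l (conD_add hg hh) hz]
    exact ih (conD_differentiableOn hσ hg) (conD_differentiableOn hσ hh) hz

lemma iterate_conD_mul_const (l : ℕ) (c : ℂ) : ∀ h : ℂ → ℂ,
    conD^[l] (fun z => h z * c) = fun z => conD^[l] h z * c := by
  induction l with
  | zero => intro h; simp
  | succ l ih =>
    intro h
    have : conD (fun z => h z * c) = fun z => conD h z * c := by
      funext z; simp only [conD, deriv_mul_const_field]; ring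
    rw [Function.iterate_succ_apply, this, ih, Function.iterate_succ_apply]

variable {σ : ℝ} {f : ℝ → ℂ → ℂ}

/-- Joint continuity is uniform over compact sets of z, so the slices converge locally uniformly;
Weierstrass' theorem then carries the convergence over to ∂_z f. -/
lemma IsHoloOn.tendstoLocallyUniformlyOn (hf : IsHoloOn σ f) (x : ℝ) :
    TendstoLocallyUniformlyOn f (f x) (𝓝 x) (pencil σ) := by
  rw [tendstoLocallyUniformlyOn_iff_forall_isCompact (isOpen_pencil σ)]
  intro K hK hKc
  have hc : ContinuousOn (Function.uncurry f) (univ ×ˢ K) :=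
    hf.cont.mono (prod_mono_right hK)
  rw [Metric.tendstoUniformlyOn_iff]
  intro ε hε
  obtain ⟨v, hv, h⟩ := hKc.mem_uniformity_of_prod hc (mem_univ x) (Metric.dist_mem_uniformity hε)
  rw [nhdsWithin_univ] at hv
  filter_upwards [hv] with y hy z hz
  have := h y hy z hz
  rw [dist_comm]; exact this

/-- Joint continuity of ∂_z f is what makes the class `IsHoloOn` stable under the conormal
derivative. -/
lemma IsHoloOn.continuousOn_deriv (hf : IsHoloOn σ f) :
    ContinuousOn (fun p : ℝ × ℂ => deriv (f p.1) p.2) (univ ×ˢ pencil σ) := by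
  rintro ⟨x, z⟩ ⟨-, hz⟩
  have h := (hf.tendstoLocallyUniformlyOn x).deriv
    (Eventually.of_forall hf.holo) (isOpen_pencil σ)
  have hc : ContinuousAt (deriv (f x)) z :=
    ((hf.holo x).deriv (isOpen_pencil σ)).continuousOn.continuousAt ((isOpen_pencil σ).mem_nhds hz)
  have hT : TendstoLocallyUniformlyOn (fun p : ℝ × ℂ => deriv (f p.1)) (deriv (f x))
      (𝓝[univ ×ˢ pencil σ] (x, z)) (pencil σ) := by
    intro u hu w hw
    obtain ⟨t, ht, he⟩ := h u hu w hw
    exact ⟨t, ht, (continuous_fst.tendsto (x, z)).mono_left nhdsWithin_le_nhds |>.eventually he⟩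
  exact hT.tendsto_comp hc.continuousWithinAt hz
    (tendsto_nhdsWithin_iff.2 ⟨(continuous_snd.tendsto (x, z)).mono_left nhdsWithin_le_nhds,
      eventually_nhdsWithin_of_forall fun p hp => hp.2⟩)

lemma IsHoloOn.continuous_left (hf : IsHoloOn σ f) {z : ℂ} (hz : z ∈ pencil σ) :
    Continuous fun x => f x z := by
  rw [← continuousOn_univ]
  exact hf.cont.comp (f := fun x : ℝ => (x, z)) (by fun_prop) fun x _ => ⟨trivial, hz⟩

lemma IsHoloOn.conormal (hσ : 0 < σ) (hf : IsHoloOn σ f) : IsHoloOn σ (conormal f) where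
  periodic z hz x := by
    have : f (x + 2 * π) =ᶠ[𝓝 z] f x := by
      filter_upwards [(isOpen_pencil σ).mem_nhds hz] with w hw using hf.periodic w hw x
    simp only [_root_.conormal, this.deriv_eq]
  cont := ((differentiableOn_psi hσ).continuousOn.comp continuousOn_snd fun p hp => hp.2).mul
    hf.continuousOn_deriv
  holo x := conD_differentiableOn hσ (hf.holo x)

lemma IsHoloOn.iterate_conormal (hσ : 0 < σ) (l : ℕ) : ∀ {f}, IsHoloOn σ f →
    IsHoloOn σ (_root_.conormal^[l] f) := by
  induction l with
  | zero => intro f h; simpa using h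
  | succ l ih => intro f h; exact ih (h.conormal hσ)

lemma IsHoloOn.hasDerivAt_mode (hf : IsHoloOn σ f) (α : ℤ) {z : ℂ} (hz : z ∈ pencil σ) :
    HasDerivAt (mode f α) (coeff (fun x => deriv (f x) z) α) z := by
  obtain ⟨ε, hε, hb⟩ := Metric.isOpen_iff.1 (isOpen_pencil σ) z hz
  have hK : Metric.closedBall z (ε / 2) ⊆ pencil σ :=
    (Metric.closedBall_subset_ball (by linarith)).trans hb
  have hcd := hf.continuousOn_deriv
  -- A constant dominates the derivative of the integrand, by compactness of one period times a
  -- closed disc.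
  obtain ⟨B, hB⟩ := (isCompact_uIcc (a := (0 : ℝ)) (b := 2 * π)).prod
    (isCompact_closedBall z (ε / 2)) |>.exists_bound_of_continuousOn
      (hcd.mono (prod_mono (subset_univ _) hK))
  have hker : Continuous fun x : ℝ => Complex.exp (-(Complex.I * α * x)) := by fun_prop
  have hne : ∀ x : ℝ, ‖Complex.exp (-(Complex.I * α * x))‖ = 1 := fun x => by
    have := norm_chr (-α) x
    rw [chr] at this; rw [← this]; congr 2; push_cast; ring
  have := intervalIntegral.hasDerivAt_integral_of_dominated_loc_of_deriv_le
    (μ := volume) (a := 0) (b := 2 * π) (x₀ := z) (s := Metric.ball z (ε / 2))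
    (F := fun w x => f x w * Complex.exp (-(Complex.I * α * x)))
    (F' := fun w x => deriv (f x) w * Complex.exp (-(Complex.I * α * x)))
    (bound := fun _ => B) (Metric.ball_mem_nhds z (by linarith)) ?_ ?_ ?_ ?_ (by simp) ?_
  · exact this.2.const_mul _
  · filter_upwards [(isOpen_pencil σ).mem_nhds hz] with w hw
    exact ((hf.continuous_left hw).mul hker).aestronglyMeasurable
  · exact ((hf.continuous_left hz).mul hker).intervalIntegrable _ _
  · refine Continuous.aestronglyMeasurable (Continuous.mul ?_ hker)
    rw [← continuousOn_univ]
    exact hcd.comp (f := fun x : ℝ => (x, z)) (by fun_prop) fun x _ => ⟨trivial, hz⟩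
  · refine Eventually.of_forall fun x hx w hw => ?_
    rw [norm_mul, hne, mul_one]
    exact hB (x, w) ⟨uIoc_subset_uIcc hx, Metric.ball_subset_closedBall hw⟩
  · refine Eventually.of_forall fun x hx w hw => ?_
    exact (((hf.holo x).differentiableAt ((isOpen_pencil σ).mem_nhds
      (hK (Metric.ball_subset_closedBall hw)))).hasDerivAt).mul_const _

lemma coeff_const_mul (c : ℂ) (g : ℝ → ℂ) (α : ℤ) :
    coeff (fun x => c * g x) α = c * coeff g α := by
  simp only [coeff, mul_assoc, intervalIntegral.integral_const_mul]; ring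

lemma IsHoloOn.mode_differentiableOn (hf : IsHoloOn σ f) (α : ℤ) :
    DifferentiableOn ℂ (mode f α) (pencil σ) := fun _ hz =>
  (hf.hasDerivAt_mode α hz).differentiableAt.differentiableWithinAt

lemma IsHoloOn.mode_conormal (hf : IsHoloOn σ f) (α : ℤ) :
    EqOn (mode (_root_.conormal f) α) (conD (mode f α)) (pencil σ) := fun z hz => by
  simp only [conD, (hf.hasDerivAt_mode α hz).deriv]
  exact coeff_const_mul _ _ _

lemma IsHoloOn.mode_iterate_conormal (hσ : 0 < σ) (α : ℤ) (l : ℕ) : ∀ {f}, IsHoloOn σ f →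
    EqOn (mode (_root_.conormal^[l] f) α) (conD^[l] (mode f α)) (pencil σ) := by
  induction l with
  | zero => intro f _ z _; simp
  | succ l ih =>
    intro f h z hz
    rw [Function.iterate_succ_apply, ih (h.conormal hσ) hz, Function.iterate_succ_apply]
    exact iterate_conD_eqOn l (h.mode_conormal α) hz

lemma iterate_dX_apply (j : ℕ) : ∀ (f : ℝ → ℂ → ℂ) (x : ℝ) (z : ℂ),
    dX^[j] f x z = deriv^[j] (fun x => f x z) x := by
  induction j with
  | zero => intro f x z; simp
  | succ j ih => intro f x z; rw [Function.iterate_succ_apply, ih, Function.iterate_succ_apply]; rfl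

lemma IsHoloOn.mode_iterate_dX (hf : IsHoloOn σ f) {z : ℂ} (hz : z ∈ pencil σ)
    (h : RapidDecay fun α => mode f α z) (j : ℕ) (α : ℤ) :
    mode (dX^[j] f) α z = (Complex.I * α) ^ j * mode f α z := by
  rw [mode, coeff_congr fun x => iterate_dX_apply j f x z]
  exact RapidDecay.coeff_iterate_deriv j (hf.continuous_left hz) (hf.periodic z hz) h α

end

noncomputable section

/-! ### The complementary error function -/

/-- `π^{-1/2} ∫_0^∞ e^{-(ξ+w)²} dw`, half the complementary error function. -/
def gaussTail (ξ : ℂ) : ℂ := ((√π)⁻¹ : ℝ) * ∫ w in Ioi (0 : ℝ), Complex.exp (-(ξ + w) ^ 2)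

/-- Re (ξ + w)² ≥ w²/2 − |ξ|², with slack (2 Re ξ + w)²/2. The bound is uniform for ξ in a disc, as
domination requires. -/
lemma norm_exp_neg_sq_le {B : ℝ} {ξ : ℂ} (hξ : ‖ξ‖ ≤ B) (w : ℝ) :
    ‖Complex.exp (-(ξ + w) ^ 2)‖ ≤ exp (B ^ 2) * exp (-(1 / 2) * w ^ 2) := by
  rw [Complex.norm_exp, ← Real.exp_add]
  apply Real.exp_le_exp.2
  have h1 : (-(ξ + w) ^ 2).re = -((ξ.re + w) ^ 2 - ξ.im ^ 2) := by
    simp [pow_two]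
  have h2 : ξ.re ^ 2 + ξ.im ^ 2 ≤ B ^ 2 := by
    have := Complex.sq_norm ξ
    rw [Complex.normSq_apply] at this
    nlinarith [pow_le_pow_left₀ (norm_nonneg ξ) hξ 2]
  rw [h1]
  nlinarith [sq_nonneg (2 * ξ.re + w)]

lemma integrable_gauss_bound (B : ℝ) :
    Integrable fun w : ℝ => 2 * (B + |w|) * (exp (B ^ 2) * exp (-(1 / 2) * w ^ 2)) := by
  have h0 : Integrable fun w : ℝ => exp (-(1 / 2) * w ^ 2) := integrable_exp_neg_mul_sq (by norm_num)
  have h1 : Integrable fun w : ℝ => w * exp (-(1 / 2) * w ^ 2) :=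
    integrable_mul_exp_neg_mul_sq (by norm_num)
  refine ((h0.const_mul (2 * B * exp (B ^ 2))).add (h1.norm.const_mul (2 * exp (B ^ 2)))).congr
    (Eventually.of_forall fun w => ?_)
  simp only [Pi.add_apply, norm_mul, Real.norm_eq_abs, abs_of_pos (exp_pos _)]
  ring

lemma integrable_exp_neg_sq (ξ : ℂ) : Integrable fun w : ℝ => Complex.exp (-(ξ + w) ^ 2) := by
  refine Integrable.mono' ((integrable_exp_neg_mul_sq (b := 1 / 2) (by norm_num)).const_mul
    (exp (‖ξ‖ ^ 2))) (by fun_prop) (Eventually.of_forall fun w => ?_)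
  exact norm_exp_neg_sq_le le_rfl w

lemma hasDerivAt_exp_neg_sq (ξ : ℂ) :
    HasDerivAt (fun ξ : ℂ => Complex.exp (-ξ ^ 2)) (-2 * ξ * Complex.exp (-ξ ^ 2)) ξ := by
  refine ((hasDerivAt_pow 2 ξ).neg.cexp).congr_deriv ?_
  simp; ring

lemma norm_deriv_exp_neg_sq_le {B : ℝ} {ξ : ℂ} (hξ : ‖ξ‖ ≤ B) (w : ℝ) :
    ‖-2 * (ξ + w) * Complex.exp (-(ξ + w) ^ 2)‖
      ≤ 2 * (B + |w|) * (exp (B ^ 2) * exp (-(1 / 2) * w ^ 2)) := by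
  rw [norm_mul]
  have hB := (norm_nonneg ξ).trans hξ
  refine mul_le_mul ?_ (norm_exp_neg_sq_le hξ w) (norm_nonneg _) (by positivity)
  rw [norm_mul]
  have : ‖ξ + (w : ℂ)‖ ≤ B + |w| := (norm_add_le _ _).trans (by simpa using hξ)
  simpa using this

/-- The integrand depends on ξ + w only, so its ξ-derivative is also its w-derivative and integrates
to the value at w = 0. -/
lemma hasDerivAt_gaussTail (ξ : ℂ) :
    HasDerivAt gaussTail (-((√π)⁻¹ : ℝ) * Complex.exp (-ξ ^ 2)) ξ := by
  have hB : ∀ z ∈ Metric.ball ξ 1, ‖z‖ ≤ ‖ξ‖ + 1 := fun z hz => by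
    have : ‖z - ξ‖ < 1 := by simpa [dist_eq_norm] using hz
    linarith [norm_le_norm_add_norm_sub' z ξ]
  have hd := hasDerivAt_integral_of_dominated_loc_of_deriv_le (μ := volume.restrict (Ioi (0 : ℝ)))
    (F := fun z (w : ℝ) => Complex.exp (-(z + w) ^ 2)) (x₀ := ξ) (s := Metric.ball ξ 1)
    (F' := fun z (w : ℝ) => -2 * (z + w) * Complex.exp (-(z + w) ^ 2))
    (bound := fun w => 2 * ((‖ξ‖ + 1) + |w|) * (exp ((‖ξ‖ + 1) ^ 2) * exp (-(1 / 2) * w ^ 2)))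
    (Metric.ball_mem_nhds _ one_pos)
    (Eventually.of_forall fun z => by fun_prop)
    (integrable_exp_neg_sq ξ).integrableOn (by fun_prop)
    (Eventually.of_forall fun w z hz => norm_deriv_exp_neg_sq_le (hB z hz) w)
    (integrable_gauss_bound _).integrableOn
    (Eventually.of_forall fun w z _ => by
      simpa using (hasDerivAt_exp_neg_sq (z + w)).comp_add_const z (w : ℂ))
  have hreal : ∀ w : ℝ, HasDerivAt (fun w : ℝ => Complex.exp (-(ξ + w) ^ 2))
      (-2 * (ξ + w) * Complex.exp (-(ξ + w) ^ 2)) w := fun w => by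
    have := (hasDerivAt_exp_neg_sq (ξ + w)).comp_const_add ξ (w : ℂ)
    exact this.comp_ofReal
  have hlim := tendsto_zero_of_hasDerivAt_of_integrableOn_Ioi (a := 0) (fun w _ => hreal w)
    hd.1 (integrable_exp_neg_sq ξ).integrableOn
  have h_integrable := integral_Ioi_of_hasDerivAt_of_tendsto' (a := 0) (fun w _ => hreal w) hd.1 hlim
  refine (hd.2.const_mul (((√π)⁻¹ : ℝ) : ℂ)).congr_deriv ?_
  rw [h_integrable]; simp

/-! ### The kernels as functions of `y ± z` -/

/-- The heat kernel of mode `α` on the line. -/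
def heatE (ν : ℝ) (α : ℤ) (t : ℝ) (ζ : ℂ) : ℂ :=
  Complex.exp (-((α : ℂ) ^ 2 * ν * t)) * heatKernel (ν * t) ζ

/-- The residual kernel of mode `α` as a function of `ζ = y + z`. -/
def resE (ν : ℝ) (α : ℤ) (t : ℝ) (ζ : ℂ) : ℂ :=
  2 * ((|α| : ℤ) : ℂ) * Complex.exp (-((α : ℂ) ^ 2 * ν * t)) *
    ∫ w in Ioi (0 : ℝ), Complex.exp (((|α| : ℤ) : ℂ) * w) * heatKernel (ν * t) (ζ + w)

lemma stokesGreen_eq (ν : ℝ) (α : ℤ) (t : ℝ) (y z : ℂ) : stokesGreen ν α t y z =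
    heatE ν α t (y - z) + heatE ν α t (y + z) + resE ν α t (y + z) := by
  simp only [stokesGreen, neumannKernel, residualKernel, heatE, resE]; ring

variable {ν t : ℝ}

lemma abs_cast_sq (α : ℤ) : (((|α| : ℤ) : ℂ)) ^ 2 = (α : ℂ) ^ 2 := by
  rw [← Int.cast_pow, sq_abs, Int.cast_pow]

lemma sq_ofReal_sqrt {τ : ℝ} (h : 0 ≤ τ) : ((√τ : ℝ) : ℂ) ^ 2 = τ := by
  rw [← Complex.ofReal_pow, Real.sq_sqrt h]

/-- Completing the square, with τ = νt and a = |α|: aw − (ζ+w)²/(4τ) = −aζ + a²τ − (ξ + w/(2√τ))²,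
where ξ = (ζ − 2aτ)/(2√τ). The factor e^{a²τ} cancels the prefactor e^{−α²νt}, and rescaling w by
2√τ cancels the normalization of the heat kernel. -/
lemma resE_eq (hν : 0 < ν) (ht : 0 < t) (α : ℤ) (ζ : ℂ) :
    resE ν α t ζ = 2 * ((|α| : ℤ) : ℂ) * Complex.exp (-((|α| : ℤ) : ℂ) * ζ) *
      gaussTail ((ζ - 2 * ((|α| : ℤ) : ℂ) * (ν * t : ℝ)) / (2 * (√(ν * t) : ℝ))) := by
  have hτ : 0 < ν * t := mul_pos hν ht
  rw [resE, gaussTail]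
  set a : ℂ := ((|α| : ℤ) : ℂ) with ha
  set τ : ℝ := ν * t with hτd
  have hs : 0 < √τ := Real.sqrt_pos.2 hτ
  have hsc : ((√τ : ℝ) : ℂ) ≠ 0 := by exact_mod_cast hs.ne'
  have hsq := sq_ofReal_sqrt hτ.le
  set ξ : ℂ := (ζ - 2 * a * (τ : ℂ)) / (2 * (√τ : ℝ)) with hξ
  have hα : (α : ℂ) ^ 2 * ν * t = a ^ 2 * τ := by rw [ha, abs_cast_sq, hτd]; push_cast; ring
  have hpt : ∀ w : ℝ, Complex.exp (a * w) * heatKernel τ (ζ + w) =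
      (((√(4 * π * τ))⁻¹ : ℝ) : ℂ) * (Complex.exp (-a * ζ) * Complex.exp (a ^ 2 * τ)) *
        Complex.exp (-(ξ + ((2 * √τ)⁻¹ * w : ℝ)) ^ 2) := by
    intro w
    rw [heatKernel, mul_left_comm, ← Complex.exp_add, ← Complex.exp_add,
      mul_assoc (((√(4 * π * τ))⁻¹ : ℝ) : ℂ), ← Complex.exp_add]
    congr 2
    rw [hξ]; push_cast; rw [← hsq]
    field_simp
    ring
  simp_rw [hpt]
  rw [integral_const_mul]
  have hcv := MeasureTheory.integral_comp_mul_left_Ioi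
    (fun w : ℝ => Complex.exp (-(ξ + (w : ℂ)) ^ 2)) 0 (b := (2 * √τ)⁻¹) (by positivity)
  rw [hcv, mul_zero, hα, inv_inv, Complex.real_smul]
  have h4 : √(4 * π * τ) = 2 * √π * √τ := by
    rw [show 4 * π * τ = 2 ^ 2 * (π * τ) by ring, Real.sqrt_mul (by norm_num),
      Real.sqrt_sq (by norm_num), Real.sqrt_mul pi_nonneg]; ring
  have he : Complex.exp (-(a ^ 2 * τ)) * Complex.exp (a ^ 2 * τ) = 1 := by
    rw [← Complex.exp_add]; simp
  have hpi : ((√π : ℝ) : ℂ) ≠ 0 := by exact_mod_cast (Real.sqrt_pos.2 pi_pos).ne'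
  rw [h4]
  push_cast
  field_simp
  linear_combination a *
    (∫ w in Ioi (0 : ℝ), Complex.exp (-(ξ + (w : ℂ)) ^ 2)) * he

/-- The same completed square read at w = 0: differentiating the error function in the closed form
of `resE` gives back the heat kernel. -/
lemma heatE_eq_gauss (hν : 0 < ν) (ht : 0 < t) (α : ℤ) (ζ : ℂ) :
    ((√π)⁻¹ : ℝ) * Complex.exp (-((|α| : ℤ) : ℂ) * ζ) * Complex.exp
      (-((ζ - 2 * ((|α| : ℤ) : ℂ) * (ν * t : ℝ)) / (2 * (√(ν * t) : ℝ))) ^ 2) =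
    2 * (√(ν * t) : ℝ) * heatE ν α t ζ := by
  have hτ : 0 < ν * t := mul_pos hν ht
  rw [heatE, heatKernel]
  set a : ℂ := ((|α| : ℤ) : ℂ) with ha
  have hα : (α : ℂ) ^ 2 * ν * t = a ^ 2 * (ν * t : ℝ) := by rw [ha, abs_cast_sq]; push_cast; ring
  rw [hα]
  set τ : ℝ := ν * t with hτd
  have hs : 0 < √τ := Real.sqrt_pos.2 hτ
  have hsc : ((√τ : ℝ) : ℂ) ≠ 0 := by exact_mod_cast hs.ne'
  have hsq := sq_ofReal_sqrt hτ.le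
  have h4 : √(4 * π * τ) = 2 * √π * √τ := by
    rw [show 4 * π * τ = 2 ^ 2 * (π * τ) by ring, Real.sqrt_mul (by norm_num),
      Real.sqrt_sq (by norm_num), Real.sqrt_mul pi_nonneg]; ring
  have hpi : ((√π : ℝ) : ℂ) ≠ 0 := by exact_mod_cast (Real.sqrt_pos.2 pi_pos).ne'
  rw [mul_assoc, ← Complex.exp_add, mul_left_comm (Complex.exp _), ← Complex.exp_add, h4]
  have : -a * ζ + -((ζ - 2 * a * τ) / (2 * (√τ : ℝ))) ^ 2 = -(a ^ 2 * τ) + -ζ ^ 2 / (4 * τ) := by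
    rw [← hsq]; field_simp; ring
  rw [this]
  push_cast
  field_simp

lemma hasDerivAt_heatE (α : ℤ) (ζ : ℂ) (hτ : ν * t ≠ 0) :
    HasDerivAt (heatE ν α t) (-(ζ / (2 * (ν * t : ℝ))) * heatE ν α t ζ) ζ := by
  have hc : ((ν * t : ℝ) : ℂ) ≠ 0 := by exact_mod_cast hτ
  have h := ((((hasDerivAt_pow 2 ζ).neg.div_const (4 * ((ν * t : ℝ) : ℂ))).cexp).const_mul
    (((√(4 * π * (ν * t)))⁻¹ : ℝ) : ℂ)).const_mul (Complex.exp (-((α : ℂ) ^ 2 * ν * t)))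
  refine h.congr_deriv ?_
  simp only [heatE, heatKernel]
  field_simp
  simp
  ring_nf

lemma differentiable_heatE (hν : 0 < ν) (ht : 0 < t) (α : ℤ) : Differentiable ℂ (heatE ν α t) :=
  fun ζ => (hasDerivAt_heatE α ζ (mul_pos hν ht).ne').differentiableAt

/-- The product rule on the closed form: the exponential contributes the multiple of the residual
kernel, the error function the multiple of the heat kernel. This equation encodes the boundary
condition. -/
lemma hasDerivAt_resE (hν : 0 < ν) (ht : 0 < t) (α : ℤ) (ζ : ℂ) :
    HasDerivAt (resE ν α t)
      (-(((|α| : ℤ) : ℂ) * resE ν α t ζ) - 2 * ((|α| : ℤ) : ℂ) * heatE ν α t ζ) ζ := by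
  have hg := heatE_eq_gauss hν ht α ζ
  have hs : 0 < √(ν * t) := Real.sqrt_pos.2 (mul_pos hν ht)
  have hsc : ((√(ν * t) : ℝ) : ℂ) ≠ 0 := by exact_mod_cast hs.ne'
  rw [show resE ν α t = _ from funext (resE_eq hν ht α)]
  set a : ℂ := ((|α| : ℤ) : ℂ) with ha
  have h1 : HasDerivAt (fun ζ : ℂ => Complex.exp (-a * ζ)) (Complex.exp (-a * ζ) * -a) ζ := by
    simpa using ((hasDerivAt_id ζ).const_mul (-a)).cexp
  have h2 := (hasDerivAt_gaussTail ((ζ - 2 * a * (ν * t : ℝ)) / (2 * (√(ν * t) : ℝ)))).comp ζ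
    (((hasDerivAt_id ζ).sub_const (2 * a * (ν * t : ℝ))).div_const (2 * (√(ν * t) : ℝ)))
  refine ((h1.const_mul (2 * a)).mul h2).congr_deriv ?_
  have hE : heatE ν α t ζ = (2 * ((√(ν * t) : ℝ) : ℂ))⁻¹ * (((√π)⁻¹ : ℝ) * Complex.exp (-a * ζ) *
      Complex.exp (-((ζ - 2 * a * (ν * t : ℝ)) / (2 * (√(ν * t) : ℝ))) ^ 2)) := by
    rw [hg]; field_simp
  rw [hE]
  simp only [Function.comp, id]
  ring

lemma differentiable_resE (hν : 0 < ν) (ht : 0 < t) (α : ℤ) : Differentiable ℂ (resE ν α t) :=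
  fun ζ => (hasDerivAt_resE hν ht α ζ).differentiableAt

/-- The factor ζ²/(4τ²) − 1/(2τ) is the one produced by ∂_ζ², so the formula is already in the form
required by the heat equation. -/
lemma hasDerivAt_time_heatE (hν : 0 < ν) (ht : 0 < t) (α : ℤ) (ζ : ℂ) :
    HasDerivAt (fun t => heatE ν α t ζ)
      (ν * ((ζ ^ 2 / (4 * (ν * t : ℝ) ^ 2) - 1 / (2 * (ν * t : ℝ))) * heatE ν α t ζ
        - (α : ℂ) ^ 2 * heatE ν α t ζ)) t := by
  have hτ : 0 < ν * t := mul_pos hν ht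
  have hp : 0 < 4 * π * (ν * t) := by positivity
  have hs : 0 < √(4 * π * (ν * t)) := Real.sqrt_pos.2 hp
  have hlin : HasDerivAt (fun s : ℝ => 4 * π * (ν * s)) (4 * π * ν) t := by
    simpa [mul_assoc] using ((hasDerivAt_id t).const_mul ν).const_mul (4 * π)
  have h1 : HasDerivAt (fun s : ℝ => (√(4 * π * (ν * s)))⁻¹)
      (-(2 * t)⁻¹ * (√(4 * π * (ν * t)))⁻¹) t := by
    refine ((hlin.sqrt hp.ne').inv hs.ne').congr_deriv ?_
    rw [Real.sq_sqrt hp.le]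
    field_simp
  have hid : HasDerivAt (fun s : ℝ => (s : ℂ)) 1 t := Complex.ofRealCLM.hasDerivAt
  have hνc : (ν : ℂ) ≠ 0 := by exact_mod_cast hν.ne'
  have htc : (t : ℂ) ≠ 0 := by exact_mod_cast ht.ne'
  have h2 : HasDerivAt (fun s : ℝ => Complex.exp (-((α : ℂ) ^ 2 * ν * s)))
      (Complex.exp (-((α : ℂ) ^ 2 * ν * t)) * -((α : ℂ) ^ 2 * ν)) t := by
    simpa using (hid.const_mul ((α : ℂ) ^ 2 * ν)).neg.cexp
  have h3 : HasDerivAt (fun s : ℝ => Complex.exp (-(ζ ^ 2) / (4 * ((ν * s : ℝ) : ℂ))))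
      (Complex.exp (-(ζ ^ 2) / (4 * ((ν * t : ℝ) : ℂ))) * (ζ ^ 2 / (4 * ν * t ^ 2))) t := by
    have hd : HasDerivAt (fun s : ℝ => (4 * ((ν * s : ℝ) : ℂ))) (4 * ν) t := by
      simpa [mul_assoc] using (hid.const_mul (4 * (ν : ℂ)))
    refine (((hasDerivAt_const t (-(ζ ^ 2))).fun_div hd
      (by push_cast; simp [hνc, htc])).cexp).congr_deriv ?_
    push_cast
    field_simp
    ring
  refine (h2.fun_mul ((h1.ofReal_comp).fun_mul h3)).congr_deriv ?_
  simp only [heatE, heatKernel]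
  push_cast
  field_simp
  ring

/-- Time enters the closed form only through the argument of the error function, so only the heat
kernel appears. The result is ν(R'' − α²R), as seen by applying `hasDerivAt_resE` twice. -/
lemma hasDerivAt_time_resE (hν : 0 < ν) (ht : 0 < t) (α : ℤ) (ζ : ℂ) :
    HasDerivAt (fun t => resE ν α t ζ)
      (ν * (2 * ((|α| : ℤ) : ℂ) * (ζ / (2 * (ν * t : ℝ)) + ((|α| : ℤ) : ℂ)) * heatE ν α t ζ)) t := by
  have hg := heatE_eq_gauss hν ht α ζ
  have hτ := mul_pos hν ht
  have hs : 0 < √(ν * t) := Real.sqrt_pos.2 hτ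
  have hsc : ((√(ν * t) : ℝ) : ℂ) ≠ 0 := by exact_mod_cast hs.ne'
  have hsq := sq_ofReal_sqrt hτ.le
  have hνc : (ν : ℂ) ≠ 0 := by exact_mod_cast hν.ne'
  have htc : (t : ℂ) ≠ 0 := by exact_mod_cast ht.ne'
  have hev : (fun t => resE ν α t ζ) =ᶠ[𝓝 t] fun t => 2 * ((|α| : ℤ) : ℂ) *
      Complex.exp (-((|α| : ℤ) : ℂ) * ζ) *
      gaussTail ((ζ - 2 * ((|α| : ℤ) : ℂ) * (ν * t : ℝ)) / (2 * (√(ν * t) : ℝ))) := by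
    filter_upwards [lt_mem_nhds ht] with s hs using resE_eq hν hs α ζ
  refine HasDerivAt.congr_of_eventuallyEq ?_ hev
  set a : ℂ := ((|α| : ℤ) : ℂ) with ha
  have hlin : HasDerivAt (fun s : ℝ => ν * s) ν t := by
    simpa using (hasDerivAt_id t).const_mul ν
  have hn : HasDerivAt (fun s : ℝ => ζ - 2 * a * ((ν * s : ℝ) : ℂ)) (-(2 * a * ν)) t := by
    simpa using (hlin.ofReal_comp.const_mul (2 * a)).const_sub ζ
  have hd : HasDerivAt (fun s : ℝ => (2 * (√(ν * s) : ℝ) : ℂ))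
      (2 * ((ν / (2 * √(ν * t)) : ℝ) : ℂ)) t :=
    (hlin.sqrt hτ.ne').ofReal_comp.const_mul 2
  have hq := hn.div hd (by simp [hsc])
  have h2 := HasDerivAt.comp t
    (hasDerivAt_gaussTail ((ζ - 2 * a * (ν * t : ℝ)) / (2 * (√(ν * t) : ℝ)))) hq
  refine (h2.const_mul (2 * a * Complex.exp (-a * ζ))).congr_deriv ?_
  have hE : heatE ν α t ζ = (2 * ((√(ν * t) : ℝ) : ℂ))⁻¹ * (((√π)⁻¹ : ℝ) * Complex.exp (-a * ζ) *
      Complex.exp (-((ζ - 2 * a * (ν * t : ℝ)) / (2 * (√(ν * t) : ℝ))) ^ 2)) := by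
    rw [hg]; field_simp
  rw [hE]
  generalize Complex.exp (-((ζ - 2 * a * (ν * t : ℝ)) / (2 * (√(ν * t) : ℝ))) ^ 2) = e1
  generalize Complex.exp (-a * ζ) = e2
  push_cast
  rw [Complex.ofReal_mul] at hsq
  rw [← hsq]
  field_simp
  ring

end

noncomputable section

/-! ### Bounds of the kernels on cones -/

/-- The closed cone `|Im ζ| ≤ σ Re ζ`. -/
def cone (σ : ℝ) : Set ℂ := {ζ | |ζ.im| ≤ σ * ζ.re}

lemma cone_re_nonneg {σ : ℝ} (hσ : 0 < σ) {ζ : ℂ} (h : ζ ∈ cone σ) : 0 ≤ ζ.re :=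
  nonneg_of_mul_nonneg_right ((abs_nonneg _).trans h) hσ

lemma cone_im_sq {σ : ℝ} {ζ : ℂ} (h : ζ ∈ cone σ) : ζ.im ^ 2 ≤ σ ^ 2 * ζ.re ^ 2 := by
  have : |ζ.im| ≤ σ * ζ.re := h
  rw [← sq_abs, ← mul_pow]
  exact pow_le_pow_left₀ (abs_nonneg _) this 2

variable {ν t : ℝ}

lemma norm_heatKernel {τ : ℝ} (ζ : ℂ) :
    ‖heatKernel τ ζ‖ = (√(4 * π * τ))⁻¹ * exp (-(ζ.re ^ 2 - ζ.im ^ 2) / (4 * τ)) := by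
  have h4 : (-(ζ ^ 2) / (4 * (τ : ℂ))).re = -(ζ.re ^ 2 - ζ.im ^ 2) / (4 * τ) := by
    rw [show (4 * (τ : ℂ)) = ((4 * τ : ℝ) : ℂ) by push_cast; ring, Complex.div_ofReal_re]
    simp [pow_two]
  rw [heatKernel, norm_mul, Complex.norm_exp, Complex.norm_real, h4, Real.norm_of_nonneg (by positivity)]

lemma norm_exp_mode (ν : ℝ) (α : ℤ) (t : ℝ) :
    ‖Complex.exp (-((α : ℂ) ^ 2 * ν * t))‖ = exp (-(|(α : ℝ)| ^ 2 * (ν * t))) := by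
  have : -((α : ℂ) ^ 2 * ν * t) = ((-((α : ℝ) ^ 2 * (ν * t)) : ℝ) : ℂ) := by push_cast; ring
  rw [this, Complex.norm_exp, Complex.ofReal_re, sq_abs]

lemma inv_sqrt_four_pi_le {τ : ℝ} (hτ : 0 < τ) : (√(4 * π * τ))⁻¹ ≤ (√τ)⁻¹ := by
  apply inv_anti₀ (Real.sqrt_pos.2 hτ)
  apply Real.sqrt_le_sqrt
  nlinarith [pi_gt_three]

lemma norm_heatE_le (hν : 0 < ν) (ht : 0 < t) (α : ℤ) (ζ : ℂ) :
    ‖heatE ν α t ζ‖ ≤ (√(ν * t))⁻¹ * exp (-(ζ.re ^ 2 - ζ.im ^ 2) / (4 * (ν * t))) := by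
  have hτ := mul_pos hν ht
  rw [heatE, norm_mul, norm_exp_mode, norm_heatKernel]
  have h1 : exp (-(|(α : ℝ)| ^ 2 * (ν * t))) ≤ 1 := by
    rw [Real.exp_le_one_iff]; have := mul_nonneg (sq_nonneg |(α : ℝ)|) hτ.le; linarith
  have h2 := inv_sqrt_four_pi_le hτ
  calc _ ≤ 1 * ((√(ν * t))⁻¹ * exp (-(ζ.re ^ 2 - ζ.im ^ 2) / (4 * (ν * t)))) := by gcongr
    _ = _ := one_mul _

/-- On the cone Re ζ² = (Re ζ)² − (Im ζ)² ≥ (1 − σ²)(Re ζ)². -/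
lemma norm_heatE_cone_le (hν : 0 < ν) (ht : 0 < t) (α : ℤ) {σ : ℝ} {ζ : ℂ} (hζ : ζ ∈ cone σ) :
    ‖heatE ν α t ζ‖ ≤ (√(ν * t))⁻¹ * exp (-((1 - σ ^ 2) / 4 * (ζ.re ^ 2 / (ν * t)))) := by
  have hτ := mul_pos hν ht
  refine (norm_heatE_le hν ht α ζ).trans ?_
  have h := cone_im_sq hζ
  gcongr
  rw [div_le_iff₀ (by positivity)]
  field_simp
  linarith

lemma integral_shift_gauss_le {c m : ℝ} (hc : 0 < c) :
    ∫ w in Ioi (0 : ℝ), exp (-c * (w - m) ^ 2) ≤ √(π / c) := by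
  have hi : Integrable fun w : ℝ => exp (-c * (w - m) ^ 2) :=
    (integrable_exp_neg_mul_sq hc).comp_sub_right m
  refine (setIntegral_le_integral hi (Eventually.of_forall fun _ => (exp_pos _).le)).trans ?_
  rw [integral_sub_right_eq_self (fun w : ℝ => exp (-c * w ^ 2)) m, integral_gaussian]

/-- The growth e^{aw} and the Gaussian in ζ + w combine into a Gaussian in w centred at 2aτ, times
e^{a²τ}, which the prefactor cancels, times decay in X = Re ζ. Integrating over w removes the factor
τ^{-1/2}, so the bound has size |α| uniformly in νt. -/
lemma norm_resE_cone_le (hν : 0 < ν) (ht : 0 < t) (α : ℤ) {σ : ℝ} (hσ : 0 < σ) (hσ1 : σ < 1)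
    {ζ : ℂ} (hζ : ζ ∈ cone σ) :
    ‖resE ν α t ζ‖ ≤ 2 * |(α : ℝ)| * √(2 / (1 - σ ^ 2)) * exp (-((1 - σ ^ 2) *
      (|(α : ℝ)| * ζ.re / 2 + ζ.re ^ 2 / (8 * (ν * t))))) := by
  have hτ := mul_pos hν ht
  have hX := cone_re_nonneg hσ hζ
  have him := cone_im_sq hζ
  rw [resE, norm_mul, norm_mul, norm_mul, norm_exp_mode]
  set a : ℝ := |(α : ℝ)| with ha
  set τ := ν * t
  have ha0 : 0 ≤ a := abs_nonneg _
  have hac : ((|α| : ℤ) : ℂ) = (a : ℂ) := by rw [ha, ← Int.cast_abs, Complex.ofReal_intCast]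
  have hna : ‖((|α| : ℤ) : ℂ)‖ = a := by rw [hac, Complex.norm_real, Real.norm_of_nonneg ha0]
  have hκ : 0 < 1 - σ ^ 2 := by nlinarith
  set κ := 1 - σ ^ 2 with hκd
  set X := ζ.re
  have hpt : ∀ w ∈ Ioi (0 : ℝ), ‖Complex.exp (((|α| : ℤ) : ℂ) * w) * heatKernel τ (ζ + w)‖ ≤
      (exp (a ^ 2 * τ) * (√(4 * π * τ))⁻¹ * exp (-(κ * (a * X / 2 + X ^ 2 / (8 * τ))))) *
        exp (-(κ / (8 * τ)) * (w - 2 * a * τ) ^ 2) := by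
    intro w hw
    have hw : 0 < w := hw
    rw [norm_mul, norm_heatKernel, hac, ← Complex.ofReal_mul, Complex.norm_exp, Complex.ofReal_re]
    rw [show ∀ p q r : ℝ, exp p * (q * exp r) = q * exp (p + r) from
        fun p q r => by rw [Real.exp_add]; ring,
      show ∀ p q r s : ℝ, exp p * q * exp r * exp s = q * exp (p + r + s) from
        fun p q r s => by rw [Real.exp_add, Real.exp_add]; ring]
    refine mul_le_mul_of_nonneg_left (Real.exp_le_exp.2 ?_) (by positivity)
    simp only [Complex.add_re, Complex.ofReal_re, Complex.add_im, Complex.ofReal_im, add_zero]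
    have h1 : a * w + -((X + w) ^ 2 - ζ.im ^ 2) / (4 * τ) =
        (8 * a * τ * w - 2 * (X + w) ^ 2 + 2 * ζ.im ^ 2) / (8 * τ) := by field_simp; ring
    have h2 : a ^ 2 * τ + -(κ * (a * X / 2 + X ^ 2 / (8 * τ))) +
        -(κ / (8 * τ)) * (w - 2 * a * τ) ^ 2 =
        (8 * a ^ 2 * τ ^ 2 - κ * (4 * a * X * τ + X ^ 2) - κ * (w - 2 * a * τ) ^ 2) / (8 * τ) := by
      field_simp; ring
    rw [h1, h2]
    gcongr
    have hκ1 : 0 ≤ σ ^ 2 := sq_nonneg _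
    -- With m = 2aτ and (Im ζ)² ≤ σ²X², the difference of the two sides is at least κ((X+w−m)² +
    -- 2Xw) + 2σ²((w−m)² + 2Xw).
    have e1 : 0 ≤ κ * (X + w - 2 * a * τ) ^ 2 := by positivity
    have e2 : 0 ≤ κ * (2 * X * w) := by positivity
    have e3 : 0 ≤ σ ^ 2 * (w - 2 * a * τ) ^ 2 := by positivity
    have e4 : 0 ≤ σ ^ 2 * (X * w) := by positivity
    rw [hκd] at e1 e2 ⊢
    nlinarith
  have h_integrable : Integrable (fun w => (exp (a ^ 2 * τ) * (√(4 * π * τ))⁻¹ *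
      exp (-(κ * (a * X / 2 + X ^ 2 / (8 * τ))))) * exp (-(κ / (8 * τ)) * (w - 2 * a * τ) ^ 2))
      (volume.restrict (Ioi (0 : ℝ))) :=
    (((integrable_exp_neg_mul_sq (by positivity)).comp_sub_right (2 * a * τ)).const_mul _).integrableOn
  have hI := norm_integral_le_of_norm_le h_integrable
    ((ae_restrict_iff' measurableSet_Ioi).2 (Eventually.of_forall hpt))
  rw [integral_const_mul] at hI
  have hg := integral_shift_gauss_le (c := κ / (8 * τ)) (m := 2 * a * τ) (by positivity)
  have hsq : (√(4 * π * τ))⁻¹ * √(π / (κ / (8 * τ))) = √(2 / κ) := by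
    rw [← Real.sqrt_inv, ← Real.sqrt_mul (by positivity)]
    congr 1; field_simp; norm_num
  have hexp : exp (-(a ^ 2 * τ)) * exp (a ^ 2 * τ) = 1 := by rw [← Real.exp_add]; simp
  rw [hna]
  calc _ ≤ ‖(2 : ℂ)‖ * a * exp (-(a ^ 2 * τ)) * (exp (a ^ 2 * τ) * (√(4 * π * τ))⁻¹ *
      exp (-(κ * (a * X / 2 + X ^ 2 / (8 * τ)))) * √(π / (κ / (8 * τ)))) := by gcongr; exact hI.trans (by gcongr)
    _ = 2 * a * (exp (-(a ^ 2 * τ)) * exp (a ^ 2 * τ)) * ((√(4 * π * τ))⁻¹ * √(π / (κ / (8 * τ)))) *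
      exp (-(κ * (a * X / 2 + X ^ 2 / (8 * τ)))) := by simp; ring
    _ = _ := by rw [hexp, hsq]; ring

/-- Part of the Gaussian is spent through X/δ ≤ 1 + X²/(νt), at the cost of a factor e, to replace
|α| by |α| + 1/δ. This gives decay on the scale δ even for small |α|; δ is free because it will be
the layer thickness at the time of the weight, which may exceed the kernel time. -/
lemma norm_resE_cone_le' (hν : 0 < ν) (ht : 0 < t) (α : ℤ) {δ : ℝ} (hδ : 0 < δ)
    (hτδ : ν * t ≤ δ ^ 2) {σ : ℝ} (hσ : 0 < σ) (hσ1 : σ < 1) {ζ : ℂ} (hζ : ζ ∈ cone σ) :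
    ‖resE ν α t ζ‖ ≤ (2 * √(2 / (1 - σ ^ 2)) * exp 1) * (|(α : ℝ)| + δ⁻¹) *
      exp (-((1 - σ ^ 2) / 16 * ((|(α : ℝ)| + δ⁻¹) * ζ.re + ζ.re ^ 2 / (ν * t)))) := by
  have hτ := mul_pos hν ht
  have hX := cone_re_nonneg hσ hζ
  refine (norm_resE_cone_le hν ht α hσ hσ1 hζ).trans ?_
  set a : ℝ := |(α : ℝ)|
  set τ := ν * t
  have ha0 : 0 ≤ a := abs_nonneg _
  have hκ : 0 < 1 - σ ^ 2 := by nlinarith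
  set κ := 1 - σ ^ 2 with hκd
  set X := ζ.re
  have hκ1 : κ ≤ 1 := by nlinarith [sq_nonneg σ]
  have hd : δ⁻¹ * X ≤ 1 + X ^ 2 / τ := by
    have h1 : X ^ 2 / δ ^ 2 ≤ X ^ 2 / τ := by gcongr
    have h2 : (δ⁻¹ * X) ^ 2 = X ^ 2 / δ ^ 2 := by field_simp
    nlinarith [sq_nonneg (δ⁻¹ * X - 1)]
  have hq : 0 ≤ X ^ 2 / τ := by positivity
  have haX : 0 ≤ a * X := by positivity
  have hexp : -(κ * (a * X / 2 + X ^ 2 / (8 * τ))) ≤ 1 + -(κ / 16 * ((a + δ⁻¹) * X + X ^ 2 / τ)) := by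
    have : X ^ 2 / (8 * τ) = X ^ 2 / τ / 8 := by field_simp
    rw [this]
    have h3 : κ * ((a + δ⁻¹) * X + X ^ 2 / τ) ≤ κ * (a * X + 1 + 2 * (X ^ 2 / τ)) := by
      have : (a + δ⁻¹) * X = a * X + δ⁻¹ * X := by ring
      exact mul_le_mul_of_nonneg_left (by linarith) hκ.le
    nlinarith [mul_nonneg hκ.le haX]
  calc _ ≤ 2 * (a + δ⁻¹) * √(2 / κ) * exp (1 + -(κ / 16 * ((a + δ⁻¹) * X + X ^ 2 / τ))) := by
        gcongr; have := inv_pos.2 hδ; linarith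
    _ = _ := by rw [Real.exp_add]; ring

/-! ### The Euler operator -/

/-- The Euler operator `ζ ∂_ζ`. -/
def eul (E : ℂ → ℂ) : ℂ → ℂ := fun ζ => ζ * deriv E ζ

lemma differentiable_eul {E : ℂ → ℂ} (h : Differentiable ℂ E) : Differentiable ℂ (eul E) :=
  differentiable_id.mul (by
    rw [← differentiableOn_univ] at h ⊢
    exact h.deriv isOpen_univ)

lemma differentiable_iterate_eul (n : ℕ) : ∀ {E : ℂ → ℂ}, Differentiable ℂ E →
    Differentiable ℂ (eul^[n] E) := by
  induction n with
  | zero => intro E h; simpa using h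
  | succ n ih => intro E h; exact ih (differentiable_eul h)

/-- The Euler operator commutes with ζ ↦ −ζ. This reduces the phase y − z, whose real part has no
sign, to the cone Re ζ ≥ 0. -/
lemma eul_even {E : ℂ → ℂ} (h : ∀ ζ, E (-ζ) = E ζ) (ζ : ℂ) : eul E (-ζ) = eul E ζ := by
  have h1 : deriv (fun w => E (-w)) ζ = -deriv E (-ζ) := deriv_comp_neg E ζ
  rw [show (fun w => E (-w)) = E from funext h] at h1
  simp only [eul, h1]; ring

lemma iterate_eul_even (n : ℕ) : ∀ {E : ℂ → ℂ}, (∀ ζ, E (-ζ) = E ζ) →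
    ∀ ζ, eul^[n] E (-ζ) = eul^[n] E ζ := by
  induction n with
  | zero => intro E h; simpa using h
  | succ n ih => intro E h; exact ih (eul_even h)

/-- A growth profile compatible with halving the argument. -/
structure IsProfile (w : ℝ → ℝ) : Prop where
  mono : ∀ x y, 0 ≤ x → x ≤ y → w x ≤ w y
  half : ∀ x, 0 ≤ x → w x / 4 ≤ w (x / 2)

lemma isProfile_quad {m τ : ℝ} (hm : 0 ≤ m) (hτ : 0 < τ) : IsProfile fun x => m * x + x ^ 2 / τ where
  mono x y hx hxy := by gcongr
  half x hx := by
    have : (x / 2) ^ 2 / τ = x ^ 2 / τ / 4 := by field_simp; norm_num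
    rw [this]; have := mul_nonneg hm hx; linarith

/-- Cauchy's estimate on the circle of radius ε Re ζ about ζ. It stays in the slightly wider cone
and in Re ≥ Re ζ / 2, so the rate drops by at most a factor 4; and |ζ| ≤ 2 Re ζ compensates the
inverse radius, so no negative power of Re ζ is lost. -/
lemma norm_eul_le {σ A C c : ℝ} {w : ℝ → ℝ} {E : ℂ → ℂ} (hσ : 0 < σ) (hσ1 : σ < 1) (hc : 0 < c)
    (hC : 0 ≤ C) (hA : 0 ≤ A) (hw : IsProfile w) (hE : Differentiable ℂ E)
    (hb : ∀ ζ ∈ cone ((1 + σ) / 2), ‖E ζ‖ ≤ C * A * exp (-(c * w ζ.re))) {ζ : ℂ} (hζ : ζ ∈ cone σ) :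
    ‖eul E ζ‖ ≤ (8 / (1 - σ) * C) * A * exp (-(c / 4 * w ζ.re)) := by
  have hX := cone_re_nonneg hσ hζ
  have hi : |ζ.im| ≤ σ * ζ.re := hζ
  have h1σ : 0 < 1 - σ := by linarith
  rcases hX.eq_or_lt with h0 | hX
  · have : ζ = 0 := by
      apply Complex.ext
      · exact h0.symm
      · rw [← h0, mul_zero] at hi
        exact abs_eq_zero.1 (le_antisymm hi (abs_nonneg _))
    rw [this, eul, zero_mul, norm_zero]; positivity
  -- Small enough that (ε + σ) ≤ (1 + σ)/2 · (1 − ε): the disc then fits into the cone of aperture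
  -- (1 + σ)/2.
  set ε : ℝ := (1 - σ) / 4 with hε
  have hεp : 0 < ε := by positivity
  have hsph : ∀ z ∈ Metric.sphere ζ (ε * ζ.re), ‖E z‖ ≤ C * A * exp (-(c / 4 * w ζ.re)) := by
    intro z hz
    have hd : ‖z - ζ‖ = ε * ζ.re := by simpa [dist_eq_norm] using hz
    have hre := (Complex.abs_re_le_norm (z - ζ)).trans hd.le
    have him := (Complex.abs_im_le_norm (z - ζ)).trans hd.le
    rw [Complex.sub_re, abs_le] at hre
    rw [Complex.sub_im] at him
    have him2 : |z.im| ≤ ε * ζ.re + σ * ζ.re := by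
      have := abs_sub_abs_le_abs_sub z.im ζ.im; linarith
    have hz2 : ζ.re / 2 ≤ z.re := by nlinarith
    have hcone : z ∈ cone ((1 + σ) / 2) := by
      show |z.im| ≤ (1 + σ) / 2 * z.re
      have h3 : (1 + σ) / 2 * ((1 - ε) * ζ.re) ≤ (1 + σ) / 2 * z.re := by gcongr; linarith
      have h4 : (ε + σ) * ζ.re ≤ (1 + σ) / 2 * (1 - ε) * ζ.re := by
        gcongr; rw [hε]; nlinarith
      linarith
    refine (hb z hcone).trans ?_
    have hw1 := hw.half ζ.re hX.le
    have hw2 := hw.mono (ζ.re / 2) z.re (by linarith) hz2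
    have : c / 4 * w ζ.re ≤ c * w z.re := by
      have := mul_le_mul_of_nonneg_left (hw1.trans hw2) hc.le
      linarith
    gcongr
  have hD := Complex.norm_deriv_le_of_forall_mem_sphere_norm_le (mul_pos hεp hX)
    hE.diffContOnCl hsph
  have hn : ‖ζ‖ ≤ 2 * ζ.re := by
    have := Complex.norm_le_abs_re_add_abs_im ζ
    rw [abs_of_pos hX] at this
    nlinarith
  rw [eul, norm_mul]
  calc _ ≤ 2 * ζ.re * (C * A * exp (-(c / 4 * w ζ.re)) / (ε * ζ.re)) := by gcongr
    _ = _ := by rw [hε]; field_simp; ring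

/-- Each Euler derivative uses a wider cone, so the bound on E is assumed for all apertures below 1.
The constants do not see E, A or w, whence uniformity in ν, t, α and δ. -/
lemma exists_norm_iterate_eul_le (C0 c0 : ℝ → ℝ) (hC0 : ∀ σ, 0 ≤ C0 σ)
    (hc0 : ∀ σ, 0 < σ → σ < 1 → 0 < c0 σ) (n : ℕ) :
    ∀ σ, 0 < σ → σ < 1 → ∃ C c : ℝ, 0 < C ∧ 0 < c ∧ ∀ (E : ℂ → ℂ) (A : ℝ) (w : ℝ → ℝ),
      0 ≤ A → IsProfile w → Differentiable ℂ E →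
      (∀ σ, 0 < σ → σ < 1 → ∀ ζ ∈ cone σ, ‖E ζ‖ ≤ C0 σ * A * exp (-(c0 σ * w ζ.re))) →
      ∀ ζ ∈ cone σ, ‖eul^[n] E ζ‖ ≤ C * A * exp (-(c * w ζ.re)) := by
  induction n with
  | zero =>
    intro σ hσ hσ1
    refine ⟨C0 σ + 1, c0 σ, by linarith [hC0 σ], hc0 σ hσ hσ1, fun E A w hA _ _ hb ζ hζ => ?_⟩
    refine (hb σ hσ hσ1 ζ hζ).trans ?_
    gcongr; linarith
  | succ n ih =>
    intro σ hσ hσ1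
    obtain ⟨C, c, hC, hc, h⟩ := ih ((1 + σ) / 2) (by linarith) (by linarith)
    have h1σ : 0 < 1 - σ := by linarith
    refine ⟨8 / (1 - σ) * C, c / 4, by positivity, by positivity, fun E A w hA hw hE hb ζ hζ => ?_⟩
    rw [Function.iterate_succ_apply']
    exact norm_eul_le hσ hσ1 hc hC.le hA hw (differentiable_iterate_eul n hE)
      (h E A w hA hw hE hb) hζ

lemma heatE_even (α : ℤ) (ζ : ℂ) : heatE ν α t (-ζ) = heatE ν α t ζ := by
  simp [heatE, heatKernel]

lemma exists_norm_eul_heatE_le {σ : ℝ} (hσ : 0 < σ) (hσ1 : σ < 1) (n : ℕ) :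
    ∃ C c : ℝ, 0 < C ∧ 0 < c ∧ ∀ (ν t : ℝ) (α : ℤ), 0 < ν → 0 < t → ∀ ζ : ℂ,
      |ζ.im| ≤ σ * |ζ.re| →
      ‖eul^[n] (heatE ν α t) ζ‖ ≤ C * (√(ν * t))⁻¹ * exp (-(c * (ζ.re ^ 2 / (ν * t)))) := by
  obtain ⟨C, c, hC, hc, h⟩ := exists_norm_iterate_eul_le (fun _ => 1) (fun σ => (1 - σ ^ 2) / 4)
    (fun _ => zero_le_one) (fun σ h0 h1 => by nlinarith) n σ hσ hσ1
  refine ⟨C, c, hC, hc, fun ν t α hν ht ζ hζ => ?_⟩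
  have hτ := mul_pos hν ht
  have key : ∀ ζ ∈ cone σ,
      ‖eul^[n] (heatE ν α t) ζ‖ ≤ C * (√(ν * t))⁻¹ * exp (-(c * (ζ.re ^ 2 / (ν * t)))) := by
    refine h (heatE ν α t) (√(ν * t))⁻¹ (fun x => x ^ 2 / (ν * t)) (by positivity) ?_
      (differentiable_heatE hν ht α) ?_
    · simpa using isProfile_quad le_rfl hτ
    · intro σ' _ _ ζ hζ
      rw [one_mul]; exact norm_heatE_cone_le hν ht α hζ
  rcases le_total 0 ζ.re with h0 | h0
  · exact key ζ (by rw [abs_of_nonneg h0] at hζ; exact hζ)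
  · have := key (-ζ) (by rw [abs_of_nonpos h0] at hζ; simpa [cone] using hζ)
    rw [iterate_eul_even n (heatE_even α)] at this
    simpa using this

lemma exists_norm_eul_resE_le {σ : ℝ} (hσ : 0 < σ) (hσ1 : σ < 1) (n : ℕ) :
    ∃ C c : ℝ, 0 < C ∧ 0 < c ∧ ∀ (ν t δ : ℝ) (α : ℤ), 0 < ν → 0 < t → 0 < δ → ν * t ≤ δ ^ 2 →
      ∀ ζ ∈ cone σ, ‖eul^[n] (resE ν α t) ζ‖ ≤ C * (|(α : ℝ)| + δ⁻¹) *
        exp (-(c * ((|(α : ℝ)| + δ⁻¹) * ζ.re + ζ.re ^ 2 / (ν * t)))) := by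
  obtain ⟨C, c, hC, hc, h⟩ := exists_norm_iterate_eul_le
    (fun σ => 2 * √(2 / (1 - σ ^ 2)) * exp 1) (fun σ => (1 - σ ^ 2) / 16)
    (fun _ => by positivity) (fun σ h0 h1 => by nlinarith) n σ hσ hσ1
  refine ⟨C, c, hC, hc, fun ν t δ α hν ht hδ hτδ => ?_⟩
  refine h (resE ν α t) (|(α : ℝ)| + δ⁻¹) (fun x => (|(α : ℝ)| + δ⁻¹) * x + x ^ 2 / (ν * t))
    (by positivity) (isProfile_quad (by positivity) (mul_pos hν ht))
    (differentiable_resE hν ht α) ?_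
  intro σ' h0 h1 ζ hζ
  exact norm_resE_cone_le' hν ht α hδ hτδ h0 h1 hζ

end

noncomputable section

/-! ### The Green function of the Stokes problem -/

variable {ν t : ℝ}

lemma hasDerivAt_stokesGreen (hν : 0 < ν) (ht : 0 < t) (α : ℤ) (y z : ℂ) :
    HasDerivAt (stokesGreen ν α t y)
      ((y - z) / (2 * (ν * t : ℝ)) * heatE ν α t (y - z)
        - (y + z) / (2 * (ν * t : ℝ)) * heatE ν α t (y + z)
        - ((|α| : ℤ) : ℂ) * resE ν α t (y + z) - 2 * ((|α| : ℤ) : ℂ) * heatE ν α t (y + z)) z := by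
  have hτ := (mul_pos hν ht).ne'
  rw [show stokesGreen ν α t y = _ from funext (stokesGreen_eq ν α t y)]
  refine ((((hasDerivAt_heatE α (y - z) hτ).comp_const_sub y z).fun_add
    ((hasDerivAt_heatE α (y + z) hτ).comp_const_add y z)).fun_add
    ((hasDerivAt_resE hν ht α (y + z)).comp_const_add y z)).congr_deriv ?_
  ring

lemma hasDerivAt_deriv_stokesGreen (hν : 0 < ν) (ht : 0 < t) (α : ℤ) (y z : ℂ) :
    HasDerivAt (deriv (stokesGreen ν α t y))
      (((y - z) ^ 2 / (4 * (ν * t : ℝ) ^ 2) - 1 / (2 * (ν * t : ℝ))) * heatE ν α t (y - z)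
        + ((y + z) ^ 2 / (4 * (ν * t : ℝ) ^ 2) - 1 / (2 * (ν * t : ℝ))) * heatE ν α t (y + z)
        + (α : ℂ) ^ 2 * resE ν α t (y + z)
        + 2 * ((|α| : ℤ) : ℂ) * ((y + z) / (2 * (ν * t : ℝ)) + ((|α| : ℤ) : ℂ))
          * heatE ν α t (y + z)) z := by
  have hτ := (mul_pos hν ht).ne'
  have hc : ((ν * t : ℝ) : ℂ) ≠ 0 := by exact_mod_cast hτ
  rw [show deriv (stokesGreen ν α t y) = _ from
    funext fun z => (hasDerivAt_stokesGreen hν ht α y z).deriv]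
  have h1 := (hasDerivAt_heatE α (y - z) hτ).comp_const_sub y z
  have h2 := (hasDerivAt_heatE α (y + z) hτ).comp_const_add y z
  have h3 := (hasDerivAt_resE hν ht α (y + z)).comp_const_add y z
  have d1 : HasDerivAt (fun z : ℂ => (y - z) / (2 * (ν * t : ℝ))) (-1 / (2 * (ν * t : ℝ))) z :=
    ((hasDerivAt_id z).const_sub y).div_const _
  have d2 : HasDerivAt (fun z : ℂ => (y + z) / (2 * (ν * t : ℝ))) (1 / (2 * (ν * t : ℝ))) z :=
    ((hasDerivAt_id z).const_add y).div_const _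
  refine ((((d1.fun_mul h1).fun_sub (d2.fun_mul h2)).fun_sub
    (h3.const_mul ((|α| : ℤ) : ℂ))).fun_sub (h2.const_mul (2 * ((|α| : ℤ) : ℂ)))).congr_deriv ?_
  rw [← abs_cast_sq]
  field_simp
  ring

/-! ### Integrability on the half-line and initial data -/

lemma norm_heatE_ofReal_le (hν : 0 < ν) (ht : 0 < t) (α : ℤ) (x : ℝ) :
    ‖heatE ν α t x‖ ≤ (√(ν * t))⁻¹ * exp (-(4 * (ν * t))⁻¹ * x ^ 2) := by
  refine (norm_heatE_le hν ht α x).trans (le_of_eq ?_)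
  simp only [Complex.ofReal_re, Complex.ofReal_im]
  congr 2; field_simp; ring

lemma integrable_heatE_sub (hν : 0 < ν) (ht : 0 < t) (α : ℤ) (y : ℝ) :
    Integrable fun z : ℝ => heatE ν α t (y - z) := by
  have hτ := mul_pos hν ht
  refine Integrable.mono' (((integrable_exp_neg_mul_sq (b := (4 * (ν * t))⁻¹)
    (by positivity)).comp_sub_left y).const_mul (√(ν * t))⁻¹) ?_ (Eventually.of_forall fun z => ?_)
  · exact ((differentiable_heatE hν ht α).continuous.comp (by fun_prop)).aestronglyMeasurable
  · have := norm_heatE_ofReal_le hν ht α (y - z)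
    push_cast at this; exact this

lemma norm_resE_ofReal_le (hν : 0 < ν) (ht : 0 < t) (α : ℤ) {y z : ℝ} (hy : 0 ≤ y) (hz : 0 ≤ z) :
    ‖resE ν α t (y + z)‖ ≤ 4 * |(α : ℝ)| * exp (-(16 * (ν * t))⁻¹ * z ^ 2) := by
  have hτ := mul_pos hν ht
  have hc : ((y : ℂ) + z) ∈ cone (1 / 2) := by
    simp [cone]; positivity
  refine (norm_resE_cone_le hν ht α (by norm_num) (by norm_num) hc).trans ?_
  have hs : √(2 / (1 - (1 / 2 : ℝ) ^ 2)) ≤ 2 := Real.sqrt_le_iff.2 (by norm_num)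
  simp only [Complex.add_re, Complex.ofReal_re]
  have he : -((1 - (1 / 2 : ℝ) ^ 2) * (|(α : ℝ)| * (y + z) / 2 + (y + z) ^ 2 / (8 * (ν * t)))) ≤
      -(16 * (ν * t))⁻¹ * z ^ 2 := by
    have h1 : 0 ≤ |(α : ℝ)| * (y + z) / 2 := by positivity
    have h2 : z ^ 2 / (8 * (ν * t)) ≤ (y + z) ^ 2 / (8 * (ν * t)) := by
      gcongr; linarith
    have h3 : -(16 * (ν * t))⁻¹ * z ^ 2 = -(1 / 2 * (z ^ 2 / (8 * (ν * t)))) := by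
      field_simp; ring
    have h4 : 0 ≤ z ^ 2 / (8 * (ν * t)) := by positivity
    rw [h3]; linarith
  calc _ ≤ 2 * |(α : ℝ)| * 2 * exp (-(16 * (ν * t))⁻¹ * z ^ 2) := by gcongr
    _ = _ := by ring

lemma continuous_resE_add (hν : 0 < ν) (ht : 0 < t) (α : ℤ) (y : ℝ) :
    Continuous fun z : ℝ => resE ν α t (y + z) :=
  (differentiable_resE hν ht α).continuous.comp (by fun_prop)

lemma integrableOn_resE (hν : 0 < ν) (ht : 0 < t) (α : ℤ) {y : ℝ} (hy : 0 ≤ y) :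
    IntegrableOn (fun z : ℝ => resE ν α t (y + z)) (Ioi 0) := by
  have hτ := mul_pos hν ht
  refine Integrable.mono' (((integrable_exp_neg_mul_sq (b := (16 * (ν * t))⁻¹)
    (by positivity)).const_mul (4 * |(α : ℝ)|)).integrableOn)
    (continuous_resE_add hν ht α y).aestronglyMeasurable
    ((ae_restrict_iff' measurableSet_Ioi).2 (Eventually.of_forall fun z hz => ?_))
  exact norm_resE_ofReal_le hν ht α hy (le_of_lt hz)

lemma integrable_heatE_add (hν : 0 < ν) (ht : 0 < t) (α : ℤ) (y : ℝ) :
    Integrable fun z : ℝ => heatE ν α t (y + z) := by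
  simpa using (integrable_heatE_sub hν ht α y).comp_neg

/-- The residual kernel does not contribute to the initial datum: by its Gaussian bound its mass is
O(|α|√(νt)). -/
lemma tendsto_integral_resE (hν : 0 < ν) (α : ℤ) {y : ℝ} (hy : 0 ≤ y)
    (φ : BoundedContinuousFunction ℝ ℂ) :
    Tendsto (fun t : ℝ => ∫ z in Ioi (0 : ℝ), resE ν α t (y + z) * φ z) (𝓝[>] 0) (𝓝 0) := by
  have hlim : Tendsto (fun t : ℝ => 4 * |(α : ℝ)| * ‖φ‖ * (√(π / (16 * (ν * t))⁻¹) / 2))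
      (𝓝[>] 0) (𝓝 0) := by
    have : Continuous fun t : ℝ => 4 * |(α : ℝ)| * ‖φ‖ * (√(π * (16 * (ν * t))) / 2) := by fun_prop
    have h := (this.tendsto 0).mono_left (nhdsWithin_le_nhds (s := Ioi 0))
    simpa [div_eq_mul_inv] using h
  refine squeeze_zero_norm' ?_ hlim
  filter_upwards [self_mem_nhdsWithin] with t ht
  have ht : 0 < t := ht
  have hτ := mul_pos hν ht
  have hI := norm_integral_le_of_norm_le (μ := volume.restrict (Ioi (0 : ℝ)))
    (f := fun z : ℝ => resE ν α t (y + z) * φ z)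
    (g := fun z => 4 * |(α : ℝ)| * ‖φ‖ * exp (-(16 * (ν * t))⁻¹ * z ^ 2))
    (((integrable_exp_neg_mul_sq (b := (16 * (ν * t))⁻¹) (by positivity)).const_mul _).integrableOn)
    ((ae_restrict_iff' measurableSet_Ioi).2 (Eventually.of_forall fun z hz => ?_))
  · rwa [integral_const_mul, integral_gaussian_Ioi] at hI
  · rw [norm_mul]
    have h1 := norm_resE_ofReal_le hν ht α hy (le_of_lt hz)
    have h2 := φ.norm_coe_le_norm z
    calc _ ≤ 4 * |(α : ℝ)| * exp (-(16 * (ν * t))⁻¹ * z ^ 2) * ‖φ‖ := by gcongr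
      _ = _ := by ring

/-- The substitution z = y + 2√(νt) v moves all time dependence, apart from the damping factor, into
the argument of F, ready for dominated convergence. -/
lemma integral_heatE_mul (hν : 0 < ν) (ht : 0 < t) (α : ℤ) (y : ℝ) (F : ℝ → ℂ) :
    ∫ z : ℝ, heatE ν α t (y - z) * F z = Complex.exp (-((α : ℂ) ^ 2 * ν * t)) *
      ∫ v : ℝ, (((√π)⁻¹ * exp (-v ^ 2) : ℝ) : ℂ) * F (y + 2 * √(ν * t) * v) := by
  have hτ := mul_pos hν ht
  have hs : 0 < √(ν * t) := Real.sqrt_pos.2 hτ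
  have hsq : (√(ν * t)) ^ 2 = ν * t := Real.sq_sqrt hτ.le
  set s := √(ν * t) with hsd
  have h1 := integral_add_left_eq_self (fun z : ℝ => heatE ν α t (y - z) * F z) y (μ := volume)
  have h2 := Measure.integral_comp_mul_left
    (fun z : ℝ => heatE ν α t (y - ((y + z : ℝ) : ℂ)) * F (y + z)) (2 * s)
  rw [← h1]
  have h3 : ∫ z : ℝ, heatE ν α t (y - ((y + z : ℝ) : ℂ)) * F (y + z) = ((2 * s : ℝ) : ℂ) *
      ∫ v : ℝ, heatE ν α t (y - ((y + 2 * s * v : ℝ) : ℂ)) * F (y + 2 * s * v) := by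
    rw [h2, abs_of_pos (by positivity), Complex.real_smul, ← mul_assoc, ← Complex.ofReal_mul,
      mul_inv_cancel₀ (by positivity), Complex.ofReal_one, one_mul]
  rw [h3, ← integral_const_mul, ← integral_const_mul]
  congr 1; funext v
  rw [heatE, heatKernel]
  have h4 : √(4 * π * (ν * t)) = 2 * √π * s := by
    rw [show 4 * π * (ν * t) = 2 ^ 2 * (π * (ν * t)) by ring, Real.sqrt_mul (by norm_num),
      Real.sqrt_sq (by norm_num), Real.sqrt_mul pi_nonneg]; ring
  have h5 : -(((y : ℂ) - ((y + 2 * s * v : ℝ) : ℂ)) ^ 2) / (4 * ((ν * t : ℝ) : ℂ)) =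
      ((-v ^ 2 : ℝ) : ℂ) := by
    rw [← hsq]
    have : (s : ℂ) ≠ 0 := by exact_mod_cast hs.ne'
    push_cast; field_simp; ring
  rw [h4, h5]
  have hsc : (s : ℂ) ≠ 0 := by exact_mod_cast hs.ne'
  push_cast
  field_simp

lemma tendsto_integral_heatE (hν : 0 < ν) (α : ℤ) (y : ℝ) {F : ℝ → ℂ} (hF : Continuous F)
    {B : ℝ} (hB : ∀ z, ‖F z‖ ≤ B) :
    Tendsto (fun t : ℝ => ∫ z : ℝ, heatE ν α t (y - z) * F z) (𝓝[>] 0) (𝓝 (F y)) := by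
  have hg : Integrable fun v : ℝ => (√π)⁻¹ * exp (-v ^ 2) := by
    simpa using (integrable_exp_neg_mul_sq (b := 1) one_pos).const_mul (√π)⁻¹
  have hg1 : ∫ v : ℝ, (((√π)⁻¹ * exp (-v ^ 2) : ℝ) : ℂ) = 1 := by
    rw [integral_complex_ofReal, integral_const_mul]
    have := integral_gaussian 1
    simp only [neg_mul, one_mul, div_one] at this
    rw [this, inv_mul_cancel₀ (Real.sqrt_pos.2 pi_pos).ne', Complex.ofReal_one]
  have h1 : Tendsto (fun t : ℝ => ∫ v : ℝ, (((√π)⁻¹ * exp (-v ^ 2) : ℝ) : ℂ) *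
      F (y + 2 * √(ν * t) * v)) (𝓝[>] 0) (𝓝 (∫ v : ℝ, (((√π)⁻¹ * exp (-v ^ 2) : ℝ) : ℂ) * F y)) := by
    refine tendsto_integral_filter_of_dominated_convergence
      (fun v => (√π)⁻¹ * exp (-v ^ 2) * B) (Eventually.of_forall fun t => ?_)
      (Eventually.of_forall fun t => Eventually.of_forall fun v => ?_) (hg.mul_const B)
      (Eventually.of_forall fun v => ?_)
    · exact (Continuous.mul (by fun_prop) (hF.comp (by fun_prop))).aestronglyMeasurable
    · rw [norm_mul, Complex.norm_real, Real.norm_of_nonneg (by positivity)]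
      exact mul_le_mul_of_nonneg_left (hB _) (by positivity)
    · refine Tendsto.const_mul _ ?_
      have : Continuous fun t : ℝ => F (y + 2 * √(ν * t) * v) := hF.comp (by fun_prop)
      simpa using (this.tendsto 0).mono_left (nhdsWithin_le_nhds (s := Ioi 0))
  rw [integral_mul_const, hg1, one_mul] at h1
  have h2 : Tendsto (fun t : ℝ => Complex.exp (-((α : ℂ) ^ 2 * ν * t))) (𝓝[>] 0) (𝓝 1) := by
    have : Continuous fun t : ℝ => Complex.exp (-((α : ℂ) ^ 2 * ν * t)) := by fun_prop
    simpa using (this.tendsto 0).mono_left (nhdsWithin_le_nhds (s := Ioi 0))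
  have h3 := h2.mul h1
  rw [one_mul] at h3
  refine h3.congr' ?_
  filter_upwards [self_mem_nhdsWithin] with t ht using (integral_heatE_mul hν ht α y F).symm

lemma integral_eq_Ioi_add_reflect {g : ℝ → ℂ} (hg : Integrable g) :
    ∫ z, g z = (∫ z in Ioi (0 : ℝ), g z) + ∫ z in Ioi (0 : ℝ), g (-z) := by
  have h := intervalIntegral.integral_Iic_add_Ioi (b := 0) hg.integrableOn hg.integrableOn
  rw [integral_comp_neg_Ioi, neg_zero, ← h, add_comm]

lemma isStokesGreen_stokesGreen (hν : 0 < ν) (α : ℤ) : IsStokesGreen ν α (stokesGreen ν α) where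
  holo t ht y _ z := (hasDerivAt_stokesGreen hν ht α y z).differentiableAt
  integrable t ht y hy := by
    simp only [stokesGreen_eq]
    exact (((integrable_heatE_sub hν ht α y).integrableOn).add
      (integrable_heatE_add hν ht α y).integrableOn).add (integrableOn_resE hν ht α hy)
  heat t ht y _ z := by
    rw [(hasDerivAt_deriv_stokesGreen hν ht α y z).deriv]
    simp only [stokesGreen_eq]
    refine (((hasDerivAt_time_heatE hν ht α (y - z)).fun_add
      (hasDerivAt_time_heatE hν ht α (y + z))).fun_add
      (hasDerivAt_time_resE hν ht α (y + z))).congr_deriv ?_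
    ring
  boundary t ht y _ := by
    -- At z = 0 the derivatives of the two heat kernels cancel, and −|α|R − 2|α|H is the negative of
    -- |α|(2H + R).
    rw [(hasDerivAt_stokesGreen hν ht α y 0).deriv, stokesGreen_eq]
    simp only [sub_zero, add_zero]
    ring
  initial y hy φ := by
    -- Method of images: the two heat kernels on the half-line are one heat kernel on the line
    -- tested against the even extension of φ. The source y = 0 needs no separate treatment.
    have h1 := tendsto_integral_heatE hν α y (F := fun z => φ |z|)
      (φ.continuous.comp continuous_abs) (fun z => φ.norm_coe_le_norm _)
    have h2 := h1.add (tendsto_integral_resE hν α hy φ)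
    simp only [abs_of_nonneg hy, add_zero] at h2
    refine h2.congr' ?_
    filter_upwards [self_mem_nhdsWithin] with t ht
    have hφ : ∀ᵐ z : ℝ, ‖φ z‖ ≤ ‖φ‖ := Eventually.of_forall fun z => φ.norm_coe_le_norm z
    have hφm : AEStronglyMeasurable (fun z : ℝ => φ z) := φ.continuous.aestronglyMeasurable
    have hi : Integrable fun z : ℝ => heatE ν α t (y - z) * φ |z| :=
      (integrable_heatE_sub hν ht α y).mul_bdd
        (φ.continuous.comp continuous_abs).aestronglyMeasurable
        (Eventually.of_forall fun z => φ.norm_coe_le_norm _)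
    have i1 := ((integrable_heatE_sub hν ht α y).mul_bdd hφm hφ).integrableOn (s := Ioi 0)
    have i2 := ((integrable_heatE_add hν ht α y).mul_bdd hφm hφ).integrableOn (s := Ioi 0)
    have i3 := (integrableOn_resE hν ht α hy).mul_bdd hφm.restrict (ae_restrict_of_ae hφ)
    rw [integral_eq_Ioi_add_reflect hi]
    simp only [stokesGreen_eq, add_mul]
    have e := integral_add (i1.add i2) i3
    simp only [Pi.add_apply] at e
    rw [e, integral_add i1 i2]
    congr 2
    · refine setIntegral_congr_fun measurableSet_Ioi fun z hz => ?_
      simp only [abs_of_pos (show 0 < z from hz)]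
    · refine setIntegral_congr_fun measurableSet_Ioi fun z hz => ?_
      simp only [abs_neg, abs_of_pos (show 0 < z from hz)]
      push_cast; rw [sub_neg_eq_add]

end

noncomputable section

/-! ### Vanishing of integrals of derivatives on the half-line -/

/-- No limits of f are assumed. At infinity integrability of f and f' forces f → 0; near 0 the
substitution r = e^s turns integrability of f/r into integrability of s ↦ f(e^s) at −∞, with the
same conclusion. The point r = 1 is exempt because the branches have a corner there. -/
lemma integral_Ioi_deriv_eq_zero {f f' : ℝ → ℂ} (hc : ContinuousOn f (Ioi 0))
    (hd : ∀ r, 0 < r → r ≠ 1 → HasDerivAt f (f' r) r) (hf' : IntegrableOn f' (Ioi 0))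
    (hf : IntegrableOn (fun r => (min r 1)⁻¹ • f r) (Ioi 0)) : ∫ r in Ioi (0 : ℝ), f' r = 0 := by
  have hc1 : ContinuousAt f 1 := hc.continuousAt (Ioi_mem_nhds one_pos)
  have h1 : ∫ r in Ioi (1 : ℝ), f' r = 0 - f 1 := by
    have hd1 : ∀ r ∈ Ioi (1 : ℝ), HasDerivAt f (f' r) r := fun r hr =>
      hd r (one_pos.trans hr) (ne_of_gt hr)
    have hi' : IntegrableOn f' (Ioi 1) := hf'.mono_set (Ioi_subset_Ioi zero_le_one)
    have hi : IntegrableOn f (Ioi 1) := by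
      refine (hf.mono_set (Ioi_subset_Ioi zero_le_one)).congr_fun (fun r hr => ?_) measurableSet_Ioi
      simp [min_eq_right (mem_Ioi.1 hr).le]
    exact integral_Ioi_of_hasDerivAt_of_tendsto hc1.continuousWithinAt hd1 hi'
      (tendsto_zero_of_hasDerivAt_of_integrableOn_Ioi hd1 hi' hi)
  have himg : exp '' Iic 0 = Ioc (0 : ℝ) 1 := by
    ext r; constructor
    · rintro ⟨s, hs, rfl⟩; exact ⟨exp_pos s, exp_le_one_iff.2 hs⟩
    · rintro ⟨h0, h1⟩; exact ⟨log r, log_nonpos h0.le h1, exp_log h0⟩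
  have hexp : ∀ s ∈ Iic (0 : ℝ), HasDerivWithinAt exp (exp s) (Iic 0) s :=
    fun s _ => (Real.hasDerivAt_exp s).hasDerivWithinAt
  have hsub : Ioc (0 : ℝ) 1 ⊆ Ioi 0 := fun r hr => hr.1
  have h2 : ∫ r in Ioc (0 : ℝ) 1, f' r = f 1 - 0 := by
    have hG' : IntegrableOn (fun s => |exp s| • f' (exp s)) (Iic 0) := by
      rw [← integrableOn_image_iff_integrableOn_abs_deriv_smul measurableSet_Iic hexp
        Real.exp_injective.injOn, himg]
      exact hf'.mono_set hsub
    have hG : IntegrableOn (fun s => f (exp s)) (Iic 0) := by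
      have : IntegrableOn (fun s => |exp s| • ((min (exp s) 1)⁻¹ • f (exp s))) (Iic 0) := by
        rw [← integrableOn_image_iff_integrableOn_abs_deriv_smul measurableSet_Iic hexp
          Real.exp_injective.injOn (fun r => (min r 1)⁻¹ • f r), himg]
        exact hf.mono_set hsub
      refine this.congr_fun (fun s hs => ?_) measurableSet_Iic
      have hs : s ≤ 0 := hs
      simp only [abs_of_pos (exp_pos s), min_eq_left (exp_le_one_iff.2 hs)]
      rw [smul_smul, mul_inv_cancel₀ (exp_pos s).ne', one_smul]
    have hD : ∀ s ∈ Iio (0 : ℝ), HasDerivAt (fun s => f (exp s)) (|exp s| • f' (exp s)) s := by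
      intro s hs
      rw [abs_of_pos (exp_pos s)]
      exact (hd (exp s) (exp_pos s) (ne_of_lt (exp_lt_one_iff.2 hs))).scomp s (Real.hasDerivAt_exp s)
    have hlt : Iic (-1 : ℝ) ⊆ Iio 0 := fun s hs => lt_of_le_of_lt (mem_Iic.1 hs) (by norm_num)
    have hle : Iic (-1 : ℝ) ⊆ Iic 0 := Iic_subset_Iic.2 (by norm_num)
    have hlim := tendsto_zero_of_hasDerivAt_of_integrableOn_Iic (a := -1)
      (fun s hs => hD s (hlt hs)) (hG'.mono_set hle) (hG.mono_set hle)
    have hcont : ContinuousWithinAt (fun s => f (exp s)) (Iic 0) 0 := by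
      refine ContinuousAt.continuousWithinAt (ContinuousAt.comp ?_ Real.continuous_exp.continuousAt)
      simpa using hc1
    have := integral_Iic_of_hasDerivAt_of_tendsto hcont hD hG' hlim
    rw [← himg, integral_image_eq_integral_abs_deriv_smul measurableSet_Iic hexp
      Real.exp_injective.injOn, this, Real.exp_zero]
  rw [← Ioc_union_Ioi_eq_Ioi zero_le_one, setIntegral_union
    (Set.disjoint_left.2 fun r hr hr' => absurd hr.2 (not_le.2 (mem_Ioi.1 hr'))) measurableSet_Ioi
    (hf'.mono_set hsub) (hf'.mono_set (Ioi_subset_Ioi zero_le_one)), h1, h2]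
  ring

/-! ### Integrals along the branches of the pencil -/

/-- `h` is holomorphic on the pencil and uniformly integrable along its branches. -/
structure PencilL1 (σ : ℝ) (h : ℂ → ℂ) : Prop where
  holo : DifferentiableOn ℂ h (pencil σ)
  fin : l1ModeNorm σ h < ⊤

lemma branch_zero (r : ℝ) : branch 0 r = r := by
  apply Complex.ext <;> simp [branch]

lemma continuous_branch : Continuous fun p : ℝ × ℝ => branch p.1 p.2 := by
  have : (fun p : ℝ × ℝ => branch p.1 p.2) =
      fun p : ℝ × ℝ => (p.2 : ℂ) + ((p.1 * min p.2 1 : ℝ) : ℂ) * Complex.I := by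
    funext p; apply Complex.ext <;> simp [branch]
  rw [this]; fun_prop

lemma continuousOn_comp_branch {σ : ℝ} {h : ℂ → ℂ} (hh : ContinuousOn h (pencil σ)) {θ : ℝ}
    (hθ : |θ| < σ) : ContinuousOn (fun r => h (branch θ r)) (Ioi 0) :=
  hh.comp (continuous_branch.comp (by fun_prop : Continuous fun r : ℝ => (θ, r))).continuousOn
    fun _ hr => branch_mem_pencil hθ hr

lemma one_le_arcDensity (θ r : ℝ) : 1 ≤ arcDensity θ r := by
  unfold arcDensity
  split_ifs
  · rw [Real.one_le_sqrt]; nlinarith [sq_nonneg θ]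
  · exact le_rfl

/-- The norm takes the two branches together for θ ≥ 0; a signed θ selects one of them, and arc
length dominates dr. -/
lemma lintegral_branch_le {σ : ℝ} (h : ℂ → ℂ) {θ : ℝ} (hθ : |θ| < σ) :
    ∫⁻ r in Ioi (0 : ℝ), ‖h (branch θ r)‖ₑ ≤ l1ModeNorm σ h := by
  have hmem : |θ| ∈ Ico 0 σ := ⟨abs_nonneg _, hθ⟩
  refine le_trans ?_ (le_iSup₂ (f := fun θ (_ : θ ∈ Ico 0 σ) => ∫⁻ r in Ioi (0 : ℝ),
    ENNReal.ofReal ((‖h (branch θ r)‖ + ‖h (branch (-θ) r)‖) * arcDensity θ r)) |θ| hmem)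
  refine lintegral_mono fun r => ?_
  rw [← ofReal_norm]
  apply ENNReal.ofReal_le_ofReal
  have h1 := one_le_arcDensity |θ| r
  have h2 : ‖h (branch θ r)‖ ≤ ‖h (branch |θ| r)‖ + ‖h (branch (-|θ|) r)‖ := by
    rcases abs_choice θ with e | e
    · rw [e]; linarith [norm_nonneg (h (branch (-θ) r))]
    · rw [e, neg_neg]; linarith [norm_nonneg (h (branch (-θ) r))]
  nlinarith [norm_nonneg (h (branch θ r))]

lemma integrableOn_branch {σ : ℝ} {h : ℂ → ℂ} (hh : PencilL1 σ h) {θ : ℝ} (hθ : |θ| < σ) :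
    IntegrableOn (fun r => h (branch θ r)) (Ioi 0) :=
  ⟨(continuousOn_comp_branch hh.holo.continuousOn hθ).aestronglyMeasurable measurableSet_Ioi,
    (lintegral_branch_le h hθ).trans_lt hh.fin⟩

lemma PencilL1.integrableOn {σ : ℝ} (hσ : 0 < σ) {h : ℂ → ℂ} (hh : PencilL1 σ h) :
    IntegrableOn (fun r : ℝ => h r) (Ioi 0) := by
  simpa only [branch_zero] using integrableOn_branch hh (θ := 0) (by simpa using hσ)

/-- The derivative of `r ↦ branch θ r`. -/
def branchDeriv (θ r : ℝ) : ℂ := if r < 1 then 1 + Complex.I * θ else 1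

/-- Let γ(r,s) = r + is(cr + d), with (c,d) = (1,0) below the corner and (0,1) above. By holomorphy
the r-derivative of F(γ)(cr + d) is the s-derivative of −iF(γ)∂_rγ. So the derivative of the
transversal integral is −i times the difference of the integrands on the branch and on ℝ₊: Cauchy's
theorem in differential form. -/
lemma hasDerivAt_contour {U : Set ℂ} (hU : IsOpen U) {F : ℂ → ℂ} (hF : DifferentiableOn ℂ F U)
    (c d θ : ℝ) {r₀ ε : ℝ} (hε : 0 < ε)
    (hmem : ∀ r ∈ Metric.closedBall r₀ ε, ∀ s ∈ uIcc 0 θ, (r + Complex.I * s * (c * r + d)) ∈ U) :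
    HasDerivAt (fun r : ℝ => ∫ s in (0 : ℝ)..θ, F (r + Complex.I * s * (c * r + d)) * (c * r + d))
      (-Complex.I * (F (r₀ + Complex.I * θ * (c * r₀ + d)) * (1 + Complex.I * θ * c) - F r₀)) r₀ := by
  have hF' : ContinuousOn (deriv F) U := (hF.deriv hU).continuousOn
  have hγ : Continuous fun p : ℝ × ℝ => ((p.1 : ℂ) + Complex.I * p.2 * (c * p.1 + d)) := by fun_prop
  have hmaps : MapsTo (fun p : ℝ × ℝ => ((p.1 : ℂ) + Complex.I * p.2 * (c * p.1 + d)))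
      (Metric.closedBall r₀ ε ×ˢ uIcc 0 θ) U := fun p hp => hmem p.1 hp.1 p.2 hp.2
  let G' : ℝ → ℝ → ℂ := fun r s => deriv F (r + Complex.I * s * (c * r + d)) *
    (1 + Complex.I * s * c) * (c * r + d) + F (r + Complex.I * s * (c * r + d)) * c
  have hG'c : ContinuousOn (Function.uncurry G') (Metric.closedBall r₀ ε ×ˢ uIcc 0 θ) := by
    refine ContinuousOn.add (((hF'.comp hγ.continuousOn hmaps).mul ?_).mul ?_)
      ((hF.continuousOn.comp hγ.continuousOn hmaps).mul continuousOn_const)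
    · exact Continuous.continuousOn (by fun_prop)
    · exact Continuous.continuousOn (by fun_prop)
  obtain ⟨B, hB⟩ := ((isCompact_closedBall r₀ ε).prod isCompact_uIcc).exists_bound_of_continuousOn hG'c
  have hr₀ : r₀ ∈ Metric.closedBall r₀ ε := Metric.mem_closedBall_self hε.le
  have hslice : ∀ r ∈ Metric.closedBall r₀ ε, ∀ H : ℝ × ℝ → ℂ,
      ContinuousOn H (Metric.closedBall r₀ ε ×ˢ uIcc 0 θ) →
      ContinuousOn (fun s => H (r, s)) (uIcc 0 θ) := fun r hr H hH =>
    hH.comp (by fun_prop) fun s hs => ⟨hr, hs⟩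
  have hGc : ContinuousOn (fun p : ℝ × ℝ => F (p.1 + Complex.I * p.2 * (c * p.1 + d)) *
      (c * p.1 + d)) (Metric.closedBall r₀ ε ×ˢ uIcc 0 θ) :=
    (hF.continuousOn.comp hγ.continuousOn hmaps).mul (Continuous.continuousOn (by fun_prop))
  have hmain := intervalIntegral.hasDerivAt_integral_of_dominated_loc_of_deriv_le
    (μ := volume) (a := 0) (b := θ) (x₀ := r₀) (s := Metric.ball r₀ ε)
    (F := fun (r s : ℝ) => F (r + Complex.I * s * (c * r + d)) * (c * r + d)) (F' := G')
    (bound := fun _ => B) (Metric.ball_mem_nhds _ hε) ?_ ?_ ?_ ?_ (by simp) ?_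
  · refine hmain.2.congr_deriv ?_
    have hFTC := intervalIntegral.integral_eq_sub_of_hasDerivAt (a := 0) (b := θ)
      (f := fun s : ℝ => -Complex.I * (F (r₀ + Complex.I * s * (c * r₀ + d)) * (1 + Complex.I * s * c)))
      (f' := G' r₀) (fun s hs => ?_) ((hslice r₀ hr₀ _ hG'c).intervalIntegrable)
    · rw [hFTC]; simp; ring
    · have hs1 : HasDerivAt (fun s : ℝ => (s : ℂ)) 1 s := Complex.ofRealCLM.hasDerivAt
      have d1 : HasDerivAt (fun s : ℝ => (r₀ + Complex.I * s * (c * r₀ + d) : ℂ))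
          (Complex.I * (c * r₀ + d)) s := by
        simpa using ((hs1.const_mul Complex.I).mul_const (c * r₀ + d : ℂ)).const_add (r₀ : ℂ)
      have d2 : HasDerivAt (fun s : ℝ => (1 + Complex.I * s * c : ℂ)) (Complex.I * c) s := by
        simpa using ((hs1.const_mul Complex.I).mul_const (c : ℂ)).const_add (1 : ℂ)
      have d3 := ((hF.differentiableAt (hU.mem_nhds (hmem r₀ hr₀ s hs))).hasDerivAt).comp s d1
      refine ((d3.fun_mul d2).const_mul (-Complex.I)).congr_deriv ?_
      simp only [G', Function.comp]
      linear_combination (-(deriv F (r₀ + Complex.I * s * (c * r₀ + d)) *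
        (1 + Complex.I * s * c) * (c * r₀ + d) + F (r₀ + Complex.I * s * (c * r₀ + d)) * c)) *
        Complex.I_mul_I
  · filter_upwards [Metric.ball_mem_nhds r₀ hε] with r hr
    exact ((hslice r (Metric.ball_subset_closedBall hr) _ hGc).mono
      uIoc_subset_uIcc).aestronglyMeasurable measurableSet_uIoc
  · exact (hslice r₀ hr₀ _ hGc).intervalIntegrable
  · exact ((hslice r₀ hr₀ _ hG'c).mono uIoc_subset_uIcc).aestronglyMeasurable measurableSet_uIoc
  · exact Eventually.of_forall fun s hs r hr =>
      hB (r, s) ⟨Metric.ball_subset_closedBall hr, uIoc_subset_uIcc hs⟩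
  · refine Eventually.of_forall fun s hs r hr => ?_
    have hr1 : HasDerivAt (fun r : ℝ => (r : ℂ)) 1 r := Complex.ofRealCLM.hasDerivAt
    have d2 : HasDerivAt (fun r : ℝ => (c * r + d : ℂ)) c r := by
      simpa using (hr1.const_mul (c : ℂ)).add_const (d : ℂ)
    have d1 : HasDerivAt (fun r : ℝ => (r + Complex.I * s * (c * r + d) : ℂ))
        (1 + Complex.I * s * c) r := hr1.add (d2.const_mul (Complex.I * s))
    have d3 := ((hF.differentiableAt (hU.mem_nhds (hmem r (Metric.ball_subset_closedBall hr) s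
      (uIoc_subset_uIcc hs)))).hasDerivAt).comp r d1
    exact d3.fun_mul d2

lemma abs_le_of_mem_uIcc {s θ : ℝ} (h : s ∈ uIcc 0 θ) : |s| ≤ |θ| := by
  rcases le_total 0 θ with h0 | h0
  · rw [uIcc_of_le h0] at h
    rw [abs_of_nonneg h.1, abs_of_nonneg h0]; exact h.2
  · rw [uIcc_of_ge h0] at h
    rw [abs_of_nonpos h.2, abs_of_nonpos h0]; linarith [h.1]

lemma branch_of_le {s r : ℝ} (h : r ≤ 1) : branch s r = r + Complex.I * s * ((1 : ℝ) * r + (0 : ℝ)) := by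
  apply Complex.ext <;> simp [branch, min_eq_left h]

lemma branch_of_ge {s r : ℝ} (h : 1 ≤ r) : branch s r = r + Complex.I * s * ((0 : ℝ) * r + (1 : ℝ)) := by
  apply Complex.ext <;> simp [branch, min_eq_right h]

/-- Needed for the corner r = 1, where the transversal integral is not shown to be differentiable.
-/
lemma continuousOn_contour {σ θ : ℝ} (hθ : |θ| < σ) {F : ℂ → ℂ} (hF : ContinuousOn F (pencil σ)) :
    ContinuousOn (fun r : ℝ => ∫ s in (0 : ℝ)..θ, F (branch s r) * (min r 1 : ℝ)) (Ioi 0) := by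
  intro r₀ hr₀
  have hr₀ : 0 < r₀ := hr₀
  have hmaps : MapsTo (fun p : ℝ × ℝ => branch p.2 p.1)
      (Metric.closedBall r₀ (r₀ / 2) ×ˢ uIcc 0 θ) (pencil σ) := fun p hp => by
    refine branch_mem_pencil ((abs_le_of_mem_uIcc hp.2).trans_lt hθ) ?_
    have : |p.1 - r₀| ≤ r₀ / 2 := by simpa [Real.dist_eq] using hp.1
    linarith [(abs_le.1 this).1]
  have hc : ContinuousOn (fun p : ℝ × ℝ => F (branch p.2 p.1) * (min p.1 1 : ℝ))
      (Metric.closedBall r₀ (r₀ / 2) ×ˢ uIcc 0 θ) :=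
    (hF.comp (continuous_branch.comp continuous_swap).continuousOn hmaps).mul
      (Continuous.continuousOn (by fun_prop))
  obtain ⟨B, hB⟩ := ((isCompact_closedBall r₀ (r₀ / 2)).prod
    isCompact_uIcc).exists_bound_of_continuousOn hc
  have hnh : Metric.closedBall r₀ (r₀ / 2) ∈ 𝓝 r₀ := Metric.closedBall_mem_nhds _ (by linarith)
  refine ContinuousAt.continuousWithinAt
    (intervalIntegral.continuousAt_of_dominated_interval (bound := fun _ => B) ?_ ?_ (by simp) ?_)
  · filter_upwards [hnh] with r hr
    exact ((hc.comp (by fun_prop : Continuous fun s : ℝ => (r, s)).continuousOn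
      fun s hs => ⟨hr, uIoc_subset_uIcc hs⟩)).aestronglyMeasurable measurableSet_uIoc
  · filter_upwards [hnh] with r hr
    exact Eventually.of_forall fun s hs => hB (r, s) ⟨hr, uIoc_subset_uIcc hs⟩
  · refine Eventually.of_forall fun s hs => ?_
    exact (hc.comp (by fun_prop : Continuous fun r : ℝ => (r, s)).continuousOn
      fun r hr => ⟨hr, uIoc_subset_uIcc hs⟩).continuousAt hnh

lemma norm_branchDeriv_le {θ : ℝ} (hθ : |θ| < 1) (r : ℝ) : ‖branchDeriv θ r‖ ≤ 2 := by
  unfold branchDeriv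
  split_ifs
  · refine (norm_add_le _ _).trans ?_
    simp; linarith
  · simp

lemma measurable_branchDeriv (θ : ℝ) : Measurable (branchDeriv θ) :=
  Measurable.ite measurableSet_Iio measurable_const measurable_const

/-- Dividing by min(r,1) removes the Jacobian of the transversal segment. By Tonelli the rest is an
integral over s of branch integrals, each at most the L¹ norm. This makes the transversal integral
vanish at both ends. -/
lemma integrable_contour {σ θ : ℝ} (hθ : |θ| < σ) {F : ℂ → ℂ} (hF : PencilL1 σ F) :
    IntegrableOn (fun r : ℝ => (min r 1)⁻¹ • ∫ s in (0 : ℝ)..θ, F (branch s r) * (min r 1 : ℝ))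
      (Ioi 0) := by
  have hmc : ContinuousOn (fun r : ℝ => (min r 1)⁻¹) (Ioi 0) :=
    ContinuousOn.inv₀ (Continuous.continuousOn (by fun_prop))
      fun r hr => (lt_min hr one_pos).ne'
  refine ⟨(hmc.smul (continuousOn_contour hθ hF.holo.continuousOn)).aestronglyMeasurable
    measurableSet_Ioi, ?_⟩
  have hmeas : AEMeasurable (fun p : ℝ × ℝ => ‖F (branch p.2 p.1)‖ₑ)
      ((volume.restrict (Ioi 0)).prod (volume.restrict (uIoc 0 θ))) := by
    rw [Measure.prod_restrict]
    refine (ContinuousOn.aestronglyMeasurable ?_ (measurableSet_Ioi.prod measurableSet_uIoc)).enorm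
    exact hF.holo.continuousOn.comp (continuous_branch.comp continuous_swap).continuousOn
      fun p hp => branch_mem_pencil
        ((abs_le_of_mem_uIcc (uIoc_subset_uIcc hp.2)).trans_lt hθ) hp.1
  calc ∫⁻ r in Ioi (0 : ℝ), ‖(min r 1)⁻¹ • ∫ s in (0 : ℝ)..θ, F (branch s r) * (min r 1 : ℝ)‖ₑ
      ≤ ∫⁻ r in Ioi (0 : ℝ), ∫⁻ s in uIoc 0 θ, ‖F (branch s r)‖ₑ := by
        refine setLIntegral_mono' measurableSet_Ioi fun r hr => ?_
        have hm : 0 < min r 1 := lt_min hr one_pos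
        have : (min r 1)⁻¹ • ∫ s in (0 : ℝ)..θ, F (branch s r) * (min r 1 : ℝ) =
            ∫ s in (0 : ℝ)..θ, F (branch s r) := by
          rw [intervalIntegral.integral_mul_const, Complex.real_smul, mul_comm, mul_assoc,
            ← Complex.ofReal_mul, mul_inv_cancel₀ hm.ne']; simp
        rw [this, ← ofReal_norm, intervalIntegral.norm_integral_eq_norm_integral_uIoc,
          ofReal_norm]
        exact enorm_integral_le_lintegral_enorm _
    _ = ∫⁻ s in uIoc 0 θ, ∫⁻ r in Ioi (0 : ℝ), ‖F (branch s r)‖ₑ := lintegral_lintegral_swap hmeas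
    _ ≤ ∫⁻ s in uIoc 0 θ, l1ModeNorm σ F := by
        refine setLIntegral_mono' measurableSet_uIoc fun s hs => ?_
        exact lintegral_branch_le F ((abs_le_of_mem_uIcc (uIoc_subset_uIcc hs)).trans_lt hθ)
    _ < ⊤ := by
        rw [setLIntegral_const]
        refine ENNReal.mul_lt_top hF.fin ?_
        rw [uIoc, Real.volume_Ioc]; exact ENNReal.ofReal_lt_top

lemma hasDerivAt_contour_branch {σ θ : ℝ} (hθ : |θ| < σ) {F : ℂ → ℂ}
    (hF : DifferentiableOn ℂ F (pencil σ)) {r : ℝ} (hr : 0 < r) (hr1 : r ≠ 1) :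
    HasDerivAt (fun r : ℝ => ∫ s in (0 : ℝ)..θ, F (branch s r) * (min r 1 : ℝ))
      (-Complex.I * (F (branch θ r) * branchDeriv θ r - F r)) r := by
  rcases lt_or_gt_of_ne hr1 with h | h
  · obtain ⟨ε, hε, hb⟩ : ∃ ε > 0, Metric.closedBall r ε ⊆ Ioo 0 1 :=
      Metric.nhds_basis_closedBall.mem_iff.1 (Ioo_mem_nhds hr h)
    have hd := hasDerivAt_contour (isOpen_pencil σ) hF 1 0 θ hε (r₀ := r) (fun x hx s hs => by
      rw [← branch_of_le (hb hx).2.le]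
      exact branch_mem_pencil ((abs_le_of_mem_uIcc hs).trans_lt hθ) (hb hx).1)
    rw [← branch_of_le h.le] at hd
    refine (hd.congr_of_eventuallyEq ?_).congr_deriv ?_
    · filter_upwards [Ioo_mem_nhds hr h] with x hx
      simp only [branch_of_le hx.2.le, min_eq_left hx.2.le]
      simp
    · simp [branchDeriv, h]
  · obtain ⟨ε, hε, hb⟩ : ∃ ε > 0, Metric.closedBall r ε ⊆ Ioi 1 :=
      Metric.nhds_basis_closedBall.mem_iff.1 (Ioi_mem_nhds h)
    have hd := hasDerivAt_contour (isOpen_pencil σ) hF 0 1 θ hε (r₀ := r) (fun x hx s hs => by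
      rw [← branch_of_ge (le_of_lt (hb hx))]
      exact branch_mem_pencil ((abs_le_of_mem_uIcc hs).trans_lt hθ) (one_pos.trans (hb hx)))
    rw [← branch_of_ge h.le] at hd
    refine (hd.congr_of_eventuallyEq ?_).congr_deriv ?_
    · filter_upwards [Ioi_mem_nhds h] with x hx
      simp only [branch_of_ge (mem_Ioi.1 hx).le, min_eq_right (mem_Ioi.1 hx).le]
      simp
    · simp [branchDeriv, h.le.not_gt]

/-- Cauchy's theorem: the contour `ℝ₊` may be replaced by a branch of the pencil. -/
lemma integral_eq_integral_branch {σ θ : ℝ} (hσ1 : σ < 1) (hθ : |θ| < σ) {F : ℂ → ℂ}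
    (hF : PencilL1 σ F) : ∫ r in Ioi (0 : ℝ), F r =
      ∫ r in Ioi (0 : ℝ), F (branch θ r) * branchDeriv θ r := by
  have hσ := (abs_nonneg θ).trans_lt hθ
  have i1 : IntegrableOn (fun r => F (branch θ r) * branchDeriv θ r) (Ioi 0) :=
    (integrableOn_branch hF hθ).mul_bdd (c := 2)
      (measurable_branchDeriv θ).aestronglyMeasurable
      (Eventually.of_forall fun r => norm_branchDeriv_le (hθ.trans hσ1) r)
  have i2 := hF.integrableOn hσ
  have h := integral_Ioi_deriv_eq_zero (continuousOn_contour hθ hF.holo.continuousOn)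
    (fun r hr hr1 => hasDerivAt_contour_branch hθ hF.holo hr hr1)
    ((i1.sub i2).const_mul (-Complex.I)) (integrable_contour hθ hF)
  rw [integral_const_mul, integral_sub i1 i2] at h
  have hI : -Complex.I ≠ 0 := by simp
  exact (sub_eq_zero.1 ((mul_eq_zero.1 h).resolve_left hI)).symm

end

noncomputable section

/-! ### Integral operators with bounded holomorphic kernels -/

/-- The operator `h ↦ ∫_0^∞ k(y,z) h(y) dy`. -/
def intOp (k : ℂ → ℂ → ℂ) (h : ℂ → ℂ) : ℂ → ℂ := fun z => ∫ y in Ioi (0 : ℝ), k y z * h y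

/-- A bounded separately holomorphic kernel on the pencil. -/
structure IsPencilKernel (σ : ℝ) (k : ℂ → ℂ → ℂ) : Prop where
  fst : ∀ z ∈ pencil σ, DifferentiableOn ℂ (fun y => k y z) (pencil σ)
  snd : ∀ y ∈ pencil σ, DifferentiableOn ℂ (k y) (pencil σ)
  bdd : ∃ B : ℝ, ∀ y ∈ pencil σ, ∀ z ∈ pencil σ, ‖k y z‖ ≤ B

lemma l1ModeNorm_le_of_norm_le {σ B : ℝ} (hB : 0 ≤ B) {g h : ℂ → ℂ}
    (hgh : ∀ z ∈ pencil σ, ‖g z‖ ≤ B * ‖h z‖) :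
    l1ModeNorm σ g ≤ ENNReal.ofReal B * l1ModeNorm σ h := by
  refine iSup₂_le fun θ hθ => ?_
  have hθ' : |θ| < σ := by rw [abs_of_nonneg hθ.1]; exact hθ.2
  have : ∫⁻ r in Ioi (0 : ℝ), ENNReal.ofReal ((‖g (branch θ r)‖ + ‖g (branch (-θ) r)‖) *
      arcDensity θ r) ≤ ∫⁻ r in Ioi (0 : ℝ), ENNReal.ofReal B * ENNReal.ofReal
      ((‖h (branch θ r)‖ + ‖h (branch (-θ) r)‖) * arcDensity θ r) := by
    refine setLIntegral_mono' measurableSet_Ioi fun r hr => ?_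
    rw [← ENNReal.ofReal_mul hB]
    apply ENNReal.ofReal_le_ofReal
    have h1 := hgh _ (branch_mem_pencil hθ' hr)
    have h2 := hgh _ (branch_mem_pencil (θ := -θ) (by rwa [abs_neg]) hr)
    have h3 := zero_le_one.trans (one_le_arcDensity θ r)
    calc _ ≤ (B * ‖h (branch θ r)‖ + B * ‖h (branch (-θ) r)‖) * arcDensity θ r := by gcongr
      _ = _ := by ring
  refine this.trans ?_
  rw [lintegral_const_mul' _ _ ENNReal.ofReal_ne_top]
  gcongr
  exact le_iSup₂ (f := fun θ (_ : θ ∈ Ico 0 σ) => ∫⁻ r in Ioi (0 : ℝ),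
    ENNReal.ofReal ((‖h (branch θ r)‖ + ‖h (branch (-θ) r)‖) * arcDensity θ r)) θ hθ

variable {σ : ℝ} {k : ℂ → ℂ → ℂ} {h : ℂ → ℂ}

lemma IsPencilKernel.exists_bound (hk : IsPencilKernel σ k) :
    ∃ B : ℝ, 0 ≤ B ∧ ∀ y ∈ pencil σ, ∀ z ∈ pencil σ, ‖k y z‖ ≤ B := by
  obtain ⟨B, hB⟩ := hk.bdd
  exact ⟨max B 0, le_max_right _ _, fun y hy z hz => (hB y hy z hz).trans (le_max_left _ _)⟩

lemma IsPencilKernel.mul (hk : IsPencilKernel σ k) (hh : PencilL1 σ h) {z : ℂ}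
    (hz : z ∈ pencil σ) : PencilL1 σ (fun y => k y z * h y) := by
  obtain ⟨B, hB0, hB⟩ := hk.exists_bound
  refine ⟨(hk.fst z hz).mul hh.holo, ?_⟩
  refine (l1ModeNorm_le_of_norm_le hB0 fun y hy => ?_).trans_lt
    (ENNReal.mul_lt_top ENNReal.ofReal_lt_top hh.fin)
  rw [norm_mul]
  exact mul_le_mul_of_nonneg_right (hB y hy z hz) (norm_nonneg _)

/-- Cauchy's estimate bounds ∂_z k by the sup of k over a small disc, so a multiple of |h|
dominates. -/
lemma IsPencilKernel.hasDerivAt_intOp (hσ : 0 < σ) (hk : IsPencilKernel σ k) (hh : PencilL1 σ h)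
    {z : ℂ} (hz : z ∈ pencil σ) :
    IntegrableOn (fun y : ℝ => deriv (k y) z * h y) (Ioi 0) ∧
    HasDerivAt (intOp k h) (∫ y in Ioi (0 : ℝ), deriv (k y) z * h y) z := by
  obtain ⟨B, hB0, hB⟩ := hk.exists_bound
  obtain ⟨ε, hε, hb⟩ := Metric.isOpen_iff.1 (isOpen_pencil σ) z hz
  have hU := isOpen_pencil σ
  have hmem : ∀ {y : ℝ}, y ∈ Ioi (0 : ℝ) → (y : ℂ) ∈ pencil σ := fun hy => ofReal_mem_pencil hσ hy
  have hcont : ∀ w ∈ pencil σ, ContinuousOn (fun y : ℝ => k y w) (Ioi 0) := fun w hw =>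
    (hk.fst w hw).continuousOn.comp Complex.continuous_ofReal.continuousOn fun y hy => hmem hy
  have hh1 := hh.integrableOn hσ
  have hd : ∀ {y : ℝ}, y ∈ Ioi (0 : ℝ) → ∀ w ∈ pencil σ, HasDerivAt (k y) (deriv (k y) w) w :=
    fun hy w hw => ((hk.snd _ (hmem hy)).differentiableAt (hU.mem_nhds hw)).hasDerivAt
  have hseq : ∀ n : ℕ, z + ((ε / 2 / (n + 1) : ℝ) : ℂ) ∈ pencil σ := fun n => hb (by
    rw [Metric.mem_ball, dist_eq_norm, add_sub_cancel_left, Complex.norm_real,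
      Real.norm_of_nonneg (by positivity)]
    have : ε / 2 / (n + 1) ≤ ε / 2 := div_le_self (by linarith) (by linarith [n.cast_nonneg (α := ℝ)])
    linarith)
  have hlim : Tendsto (fun n : ℕ => ((ε / 2 / (n + 1) : ℝ) : ℂ)) atTop (𝓝[≠] 0) := by
    refine tendsto_nhdsWithin_iff.2 ⟨?_, Eventually.of_forall fun n => ?_⟩
    · have h1 : Tendsto (fun n : ℕ => ε / 2 / ((n : ℝ) + 1)) atTop (𝓝 0) := by
        have := (tendsto_one_div_add_atTop_nhds_zero_nat (𝕜 := ℝ)).const_mul (ε / 2)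
        simpa [div_eq_mul_inv] using this
      exact_mod_cast (Complex.continuous_ofReal.tendsto 0).comp h1
    · have : ε / 2 / ((n : ℝ) + 1) ≠ 0 := by positivity
      exact Complex.ofReal_ne_zero.2 this
  -- The kernel is only separately holomorphic, so measurability of ∂_z k in y comes from difference
  -- quotients along a sequence of increments tending to 0.
  have hmeas : AEStronglyMeasurable (fun y : ℝ => deriv (k y) z) (volume.restrict (Ioi 0)) := by
    refine aestronglyMeasurable_of_tendsto_ae atTop (f := fun (n : ℕ) (y : ℝ) =>
      (((ε / 2 / (n + 1) : ℝ) : ℂ))⁻¹ • (k y (z + ((ε / 2 / (n + 1) : ℝ) : ℂ)) - k y z))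
      (fun n => ?_) ?_
    · exact ContinuousOn.aestronglyMeasurable
        (continuousOn_const.fun_smul ((hcont _ (hseq n)).fun_sub (hcont z hz))) measurableSet_Ioi
    · refine (ae_restrict_iff' measurableSet_Ioi).2 (Eventually.of_forall fun y hy => ?_)
      exact (hasDerivAt_iff_tendsto_slope_zero.1 (hd hy z hz)).comp hlim
  have hball : ∀ w ∈ Metric.ball z (ε / 2), Metric.closedBall w (ε / 4) ⊆ pencil σ := by
    intro w hw
    refine (Metric.closedBall_subset_ball' ?_).trans hb
    have := Metric.mem_ball.1 hw
    linarith
  refine hasDerivAt_integral_of_dominated_loc_of_deriv_le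
    (F := fun w (y : ℝ) => k y w * h y) (F' := fun w (y : ℝ) => deriv (k y) w * h y)
    (bound := fun y : ℝ => B / (ε / 4) * ‖h y‖) (s := Metric.ball z (ε / 2))
    (Metric.ball_mem_nhds z (by linarith)) ?_ ?_ ?_ ?_ ?_ ?_
  · filter_upwards [hU.mem_nhds hz] with w hw
    exact ((hcont w hw).aestronglyMeasurable measurableSet_Ioi).mul hh1.aestronglyMeasurable
  · exact (hk.mul hh hz).integrableOn hσ
  · exact hmeas.mul hh1.aestronglyMeasurable
  · refine (ae_restrict_iff' measurableSet_Ioi).2 (Eventually.of_forall fun y hy w hw => ?_)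
    rw [norm_mul]
    refine mul_le_mul_of_nonneg_right ?_ (norm_nonneg _)
    refine Complex.norm_deriv_le_of_forall_mem_sphere_norm_le (by linarith) ?_ fun u hu =>
      hB y (hmem hy) u (hball w hw (Metric.sphere_subset_closedBall hu))
    refine DifferentiableOn.diffContOnCl ?_
    rw [closure_ball _ (by linarith : ε / 4 ≠ 0)]
    exact (hk.snd y (hmem hy)).mono (hball w hw)
  · exact hh1.norm.const_mul _
  · refine (ae_restrict_iff' measurableSet_Ioi).2 (Eventually.of_forall fun y hy w hw => ?_)
    exact (hd hy w (hball w hw (Metric.mem_closedBall_self (by linarith)))).mul_const _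

lemma IsPencilKernel.differentiableOn_intOp (hσ : 0 < σ) (hk : IsPencilKernel σ k)
    (hh : PencilL1 σ h) : DifferentiableOn ℂ (intOp k h) (pencil σ) := fun _ hz =>
  (hk.hasDerivAt_intOp hσ hh hz).2.differentiableAt.differentiableWithinAt

/-- ψ vanishes at 0 fast enough to absorb the factor 1/min(r,1) in `integral_Ioi_deriv_eq_zero`. -/
lemma norm_psi_ofReal_le {r : ℝ} (hr : 0 < r) : ‖psi r‖ ≤ min r 1 := by
  have : psi r = ((r / (1 + r) : ℝ) : ℂ) := by simp [psi]
  rw [this, Complex.norm_real, Real.norm_of_nonneg (by positivity)]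
  refine le_min ?_ ?_
  · exact div_le_self hr.le (by linarith)
  · rw [div_le_one (by linarith)]; linarith

/-- The commutator of `ψ∂_z` with an integral operator, by integration by parts. -/
lemma conD_intOp (hσ : 0 < σ) {k' : ℂ → ℂ → ℂ} (hk : IsPencilKernel σ k)
    (hk' : IsPencilKernel σ k') (hh : PencilL1 σ h) (hh' : PencilL1 σ (conD h))
    (hkk : ∀ y ∈ pencil σ, ∀ z ∈ pencil σ, k' y z = psi z * deriv (k y) z +
      psi y * deriv (fun y => k y z) y + ((1 + y)⁻¹) ^ 2 * k y z) :
    EqOn (conD (intOp k h)) (fun z => intOp k' h z + intOp k (conD h) z) (pencil σ) := by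
  intro z hz
  obtain ⟨hi, hD⟩ := hk.hasDerivAt_intOp hσ hh hz
  have hU := isOpen_pencil σ
  have hmem : ∀ {y : ℝ}, 0 < y → (y : ℂ) ∈ pencil σ := fun hy => ofReal_mem_pencil hσ hy
  have i0 := (hk.mul hh hz).integrableOn hσ
  have i1 := (hk'.mul hh hz).integrableOn hσ
  have i2 := (hk.mul hh' hz).integrableOn hσ
  have i3 := hi.const_mul (psi z)
  -- The total derivative to be integrated to zero; its terms are arranged so that ψ(z)∂_z k h is
  -- the only one outside the two operators on the right.
  have hd : ∀ r : ℝ, 0 < r → HasDerivAt (fun r : ℝ => psi r * (k r z * h r))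
      (k' r z * h r + k r z * conD h r - psi z * (deriv (k r) z * h r)) r := by
    intro r hr
    have hr' := hmem hr
    have d1 := hasDerivAt_psi (z := (r : ℂ)) (by simpa using hr.le)
    have d2 := ((hk.fst z hz).differentiableAt (hU.mem_nhds hr')).hasDerivAt
    have d3 := (hh.holo.differentiableAt (hU.mem_nhds hr')).hasDerivAt
    refine ((d1.fun_mul (d2.fun_mul d3)).comp_ofReal).congr_deriv ?_
    rw [hkk r hr' z hz, conD]; ring
  have hmc : ContinuousOn (fun r : ℝ => (min r 1)⁻¹) (Ioi 0) :=
    ContinuousOn.inv₀ (Continuous.continuousOn (by fun_prop)) fun r hr => (lt_min hr one_pos).ne'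
  have hcf : ContinuousOn (fun r : ℝ => psi r * (k r z * h r)) (Ioi 0) := fun r hr =>
    (hd r hr).continuousAt.continuousWithinAt
  have hz0 := integral_Ioi_deriv_eq_zero hcf (fun r hr _ => hd r hr) ((i1.add i2).sub i3) (by
    refine Integrable.mono' i0.norm ((hmc.smul hcf).aestronglyMeasurable measurableSet_Ioi) ?_
    refine (ae_restrict_iff' measurableSet_Ioi).2 (Eventually.of_forall fun r hr => ?_)
    have hr : 0 < r := hr
    have hm : 0 < min r 1 := lt_min hr one_pos
    rw [norm_smul, norm_mul, Real.norm_of_nonneg (inv_pos.2 hm).le, ← mul_assoc]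
    refine mul_le_of_le_one_left (norm_nonneg _) ?_
    rw [inv_mul_le_iff₀ hm, mul_one]
    exact norm_psi_ofReal_le hr)
  have e := integral_sub (i1.add i2) i3
  simp only [Pi.add_apply] at e
  rw [e, integral_add i1 i2, integral_const_mul, sub_eq_zero] at hz0
  rw [conD, hD.deriv, ← hz0]
  rfl

/-- The value of the integral operator at a point, with the contour through this point. -/
lemma enorm_intOp_branch_le (hσ1 : σ < 1) (hk : IsPencilKernel σ k) (hh : PencilL1 σ h)
    {θ x : ℝ} (hθ : |θ| < σ) (hx : 0 < x) :
    ‖intOp k h (branch θ x)‖ₑ ≤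
      2 * ∫⁻ r in Ioi (0 : ℝ), ‖k (branch θ r) (branch θ x)‖ₑ * ‖h (branch θ r)‖ₑ := by
  rw [intOp, integral_eq_integral_branch hσ1 hθ (hk.mul hh (branch_mem_pencil hθ hx))]
  refine (enorm_integral_le_lintegral_enorm _).trans ?_
  rw [← lintegral_const_mul' _ _ (by norm_num)]
  refine lintegral_mono fun r => ?_
  have h2 : ‖branchDeriv θ r‖ₑ ≤ 2 := by
    rw [← ofReal_norm]
    exact (ENNReal.ofReal_le_ofReal (norm_branchDeriv_le (hθ.trans hσ1) r)).trans (by simp)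
  calc _ = ‖k (branch θ r) (branch θ x)‖ₑ * ‖h (branch θ r)‖ₑ * ‖branchDeriv θ r‖ₑ := by
        rw [enorm_mul, enorm_mul]
    _ ≤ ‖k (branch θ r) (branch θ x)‖ₑ * ‖h (branch θ r)‖ₑ * 2 := by gcongr
    _ = _ := by rw [mul_comm]

/-! ### Coefficients generated by the commutators -/

/-- Polynomials in `1/(1+y)`, `1/(1+z)` and `y/(y+z)`. -/
inductive IsCoef : (ℂ → ℂ → ℂ) → Prop
  | const (c : ℂ) : IsCoef fun _ _ => c
  | fst : IsCoef fun y _ => (1 + y)⁻¹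
  | snd : IsCoef fun _ z => (1 + z)⁻¹
  | frac : IsCoef fun y z => y / (y + z)
  | add {A A' : ℂ → ℂ → ℂ} : IsCoef A → IsCoef A' → IsCoef fun y z => A y z + A' y z
  | mul {A A' : ℂ → ℂ → ℂ} : IsCoef A → IsCoef A' → IsCoef fun y z => A y z * A' y z

lemma norm_inv_one_add_le {z : ℂ} (hz : 0 ≤ z.re) : ‖(1 + z)⁻¹‖ ≤ 1 := by
  rw [norm_inv]
  refine inv_le_one_of_one_le₀ ?_
  have := Complex.re_le_norm (1 + z)
  simp at this; linarith

/-- For y/(y+z): |y| ≤ 2 Re y ≤ 2|y+z| on the cone. The vertex y = 0 is included, since the boundary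
operator evaluates coefficients there. -/
lemma IsCoef.exists_bound {A : ℂ → ℂ → ℂ} (hA : IsCoef A) :
    ∃ B : ℝ, 0 ≤ B ∧ ∀ y z, y ∈ cone 1 → 0 < z.re → ‖A y z‖ ≤ B := by
  induction hA with
  | const c => exact ⟨‖c‖, norm_nonneg _, fun _ _ _ _ => le_rfl⟩
  | fst => exact ⟨1, zero_le_one, fun y z hy _ => norm_inv_one_add_le (cone_re_nonneg one_pos hy)⟩
  | snd => exact ⟨1, zero_le_one, fun y z _ hz => norm_inv_one_add_le hz.le⟩
  | frac =>
    refine ⟨2, by norm_num, fun y z hy hz => ?_⟩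
    have h0 := cone_re_nonneg one_pos hy
    have h1 : |y.im| ≤ 1 * y.re := hy
    have h2 := Complex.norm_le_abs_re_add_abs_im y
    have h3 := Complex.re_le_norm (y + z)
    rw [abs_of_nonneg h0] at h2
    rw [Complex.add_re] at h3
    rw [norm_div, div_le_iff₀ (by linarith)]
    linarith
  | add _ _ h1 h2 =>
    obtain ⟨B1, p1, h1⟩ := h1
    obtain ⟨B2, p2, h2⟩ := h2
    exact ⟨B1 + B2, by positivity, fun y z hy hz =>
      (norm_add_le _ _).trans (add_le_add (h1 y z hy hz) (h2 y z hy hz))⟩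
  | mul _ _ h1 h2 =>
    obtain ⟨B1, p1, h1⟩ := h1
    obtain ⟨B2, p2, h2⟩ := h2
    refine ⟨B1 * B2, by positivity, fun y z hy hz => ?_⟩
    rw [norm_mul]
    exact mul_le_mul (h1 y z hy hz) (h2 y z hy hz) (norm_nonneg _) p1

lemma add_ne_zero_of_re {y z : ℂ} (hy : 0 ≤ y.re) (hz : 0 < z.re) : y + z ≠ 0 := fun e => by
  have := congrArg Complex.re e
  simp at this; linarith

lemma hasDerivAt_inv_one_add {z : ℂ} (hz : 0 ≤ z.re) :
    HasDerivAt (fun z : ℂ => (1 + z)⁻¹) (-((1 + z)⁻¹) ^ 2) z := by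
  refine (((hasDerivAt_id z).const_add 1).fun_inv (one_add_ne_zero hz)).congr_deriv ?_
  simp only [id]; field_simp

lemma IsCoef.sub {A A' : ℂ → ℂ → ℂ} (h : IsCoef A) (h' : IsCoef A') :
    IsCoef fun y z => A y z + (-1) * A' y z := h.add ((IsCoef.const (-1)).mul h')

/-- The derivation `ψ(y)∂_y + ψ(z)∂_z` preserves coefficients. -/
lemma IsCoef.exists_deriv {A : ℂ → ℂ → ℂ} (hA : IsCoef A) :
    ∃ A', IsCoef A' ∧ ∀ y z : ℂ, 0 ≤ y.re → 0 < z.re → ∃ a b, HasDerivAt (fun y => A y z) a y ∧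
      HasDerivAt (A y) b z ∧ psi y * a + psi z * b = A' y z := by
  induction hA with
  | const c =>
    exact ⟨_, .const 0, fun y z _ _ => ⟨0, 0, hasDerivAt_const _ _, hasDerivAt_const _ _, by simp⟩⟩
  | fst =>
    refine ⟨_, (((IsCoef.const 1).sub .fst).mul (.mul .fst .fst)).mul (.const (-1)), fun y z hy _ =>
      ⟨_, 0, hasDerivAt_inv_one_add hy, hasDerivAt_const _ _, ?_⟩⟩
    have := one_add_ne_zero hy
    simp only [psi]; field_simp; ring
  | snd =>
    refine ⟨_, (((IsCoef.const 1).sub .snd).mul (.mul .snd .snd)).mul (.const (-1)), fun y z _ hz =>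
      ⟨0, _, hasDerivAt_const _ _, hasDerivAt_inv_one_add hz.le, ?_⟩⟩
    have := one_add_ne_zero hz.le
    simp only [psi]; field_simp; ring
  | frac =>
    -- With q = y/(y+z) the result is q(1−q)(1/(1+y) − 1/(1+z)): the derivation does not leave the
    -- algebra.
    refine ⟨_, (IsCoef.frac.mul ((IsCoef.const 1).sub .frac)).mul (IsCoef.fst.sub .snd),
      fun y z hy hz => ⟨z / (y + z) ^ 2, -y / (y + z) ^ 2, ?_, ?_, ?_⟩⟩
    · refine ((hasDerivAt_id y).fun_div ((hasDerivAt_id y).add_const z)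
        (add_ne_zero_of_re hy hz)).congr_deriv ?_
      simp
    · refine ((hasDerivAt_const z y).fun_div ((hasDerivAt_id z).const_add y)
        (add_ne_zero_of_re hy hz)).congr_deriv ?_
      simp
    · have h1 := one_add_ne_zero hy
      have h2 := one_add_ne_zero hz.le
      have h3 := add_ne_zero_of_re hy hz
      simp only [psi]; field_simp; ring
  | add _ _ h1 h2 =>
    obtain ⟨A1, c1, h1⟩ := h1
    obtain ⟨A2, c2, h2⟩ := h2
    refine ⟨_, c1.add c2, fun y z hy hz => ?_⟩
    obtain ⟨a1, b1, d1, e1, f1⟩ := h1 y z hy hz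
    obtain ⟨a2, b2, d2, e2, f2⟩ := h2 y z hy hz
    exact ⟨_, _, d1.fun_add d2, e1.fun_add e2, by rw [← f1, ← f2]; ring⟩
  | @mul A A' g1 g2 h1 h2 =>
    obtain ⟨A1, c1, h1⟩ := h1
    obtain ⟨A2, c2, h2⟩ := h2
    refine ⟨_, (c1.mul g2).add (g1.mul c2), fun y z hy hz => ?_⟩
    obtain ⟨a1, b1, d1, e1, f1⟩ := h1 y z hy hz
    obtain ⟨a2, b2, d2, e2, f2⟩ := h2 y z hy hz
    exact ⟨_, _, d1.fun_mul d2, e1.fun_mul e2, by rw [← f1, ← f2]; ring⟩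

/-- ψ(y) − ψ(z) = (y−z)/((1+y)(1+z)), and ψ(y) + ψ(z) = (y+z)(q/(1+y) + (1−q)/(1+z)) with q =
y/(y+z). Hence the derivation acts on a function of the phase as a bounded multiple of the Euler
operator. -/
lemma exists_phase_coef {ε : ℂ} (hε : ε = 1 ∨ ε = -1) : ∃ c, IsCoef c ∧ ∀ y z : ℂ, 0 ≤ y.re →
    0 < z.re → psi y + ε * psi z = (y + ε * z) * c y z := by
  rcases hε with rfl | rfl
  · refine ⟨_, (IsCoef.frac.mul .fst).add (((IsCoef.const 1).sub .frac).mul .snd),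
      fun y z hy hz => ?_⟩
    have h1 := one_add_ne_zero hy
    have h2 := one_add_ne_zero hz.le
    have h3 := add_ne_zero_of_re hy hz
    simp only [psi]; field_simp; ring
  · refine ⟨_, IsCoef.fst.mul .snd, fun y z hy hz => ?_⟩
    have h1 := one_add_ne_zero hy
    have h2 := one_add_ne_zero hz.le
    simp only [psi]; field_simp; ring

/-! ### Phase kernels and their conormal derivatives -/

/-- The kernel `A(y,z) ((ζ∂_ζ)^n E)(y + εz)`. -/
def phaseKer (ε : ℂ) (A : ℂ → ℂ → ℂ) (E : ℂ → ℂ) (n : ℕ) (y z : ℂ) : ℂ :=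
  A y z * eul^[n] E (y + ε * z)

/-- Bounds of a kernel `E(y + εz)` and its Euler derivatives by kernels `M n` on the half-line. -/
structure KernelBound (σ : ℝ) (ε : ℂ) (E : ℂ → ℂ) (M : ℕ → ℝ → ℝ → ℝ) : Prop where
  entire : Differentiable ℂ E
  bdd : ∀ n, ∃ B : ℝ, ∀ y ∈ pencil σ, ∀ z ∈ pencil σ, ‖eul^[n] E (y + ε * z)‖ ≤ B
  le : ∀ n θ r x, |θ| < σ → 0 ≤ r → 0 < x →
    ‖eul^[n] E (branch θ r + ε * branch θ x)‖ ≤ M n r x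

lemma pencil_subset_cone (hσ : 0 < σ) (hσ1 : σ < 1) {z : ℂ} (hz : z ∈ pencil σ) : z ∈ cone 1 := by
  have h1 : |z.im| < σ * z.re := lt_of_lt_of_le hz (min_le_left _ _)
  have := pencil_re_pos hσ hz
  show |z.im| ≤ 1 * z.re
  nlinarith

/-- The derivation `ψ(y)∂_y + ψ(z)∂_z` applied to a phase kernel. -/
lemma exists_deriv_phaseKer {ε : ℂ} {A A' c : ℂ → ℂ → ℂ} {E : ℂ → ℂ} (hE : Differentiable ℂ E)
    (n : ℕ) {y z : ℂ}
    (hA : ∃ a b, HasDerivAt (fun y => A y z) a y ∧ HasDerivAt (A y) b z ∧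
      psi y * a + psi z * b = A' y z)
    (hc : psi y + ε * psi z = (y + ε * z) * c y z) :
    ∃ a b, HasDerivAt (fun y => phaseKer ε A E n y z) a y ∧ HasDerivAt (phaseKer ε A E n y) b z ∧
      psi y * a + psi z * b =
        phaseKer ε A' E n y z + phaseKer ε (fun y z => A y z * c y z) E (n + 1) y z := by
  obtain ⟨a, b, ha, hb, hab⟩ := hA
  have hD := (differentiable_iterate_eul n hE (y + ε * z)).hasDerivAt
  have d1 : HasDerivAt (fun y => eul^[n] E (y + ε * z)) (deriv (eul^[n] E) (y + ε * z)) y :=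
    hD.comp_add_const y (ε * z)
  have d2 : HasDerivAt (fun z => eul^[n] E (y + ε * z)) (deriv (eul^[n] E) (y + ε * z) * ε) z := by
    have h0 : HasDerivAt (fun z => y + ε * z) ε z := by
      simpa using ((hasDerivAt_id z).const_mul ε).const_add y
    exact HasDerivAt.comp z hD h0
  refine ⟨_, _, ha.fun_mul d1, hb.fun_mul d2, ?_⟩
  simp only [phaseKer, Function.iterate_succ_apply', eul]
  rw [← hab]
  linear_combination (A y z * deriv (eul^[n] E) (y + ε * z)) * hc

lemma isPencilKernel_phaseKer (hσ : 0 < σ) (hσ1 : σ < 1) {ε : ℂ} (hε : ε = 1 ∨ ε = -1)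
    {A : ℂ → ℂ → ℂ} (hA : IsCoef A) {E : ℂ → ℂ} {M : ℕ → ℝ → ℝ → ℝ} (hE : KernelBound σ ε E M)
    (n : ℕ) : IsPencilKernel σ (phaseKer ε A E n) := by
  obtain ⟨A', hA', hd⟩ := hA.exists_deriv
  obtain ⟨c, hc, hcc⟩ := exists_phase_coef hε
  have key : ∀ y ∈ pencil σ, ∀ z ∈ pencil σ, _ := fun y hy z hz =>
    exists_deriv_phaseKer (ε := ε) hE.entire n
      (hd y z (pencil_re_pos hσ hy).le (pencil_re_pos hσ hz))
      (hcc y z (pencil_re_pos hσ hy).le (pencil_re_pos hσ hz))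
  refine ⟨fun z hz y hy => ?_, fun y hy z hz => ?_, ?_⟩
  · obtain ⟨a, b, h1, -, -⟩ := key y hy z hz
    exact h1.differentiableAt.differentiableWithinAt
  · obtain ⟨a, b, -, h1, -⟩ := key y hy z hz
    exact h1.differentiableAt.differentiableWithinAt
  · obtain ⟨B, hB0, hB⟩ := hA.exists_bound
    obtain ⟨B', hB'⟩ := hE.bdd n
    refine ⟨B * B', fun y hy z hz => ?_⟩
    rw [phaseKer, norm_mul]
    exact mul_le_mul (hB y z (pencil_subset_cone hσ hσ1 hy) (pencil_re_pos hσ hz))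
      (hB' y hy z hz) (norm_nonneg _) hB0

lemma intOp_add {k₁ k₂ : ℂ → ℂ → ℂ} (hσ : 0 < σ) (h₁ : IsPencilKernel σ k₁)
    (h₂ : IsPencilKernel σ k₂) (hh : PencilL1 σ h) {z : ℂ} (hz : z ∈ pencil σ) :
    intOp (fun y z => k₁ y z + k₂ y z) h z = intOp k₁ h z + intOp k₂ h z := by
  simp only [intOp, add_mul]
  exact integral_add ((h₁.mul hh hz).integrableOn hσ) ((h₂.mul hh hz).integrableOn hσ)

lemma IsPencilKernel.add {k₁ k₂ : ℂ → ℂ → ℂ} (h₁ : IsPencilKernel σ k₁)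
    (h₂ : IsPencilKernel σ k₂) : IsPencilKernel σ (fun y z => k₁ y z + k₂ y z) := by
  obtain ⟨B₁, hB₁⟩ := h₁.bdd
  obtain ⟨B₂, hB₂⟩ := h₂.bdd
  exact ⟨fun z hz => (h₁.fst z hz).add (h₂.fst z hz), fun y hy => (h₁.snd y hy).add (h₂.snd y hy),
    B₁ + B₂, fun y hy z hz => (norm_add_le _ _).trans (add_le_add (hB₁ y hy z hz) (hB₂ y hy z hz))⟩

/-- One conormal derivative of a phase operator. -/
lemma conD_intOp_phaseKer (hσ : 0 < σ) (hσ1 : σ < 1) {ε : ℂ} (hε : ε = 1 ∨ ε = -1)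
    {A A' c : ℂ → ℂ → ℂ} (hA : IsCoef A) (hA' : IsCoef A')
    (hd : ∀ y z : ℂ, 0 ≤ y.re → 0 < z.re → ∃ a b, HasDerivAt (fun y => A y z) a y ∧
      HasDerivAt (A y) b z ∧ psi y * a + psi z * b = A' y z)
    (hc : IsCoef c) (hcc : ∀ y z : ℂ, 0 ≤ y.re → 0 < z.re → psi y + ε * psi z = (y + ε * z) * c y z)
    {E : ℂ → ℂ} {M : ℕ → ℝ → ℝ → ℝ} (hE : KernelBound σ ε E M) (n : ℕ)
    (hh : PencilL1 σ h) (hh' : PencilL1 σ (conD h)) :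
    EqOn (conD (intOp (phaseKer ε A E n) h))
      (fun z => (intOp (phaseKer ε (fun y z => A' y z + (1 + y)⁻¹ * (1 + y)⁻¹ * A y z) E n) h z +
        intOp (phaseKer ε (fun y z => A y z * c y z) E (n + 1)) h z) +
        intOp (phaseKer ε A E n) (conD h) z) (pencil σ) := by
  have k0 := isPencilKernel_phaseKer hσ hσ1 hε hA hE n
  have k1 := isPencilKernel_phaseKer hσ hσ1 hε (hA'.add ((IsCoef.fst.mul .fst).mul hA)) hE n
  have k2 := isPencilKernel_phaseKer hσ hσ1 hε (hA.mul hc) hE (n + 1)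
  intro z hz
  rw [conD_intOp hσ k0 (k1.add k2) hh hh' ?_ hz]
  · simp only
    rw [intOp_add hσ k1 k2 hh hz]
  · intro y hy z hz
    obtain ⟨a, b, h1, h2, h3⟩ := exists_deriv_phaseKer (ε := ε) hE.entire n
      (hd y z (pencil_re_pos hσ hy).le (pencil_re_pos hσ hz))
      (hcc y z (pencil_re_pos hσ hy).le (pencil_re_pos hσ hz))
    rw [h1.deriv, h2.deriv, add_comm (psi z * b), h3]
    simp only [phaseKer]; ring

/-- Conormal derivatives of a phase operator, estimated along the branch through the point. -/
lemma exists_enorm_iterate_conD_intOp_le {ε : ℂ} (hε : ε = 1 ∨ ε = -1) (l : ℕ) :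
    ∀ {A : ℂ → ℂ → ℂ}, IsCoef A → ∃ C : ℝ, 0 ≤ C ∧ ∀ (σ : ℝ) (E : ℂ → ℂ) (M : ℕ → ℝ → ℝ → ℝ)
      (n : ℕ) (h : ℂ → ℂ), 0 < σ → σ < 1 → KernelBound σ ε E M →
      (∀ j ≤ l, PencilL1 σ (conD^[j] h)) → ∀ θ x, |θ| < σ → 0 < x →
      ‖conD^[l] (intOp (phaseKer ε A E n) h) (branch θ x)‖ₑ ≤ ENNReal.ofReal C *
        ∑ i ∈ Finset.range (l + 1), ∑ j ∈ Finset.range (l + 1),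
          ∫⁻ r in Ioi (0 : ℝ), ENNReal.ofReal (M (n + i) r x) * ‖conD^[j] h (branch θ r)‖ₑ := by
  induction l with
  | zero =>
    intro A hA
    obtain ⟨B, hB0, hB⟩ := hA.exists_bound
    -- The 2 bounds the derivative of the branch parametrization.
    refine ⟨2 * B, by positivity, fun σ E M n h hσ hσ1 hE hh θ x hθ hx => ?_⟩
    refine (enorm_intOp_branch_le hσ1 (isPencilKernel_phaseKer hσ hσ1 hε hA hE n)
      (hh 0 le_rfl) hθ hx).trans ?_
    simp only [zero_add, Finset.range_one, Finset.sum_singleton, add_zero, Function.iterate_zero, id]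
    rw [ENNReal.ofReal_mul (by norm_num), ENNReal.ofReal_ofNat, mul_assoc]
    gcongr
    rw [← lintegral_const_mul' _ _ ENNReal.ofReal_ne_top]
    refine setLIntegral_mono' measurableSet_Ioi fun r hr => ?_
    rw [← mul_assoc, ← ENNReal.ofReal_mul hB0]
    gcongr
    rw [← ofReal_norm]
    apply ENNReal.ofReal_le_ofReal
    rw [phaseKer, norm_mul]
    exact mul_le_mul (hB _ _ (pencil_subset_cone hσ hσ1 (branch_mem_pencil hθ hr))
      (pencil_re_pos hσ (branch_mem_pencil hθ hx))) (hE.le n θ r x hθ (mem_Ioi.1 hr).le hx) (norm_nonneg _) hB0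
  | succ l ih =>
    intro A hA
    obtain ⟨A', hA', hd⟩ := hA.exists_deriv
    obtain ⟨c, hc, hcc⟩ := exists_phase_coef hε
    have hA1 := hA'.add ((IsCoef.fst.mul .fst).mul hA)
    have hA2 := hA.mul hc
    obtain ⟨C1, p1, h1⟩ := ih hA1
    obtain ⟨C2, p2, h2⟩ := ih hA2
    obtain ⟨C3, p3, h3⟩ := ih hA
    refine ⟨C1 + C2 + C3, by positivity, fun σ E M n h hσ hσ1 hE hh θ x hθ hx => ?_⟩
    have hh0 : PencilL1 σ h := hh 0 (Nat.zero_le _)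
    have hh1 : PencilL1 σ (conD h) := hh 1 (by omega)
    have hz := branch_mem_pencil hθ hx
    rw [Function.iterate_succ_apply, iterate_conD_eqOn l
      (conD_intOp_phaseKer hσ hσ1 hε hA hA' hd hc hcc hE n hh0 hh1) hz]
    have k0 := (isPencilKernel_phaseKer hσ hσ1 hε hA hE n).differentiableOn_intOp hσ hh1
    have k1 := (isPencilKernel_phaseKer hσ hσ1 hε hA1 hE n).differentiableOn_intOp hσ hh0
    have k2 := (isPencilKernel_phaseKer hσ hσ1 hε hA2 hE (n + 1)).differentiableOn_intOp hσ hh0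
    rw [iterate_conD_add hσ l (k1.fun_add k2) k0 hz]
    simp only
    rw [iterate_conD_add hσ l k1 k2 hz]
    set S := ∑ i ∈ Finset.range (l + 1 + 1), ∑ j ∈ Finset.range (l + 1 + 1),
      ∫⁻ r in Ioi (0 : ℝ), ENNReal.ofReal (M (n + i) r x) * ‖conD^[j] h (branch θ r)‖ₑ with hS
    let T : ℕ → ℕ → ℝ≥0∞ := fun i j =>
      ∫⁻ r in Ioi (0 : ℝ), ENNReal.ofReal (M (n + i) r x) * ‖conD^[j] h (branch θ r)‖ₑ
    have hsub : Finset.range (l + 1) ⊆ Finset.range (l + 1 + 1) :=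
      Finset.range_mono (Nat.le_succ _)
    -- The three terms of one conormal derivative: the coefficient is differentiated (indices
    -- unchanged), the phase function gains an Euler derivative (i shifts), or the derivative lands
    -- on the datum (j shifts).
    have b1 : ∑ i ∈ Finset.range (l + 1), ∑ j ∈ Finset.range (l + 1), T i j ≤ S :=
      (Finset.sum_le_sum fun i _ => Finset.sum_le_sum_of_subset hsub).trans
        (Finset.sum_le_sum_of_subset hsub)
    have b2 : ∑ i ∈ Finset.range (l + 1), ∑ j ∈ Finset.range (l + 1), T (i + 1) j ≤ S := by
      refine (Finset.sum_le_sum fun i _ => Finset.sum_le_sum_of_subset hsub).trans ?_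
      rw [hS, Finset.sum_range_succ' (n := l + 1)]
      exact le_self_add
    have b3 : ∑ i ∈ Finset.range (l + 1), ∑ j ∈ Finset.range (l + 1), T i (j + 1) ≤ S := by
      refine le_trans (Finset.sum_le_sum fun i _ => ?_) (Finset.sum_le_sum_of_subset hsub)
      rw [Finset.sum_range_succ' (n := l + 1)]
      exact le_self_add
    refine (enorm_add_le _ _).trans ((add_le_add_left (enorm_add_le _ _) _).trans ?_)
    rw [ENNReal.ofReal_add (by positivity) p3, ENNReal.ofReal_add p1 p2, add_mul, add_mul]
    refine add_le_add (add_le_add ?_ ?_) ?_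
    · refine (h1 σ E M n h hσ hσ1 hE (fun j hj => hh j (by omega)) θ x hθ hx).trans ?_
      gcongr
    · refine (h2 σ E M (n + 1) h hσ hσ1 hE (fun j hj => hh j (by omega)) θ x hθ hx).trans ?_
      gcongr
      refine le_trans (le_of_eq ?_) b2
      refine Finset.sum_congr rfl fun i _ => Finset.sum_congr rfl fun j _ => ?_
      simp only [T, show n + 1 + i = n + (i + 1) by omega]
    · refine (h3 σ E M n (conD h) hσ hσ1 hE (fun j hj => ?_) θ x hθ hx).trans ?_
      · rw [← Function.iterate_succ_apply]; exact hh (j + 1) (by omega)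
      gcongr
      refine le_trans (le_of_eq ?_) b3
      refine Finset.sum_congr rfl fun i _ => Finset.sum_congr rfl fun j _ => ?_
      simp only [T, Function.iterate_succ_apply]

/-- Conormal derivatives of the kernel with source at the boundary. -/
lemma exists_norm_iterate_conD_boundary_le (l : ℕ) : ∀ {A : ℂ → ℂ → ℂ}, IsCoef A →
    ∃ C : ℝ, 0 ≤ C ∧ ∀ (σ : ℝ) (E : ℂ → ℂ) (n : ℕ), 0 < σ → Differentiable ℂ E → ∀ z ∈ pencil σ,
      ‖conD^[l] (phaseKer 1 A E n 0) z‖ ≤ C * ∑ i ∈ Finset.range (l + 1), ‖eul^[n + i] E z‖ := by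
  induction l with
  | zero =>
    intro A hA
    obtain ⟨B, hB0, hB⟩ := hA.exists_bound
    refine ⟨B, hB0, fun σ E n hσ hE z hz => ?_⟩
    simp only [zero_add, Finset.range_one, Finset.sum_singleton, add_zero, Function.iterate_zero,
      id, phaseKer, one_mul, norm_mul]
    exact mul_le_mul_of_nonneg_right (hB _ _ (by simp [cone]) (pencil_re_pos hσ hz)) (norm_nonneg _)
  | succ l ih =>
    intro A hA
    obtain ⟨A', hA', hd⟩ := hA.exists_deriv
    obtain ⟨c, hc, hcc⟩ := exists_phase_coef (ε := 1) (Or.inl rfl)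
    obtain ⟨C1, p1, h1⟩ := ih hA'
    obtain ⟨C2, p2, h2⟩ := ih (hA.mul hc)
    refine ⟨C1 + C2, by positivity, fun σ E n hσ hE z hz => ?_⟩
    have key : ∀ z ∈ pencil σ, _ := fun z hz => exists_deriv_phaseKer (ε := 1) hE n
      (hd 0 z le_rfl (pencil_re_pos hσ hz)) (hcc 0 z le_rfl (pencil_re_pos hσ hz))
    have hdiff : ∀ {A : ℂ → ℂ → ℂ}, IsCoef A → ∀ m,
        DifferentiableOn ℂ (phaseKer 1 A E m 0) (pencil σ) := by
      intro A hA m z hz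
      obtain ⟨_, -, hd⟩ := hA.exists_deriv
      obtain ⟨a, b, -, h2, -⟩ := exists_deriv_phaseKer (ε := 1) hE m
        (hd 0 z le_rfl (pencil_re_pos hσ hz)) (hcc 0 z le_rfl (pencil_re_pos hσ hz))
      exact h2.differentiableAt.differentiableWithinAt
    have heq : EqOn (conD (phaseKer 1 A E n 0)) (fun z => phaseKer 1 A' E n 0 z +
        phaseKer 1 (fun y z => A y z * c y z) E (n + 1) 0 z) (pencil σ) := fun z hz => by
      obtain ⟨a, b, h1, h2, h3⟩ := key z hz
      simp only [conD, h2.deriv]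
      -- At y = 0 the y-part of the derivation disappears because ψ(0) = 0.
      rw [← h3]; simp [psi]
    rw [Function.iterate_succ_apply, iterate_conD_eqOn l heq hz,
      iterate_conD_add hσ l (hdiff hA' n) (hdiff (hA.mul hc) (n + 1)) hz, add_mul]
    refine (norm_add_le _ _).trans (add_le_add ?_ ?_)
    · refine (h1 σ E n hσ hE z hz).trans ?_
      refine mul_le_mul_of_nonneg_left ?_ p1
      rw [Finset.sum_range_succ (n := l + 1)]
      exact le_add_of_nonneg_right (norm_nonneg _)
    · refine (h2 σ E (n + 1) hσ hE z hz).trans ?_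
      refine mul_le_mul_of_nonneg_left ?_ p2
      rw [Finset.sum_range_succ' (n := l + 1)]
      refine le_trans (le_of_eq ?_) (le_add_of_nonneg_right (norm_nonneg _))
      refine Finset.sum_congr rfl fun i _ => ?_
      rw [show n + 1 + i = n + (i + 1) by omega]

end

noncomputable section

/-! ### Kernel bounds for the heat and residual kernels -/

/-- A point of the strip |Im ζ| ≤ 2 with |Re ζ| > 2/σ lies in the double cone, and the remaining
rectangle is compact. This handles phases of points on different branches, where only some finite
bound is needed. -/
lemma exists_bound_of_cone {F : ℂ → ℂ} (hF : Continuous F) {σ B₀ : ℝ} (hσ : 0 < σ) (S : Set ℂ)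
    (hS : ∀ ζ ∈ S, |ζ.im| ≤ 2) (hB : ∀ ζ ∈ S, |ζ.im| ≤ σ * |ζ.re| → ‖F ζ‖ ≤ B₀) :
    ∃ B : ℝ, ∀ ζ ∈ S, ‖F ζ‖ ≤ B := by
  have hK : IsCompact (Icc (-(2 / σ)) (2 / σ) ×ℂ Icc (-2) 2) := isCompact_Icc.reProdIm isCompact_Icc
  obtain ⟨B₁, hB₁⟩ := hK.exists_bound_of_continuousOn hF.continuousOn
  refine ⟨max B₀ B₁, fun ζ hζ => ?_⟩
  by_cases h : |ζ.re| ≤ 2 / σ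
  · refine (hB₁ ζ ?_).trans (le_max_right _ _)
    rw [Complex.mem_reProdIm]
    exact ⟨abs_le.1 h, abs_le.1 (hS ζ hζ)⟩
  · refine (hB ζ hζ ?_).trans (le_max_left _ _)
    rw [not_le, div_lt_iff₀ hσ] at h
    linarith [hS ζ hζ]

lemma pencil_im_lt {σ : ℝ} {z : ℂ} (hz : z ∈ pencil σ) : |z.im| < σ :=
  lt_of_lt_of_le hz (min_le_right _ _)

lemma abs_im_phase_le {σ : ℝ} (hσ1 : σ < 1) {ε : ℂ} (hε : ε = 1 ∨ ε = -1) {y z : ℂ}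
    (hy : y ∈ pencil σ) (hz : z ∈ pencil σ) : |(y + ε * z).im| ≤ 2 := by
  have h1 := (pencil_im_lt hy).trans hσ1
  have h2 := (pencil_im_lt hz).trans hσ1
  have h3 := abs_add_le y.im z.im
  have h4 := abs_sub y.im z.im
  rcases hε with rfl | rfl
  · simp; linarith
  · simp [← sub_eq_add_neg]; linarith

lemma abs_min_sub_le (r x : ℝ) : |min r 1 - min x 1| ≤ |r - x| := by
  simpa using abs_min_sub_min_le_max r 1 x 1

/-- Two points of the same branch differ by r − x + iθ(min(r,1) − min(x,1)), and min(·,1) is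
1-Lipschitz. This is why the contour is taken through z. -/
lemma branch_sub_cone {σ θ : ℝ} (hθ : |θ| ≤ σ) (r x : ℝ) :
    |(branch θ r + (-1) * branch θ x).im| ≤ σ * |(branch θ r + (-1) * branch θ x).re| := by
  have : (branch θ r + (-1) * branch θ x).im = θ * (min r 1 - min x 1) := by
    simp [branch]; ring
  rw [this, abs_mul]
  have h2 : (branch θ r + (-1) * branch θ x).re = r - x := by simp [branch]; ring
  rw [h2]
  exact mul_le_mul hθ (abs_min_sub_le r x) (abs_nonneg _) ((abs_nonneg _).trans hθ)

lemma branch_add_cone {σ θ : ℝ} (hθ : |θ| ≤ σ) {r x : ℝ} (hr : 0 ≤ r) (hx : 0 ≤ x) :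
    branch θ r + 1 * branch θ x ∈ cone σ := by
  show |(branch θ r + 1 * branch θ x).im| ≤ σ * (branch θ r + 1 * branch θ x).re
  have : (branch θ r + 1 * branch θ x).im = θ * (min r 1 + min x 1) := by
    simp [branch]; ring
  rw [this, abs_mul]
  have h2 : (branch θ r + 1 * branch θ x).re = r + x := by simp [branch]
  have h0 : 0 ≤ min r 1 + min x 1 :=
    add_nonneg (le_min hr zero_le_one) (le_min hx zero_le_one)
  rw [h2, abs_of_nonneg h0]
  exact mul_le_mul hθ (add_le_add (min_le_left _ _) (min_le_left _ _)) h0 ((abs_nonneg _).trans hθ)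

/-- The Gaussian majorant of the heat kernel. -/
def heatMaj (τ C c r x : ℝ) : ℝ := C * (√τ)⁻¹ * exp (-(c * ((r - x) ^ 2 / τ)))

/-- The majorant of the residual kernel. -/
def resMaj (τ μ C c r x : ℝ) : ℝ := C * μ * exp (-(c * (μ * (r + x) + (r + x) ^ 2 / τ)))

lemma exists_kernelBound_heatE {σ₀ : ℝ} (hσ₀ : 0 < σ₀) (hσ₀1 : σ₀ < 1) :
    ∃ C c : ℕ → ℝ, (∀ n, 0 < C n) ∧ (∀ n, 0 < c n) ∧ ∀ (ν t σ : ℝ) (α : ℤ) (ε : ℂ), 0 < ν → 0 < t →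
      0 < σ → σ ≤ σ₀ → (ε = 1 ∨ ε = -1) →
      KernelBound σ ε (heatE ν α t) fun n r x => heatMaj (ν * t) (C n) (c n) r x := by
  choose C c hC hc h using fun n => exists_norm_eul_heatE_le hσ₀ hσ₀1 n
  refine ⟨C, c, hC, hc, fun ν t σ α ε hν ht hσ hσσ hε => ⟨differentiable_heatE hν ht α, ?_, ?_⟩⟩
  · intro n
    obtain ⟨B, hB⟩ := exists_bound_of_cone
      (differentiable_iterate_eul n (differentiable_heatE hν ht α)).continuous
      (B₀ := C n * (√(ν * t))⁻¹) hσ₀ {ζ | |ζ.im| ≤ 2} (fun ζ hζ => hζ) (fun ζ _ hζ => by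
        refine (h n ν t α hν ht ζ hζ).trans (mul_le_of_le_one_right ?_ ?_)
        · have := hC n; positivity
        · rw [Real.exp_le_one_iff]
          have := hc n; have := mul_pos hν ht
          have : 0 ≤ c n * (ζ.re ^ 2 / (ν * t)) := by positivity
          linarith)
    exact ⟨B, fun y hy z hz => hB _ (abs_im_phase_le (hσσ.trans_lt hσ₀1) hε hy hz)⟩
  · intro n θ r x hθ hr hx
    have hτ := mul_pos hν ht
    have hθ' : |θ| ≤ σ₀ := hθ.le.trans hσσ
    rcases hε with rfl | rfl
    · have hcone := branch_add_cone hθ' hr hx.le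
      have h2 : (branch θ r + 1 * branch θ x).re = r + x := by simp [branch]
      refine (h n ν t α hν ht _ ?_).trans ?_
      · rw [abs_of_nonneg (cone_re_nonneg hσ₀ hcone)]; exact hcone
      -- The reflected kernel gets the same majorant as the direct one, because (r − x)² ≤ (r + x)²
      -- for r, x ≥ 0.
      · rw [h2, heatMaj]
        have := hC n; have := hc n
        gcongr ?_ * exp (-(?_ * (?_ / _)))
        nlinarith
    · have h2 : (branch θ r + (-1) * branch θ x).re = r - x := by simp [branch]; ring
      have := h n ν t α hν ht _ (branch_sub_cone hθ' r x)
      rwa [h2] at this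

lemma exists_kernelBound_resE {σ₀ : ℝ} (hσ₀ : 0 < σ₀) (hσ₀1 : σ₀ < 1) :
    ∃ C c : ℕ → ℝ, (∀ n, 0 < C n) ∧ (∀ n, 0 < c n) ∧ ∀ (ν t δ σ : ℝ) (α : ℤ), 0 < ν → 0 < t →
      0 < δ → ν * t ≤ δ ^ 2 → 0 < σ → σ ≤ σ₀ →
      KernelBound σ 1 (resE ν α t) fun n r x => resMaj (ν * t) (|(α : ℝ)| + δ⁻¹) (C n) (c n) r x := by
  choose C c hC hc h using fun n => exists_norm_eul_resE_le hσ₀ hσ₀1 n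
  refine ⟨C, c, hC, hc, fun ν t δ σ α hν ht hδ hτδ hσ hσσ => ⟨differentiable_resE hν ht α, ?_, ?_⟩⟩
  · intro n
    obtain ⟨B, hB⟩ := exists_bound_of_cone
      (differentiable_iterate_eul n (differentiable_resE hν ht α)).continuous
      (B₀ := C n * (|(α : ℝ)| + δ⁻¹)) hσ₀ {ζ | |ζ.im| ≤ 2 ∧ 0 ≤ ζ.re} (fun ζ hζ => hζ.1)
      (fun ζ hζ0 hζ => by
        have h0 : 0 ≤ ζ.re := hζ0.2
        rw [abs_of_nonneg h0] at hζ
        refine (h n ν t δ α hν ht hδ hτδ ζ hζ).trans (mul_le_of_le_one_right ?_ ?_)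
        · have := hC n; positivity
        · rw [Real.exp_le_one_iff]
          have := hc n; have := mul_pos hν ht
          have : 0 ≤ c n * ((|(α : ℝ)| + δ⁻¹) * ζ.re + ζ.re ^ 2 / (ν * t)) := by positivity
          linarith)
    refine ⟨B, fun y hy z hz => hB _ ⟨abs_im_phase_le (hσσ.trans_lt hσ₀1) (Or.inl rfl) hy hz, ?_⟩⟩
    have h1 := pencil_re_pos hσ hy
    have h2 := pencil_re_pos hσ hz
    simp; linarith
  · intro n θ r x hθ hr hx
    have hθ' : |θ| ≤ σ₀ := hθ.le.trans hσσ
    have h2 : (branch θ r + 1 * branch θ x).re = r + x := by simp [branch]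
    have := h n ν t δ α hν ht hδ hτδ _ (branch_add_cone hθ' hr hx.le)
    rwa [h2] at this

/-! ### Integrals of the majorants -/

lemma lintegral_gauss_le {τ c : ℝ} (hτ : 0 < τ) (hc : 0 < c) (x : ℝ) :
    ∫⁻ r in Ioi (0 : ℝ), ENNReal.ofReal ((√τ)⁻¹ * exp (-(c * ((r - x) ^ 2 / τ))))
      ≤ ENNReal.ofReal √(π / c) := by
  have he : ∀ r : ℝ, -(c * ((r - x) ^ 2 / τ)) = -(c / τ) * (r - x) ^ 2 := fun r => by ring
  simp only [he]
  have hi : IntegrableOn (fun r : ℝ => (√τ)⁻¹ * exp (-(c / τ) * (r - x) ^ 2)) (Ioi 0) :=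
    (((integrable_exp_neg_mul_sq (by positivity)).comp_sub_right x).const_mul _).integrableOn
  rw [← ofReal_integral_eq_lintegral_ofReal hi (Eventually.of_forall fun _ => by positivity),
    integral_const_mul]
  apply ENNReal.ofReal_le_ofReal
  calc _ ≤ (√τ)⁻¹ * √(π / (c / τ)) := by
        gcongr; exact integral_shift_gauss_le (by positivity)
    _ = √(π / c) := by
        rw [← Real.sqrt_inv, ← Real.sqrt_mul (by positivity)]
        congr 1; field_simp

/-- The bound does not depend on μ, which will be |α| + 1/δ: in L¹ the factor |α| of the residual
kernel costs no derivative. -/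
lemma lintegral_exp_le {μ c : ℝ} (hμ : 0 < μ) (hc : 0 < c) :
    ∫⁻ r in Ioi (0 : ℝ), ENNReal.ofReal (μ * exp (-(c * (μ * r)))) ≤ ENNReal.ofReal c⁻¹ := by
  have he : ∀ r : ℝ, -(c * (μ * r)) = -(c * μ) * r := fun r => by ring
  simp only [he]
  have hneg : -(c * μ) < 0 := by have := mul_pos hc hμ; linarith
  have hi : IntegrableOn (fun r : ℝ => μ * exp (-(c * μ) * r)) (Ioi 0) :=
    (integrableOn_exp_mul_Ioi hneg 0).const_mul _
  rw [← ofReal_integral_eq_lintegral_ofReal hi (Eventually.of_forall fun _ => by positivity),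
    integral_const_mul, integral_exp_mul_Ioi hneg]
  apply ENNReal.ofReal_le_ofReal
  simp
  field_simp
  exact le_rfl

/-! ### The boundary layer weights -/

lemma layer_re (P δ : ℝ) (z : ℂ) : layer P δ z = δ⁻¹ * (1 / (1 + |δ⁻¹ * z.re| ^ P)) := by
  simp [layer, phiP]

lemma layer_ofReal_re (P δ : ℝ) (z : ℂ) : layer P δ (z.re : ℂ) = layer P δ z := by
  rw [layer_re, layer_re, Complex.ofReal_re]

lemma layer_nonneg (P : ℝ) {δ : ℝ} (hδ : 0 ≤ δ) (z : ℂ) : 0 ≤ layer P δ z := by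
  rw [layer_re]; positivity

lemma layer_le_inv (P : ℝ) {δ : ℝ} (hδ : 0 ≤ δ) (z : ℂ) : layer P δ z ≤ δ⁻¹ := by
  rw [layer_re]
  refine mul_le_of_le_one_right (by positivity) ?_
  have : 0 ≤ |δ⁻¹ * z.re| ^ P := by positivity
  rw [div_le_one (by linarith)]; linarith

lemma blWeight_re (P ν t : ℝ) (z : ℂ) : blWeight P ν t (z.re : ℂ) = blWeight P ν t z := by
  simp only [blWeight, layer_ofReal_re]

lemma one_le_blWeight (P ν t : ℝ) (z : ℂ) : 1 ≤ blWeight P ν t z := by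
  have h1 := layer_nonneg P (Real.sqrt_nonneg ν) z
  have h2 := layer_nonneg P (Real.sqrt_nonneg (ν * t)) z
  unfold blWeight
  split_ifs <;> linarith

lemma blWeight_of_pos (P ν : ℝ) {t : ℝ} (ht : 0 < t) (z : ℂ) :
    blWeight P ν t z = 1 + layer P √(ν * t) z + layer P √ν z := by
  simp [blWeight, ht.ne']

lemma blWeight_zero_le (P ν t : ℝ) (z : ℂ) : blWeight P ν 0 z ≤ blWeight P ν t z := by
  have h2 := layer_nonneg P (Real.sqrt_nonneg (ν * t)) z
  unfold blWeight
  split_ifs <;> simp_all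

/-- The amplitudes satisfy δ_s^{-1} = √(t/s) δ_t^{-1}, and the profile φ_P is smaller for the
thinner layer; the other two terms are common and √(t/s) ≥ 1. -/
lemma blWeight_le_of_lt {P ν s t : ℝ} (hP : 1 < P) (hν : 0 < ν) (hs : 0 < s) (hst : s < t) (z : ℂ) :
    blWeight P ν s z ≤ √(t / s) * blWeight P ν t z := by
  have ht := hs.trans hst
  have h1 : 1 ≤ √(t / s) := by rw [Real.one_le_sqrt, one_le_div hs]; exact hst.le
  rw [blWeight_of_pos P ν hs, blWeight_of_pos P ν ht]
  have h2 := layer_nonneg P (Real.sqrt_nonneg ν) z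
  have hδs : 0 < √(ν * s) := Real.sqrt_pos.2 (mul_pos hν hs)
  have hδ : √(ν * s) ≤ √(ν * t) := Real.sqrt_le_sqrt (by gcongr)
  have h3 : layer P √(ν * s) z ≤ √(t / s) * layer P √(ν * t) z := by
    rw [layer_re, layer_re, ← mul_assoc]
    have e : (√(ν * s))⁻¹ = √(t / s) * (√(ν * t))⁻¹ := by
      rw [← Real.sqrt_inv, ← Real.sqrt_inv, ← Real.sqrt_mul (by positivity)]
      congr 1; field_simp
    rw [← e]
    have hi := inv_anti₀ hδs hδ
    have habs : |(√(ν * t))⁻¹ * z.re| ≤ |(√(ν * s))⁻¹ * z.re| := by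
      rw [abs_mul, abs_mul, abs_of_nonneg (inv_nonneg.2 (Real.sqrt_nonneg (ν * t))),
        abs_of_nonneg (inv_nonneg.2 (Real.sqrt_nonneg (ν * s)))]
      exact mul_le_mul_of_nonneg_right hi (abs_nonneg _)
    gcongr
  nlinarith

/-! ### Exponentials and Gaussians against layers -/

lemma exists_rpow_mul_exp_le {P c : ℝ} (hP : 0 ≤ P) (hc : 0 < c) :
    ∃ K : ℝ, 0 < K ∧ ∀ u : ℝ, 0 ≤ u → (1 + u ^ P) * exp (-(c * u)) ≤ K := by
  obtain ⟨C, hC, h⟩ := pow_le_exp_mul hc ⌈P⌉₊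
  refine ⟨2 + C, by positivity, fun u hu => ?_⟩
  have h1 : u ^ P ≤ 1 + u ^ ⌈P⌉₊ := by
    rcases le_total u 1 with hu1 | hu1
    · have := Real.rpow_le_one hu hu1 hP
      have : 0 ≤ u ^ ⌈P⌉₊ := by positivity
      linarith
    · have := Real.rpow_le_rpow_of_exponent_le hu1 (Nat.le_ceil P)
      rw [Real.rpow_natCast] at this; linarith
  have h2 : exp (c * u) * exp (-(c * u)) = 1 := by rw [← Real.exp_add]; simp
  have h3 : exp (-(c * u)) ≤ 1 := by rw [Real.exp_le_one_iff]; nlinarith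
  calc _ ≤ (2 + C * exp (c * u)) * exp (-(c * u)) 
          := mul_le_mul_of_nonneg_right (by linarith [h u hu]) (exp_nonneg _)
    _ = 2 * exp (-(c * u)) + C * (exp (c * u) * exp (-(c * u))) := by ring
    _ ≤ 2 + C := by rw [h2]; linarith

lemma exists_rpow_mul_exp_sq_le {P c : ℝ} (hP : 0 ≤ P) (hc : 0 < c) :
    ∃ K : ℝ, 0 < K ∧ ∀ u : ℝ, 0 ≤ u → (1 + u ^ P) * exp (-(c * u ^ 2)) ≤ K := by
  obtain ⟨K, hK, h⟩ := exists_rpow_mul_exp_le hP hc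
  refine ⟨K * exp c, by positivity, fun u hu => ?_⟩
  have h1 : exp (-(c * u ^ 2)) ≤ exp (-(c * u)) * exp c := by
    rw [← Real.exp_add]; apply Real.exp_le_exp.2; nlinarith [sq_nonneg (u - 1 / 2)]
  calc _ ≤ (1 + u ^ P) * (exp (-(c * u)) * exp c) := by gcongr
    _ = (1 + u ^ P) * exp (-(c * u)) * exp c := by ring
    _ ≤ _ := by gcongr; exact h u hu

/-- `δ⁻¹ e^{-cx/δ}` is controlled by a layer. -/
lemma exists_exp_le_layer {P c : ℝ} (hP : 0 ≤ P) (hc : 0 < c) :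
    ∃ K : ℝ, 0 < K ∧ ∀ δ x : ℝ, 0 < δ → 0 ≤ x →
      δ⁻¹ * exp (-(c * (δ⁻¹ * x))) ≤ K * layer P δ x := by
  obtain ⟨K, hK, h⟩ := exists_rpow_mul_exp_le hP hc
  refine ⟨K, hK, fun δ x hδ hx => ?_⟩
  have hu : 0 ≤ δ⁻¹ * x := by positivity
  have := h _ hu
  rw [layer_re, Complex.ofReal_re, abs_of_nonneg hu, mul_left_comm K]
  refine mul_le_mul_of_nonneg_left ?_ (inv_nonneg.2 hδ.le)
  rw [mul_one_div, le_div_iff₀ (by positivity)]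
  linarith

/-- `δ⁻¹ e^{-cx²/δ²}` is controlled by a layer. -/
lemma exists_gauss_le_layer {P c : ℝ} (hP : 0 ≤ P) (hc : 0 < c) :
    ∃ K : ℝ, 0 < K ∧ ∀ δ x : ℝ, 0 < δ → 0 ≤ x →
      δ⁻¹ * exp (-(c * (x ^ 2 / δ ^ 2))) ≤ K * layer P δ x := by
  obtain ⟨K, hK, h⟩ := exists_rpow_mul_exp_sq_le hP hc
  refine ⟨K, hK, fun δ x hδ hx => ?_⟩
  have hu : 0 ≤ δ⁻¹ * x := by positivity
  have := h _ hu
  rw [layer_re, Complex.ofReal_re, abs_of_nonneg hu, mul_left_comm K]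
  refine mul_le_mul_of_nonneg_left ?_ (inv_nonneg.2 hδ.le)
  rw [mul_one_div, le_div_iff₀ (by positivity)]
  have e : x ^ 2 / δ ^ 2 = (δ⁻¹ * x) ^ 2 := by field_simp
  rw [e]; linarith

lemma one_add_rpow_add_le {P p u : ℝ} (hP : 0 ≤ P) (hp : 0 ≤ p) (hu : 0 ≤ u) :
    1 + (p + u) ^ P ≤ 2 ^ P * ((1 + p ^ P) * (1 + u ^ P)) := by
  have h2 : (1 : ℝ) ≤ 2 ^ P := Real.one_le_rpow (by norm_num) hP
  have hm : (p + u) ^ P ≤ 2 ^ P * (p ^ P + u ^ P) := by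
    have h1 : (p + u) ^ P ≤ (2 * max p u) ^ P := by
      apply Real.rpow_le_rpow (by positivity) _ hP
      linarith [le_max_left p u, le_max_right p u]
    rw [Real.mul_rpow (by norm_num) (le_max_of_le_left hp)] at h1
    refine h1.trans ?_
    gcongr
    have a : 0 ≤ p ^ P := by positivity
    have b : 0 ≤ u ^ P := by positivity
    rcases max_choice p u with e | e <;> rw [e] <;> linarith
  have a : 0 ≤ p ^ P * u ^ P := by positivity
  have : 0 ≤ 2 ^ P * (p ^ P * u ^ P) := by positivity
  nlinarith

/-- A Peetre-type inequality moves the layer from r to x at the price 1 + u^P with u = |r − x|/δ,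
and the Gaussian pays for it because its variance τ is at most mδ². -/
lemma exists_gauss_mul_layer_le {P c m : ℝ} (hP : 0 ≤ P) (hc : 0 < c) (hm : 0 < m) :
    ∃ K : ℝ, 0 < K ∧ ∀ δ τ r x : ℝ, 0 < δ → 0 < τ → τ ≤ m * δ ^ 2 → 0 < r → 0 < x →
      exp (-(c * ((r - x) ^ 2 / τ))) * layer P δ r ≤ K * layer P δ x := by
  obtain ⟨K, hK, h⟩ := exists_rpow_mul_exp_sq_le hP (c := c / m) (by positivity)
  refine ⟨2 ^ P * K, by positivity, fun δ τ r x hδ hτ hτm hr hx => ?_⟩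
  set u := δ⁻¹ * |r - x| with hu
  have hu0 : 0 ≤ u := by positivity
  have h1 : exp (-(c * ((r - x) ^ 2 / τ))) ≤ exp (-(c / m * u ^ 2)) := by
    apply Real.exp_le_exp.2
    have e : c / m * u ^ 2 = c * ((r - x) ^ 2 / (m * δ ^ 2)) := by
      rw [hu, mul_pow, sq_abs]; field_simp
    rw [e]
    have : (r - x) ^ 2 / (m * δ ^ 2) ≤ (r - x) ^ 2 / τ := by gcongr
    nlinarith
  have h2 := h u hu0
  have hxr : δ⁻¹ * x ≤ δ⁻¹ * r + u := by
    rw [hu, ← mul_add]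
    gcongr
    have := neg_abs_le (r - x); linarith
  have h3 : 1 + (δ⁻¹ * x) ^ P ≤ 2 ^ P * ((1 + (δ⁻¹ * r) ^ P) * (1 + u ^ P)) := by
    refine le_trans ?_ (one_add_rpow_add_le hP (by positivity) hu0)
    gcongr
  rw [layer_re, layer_re, Complex.ofReal_re, Complex.ofReal_re, abs_of_nonneg (by positivity),
    abs_of_nonneg (by positivity), mul_left_comm, mul_left_comm (2 ^ P * K)]
  refine mul_le_mul_of_nonneg_left ?_ (inv_nonneg.2 hδ.le)
  rw [mul_one_div, mul_one_div, div_le_div_iff₀ (by positivity) (by positivity)]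
  calc _ ≤ exp (-(c / m * u ^ 2)) * (2 ^ P * ((1 + (δ⁻¹ * r) ^ P) * (1 + u ^ P))) := by gcongr
    _ = 2 ^ P * ((1 + u ^ P) * exp (-(c / m * u ^ 2))) * (1 + (δ⁻¹ * r) ^ P) := by ring
    _ ≤ _ := by gcongr

lemma exists_gauss_mul_blWeight_le {P c T : ℝ} (hP : 1 < P) (hc : 0 < c) (hT : 0 < T) :
    ∃ K : ℝ, 0 < K ∧ ∀ ν t t' r x : ℝ, 0 < ν → 0 < t' → t' ≤ t → t ≤ T → 0 < r → 0 < x →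
      exp (-(c * ((r - x) ^ 2 / (ν * t')))) * blWeight P ν t r ≤ K * blWeight P ν t x := by
  -- m = 1 for the layer √(νt), since t' ≤ t; m = T for the layer √ν, since νt' ≤ Tν.
  obtain ⟨K₁, hK₁, h₁⟩ := exists_gauss_mul_layer_le (m := 1) (by linarith : 0 ≤ P) hc one_pos
  obtain ⟨K₂, hK₂, h₂⟩ := exists_gauss_mul_layer_le (m := T) (by linarith : 0 ≤ P) hc hT
  refine ⟨1 + K₁ + K₂, by positivity, fun ν t t' r x hν ht' htt hT hr hx => ?_⟩
  have ht := ht'.trans_le htt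
  have a1 := h₁ √(ν * t) (ν * t') r x (Real.sqrt_pos.2 (mul_pos hν ht)) (mul_pos hν ht')
    (by rw [Real.sq_sqrt (by positivity), one_mul]; gcongr) hr hx
  have a2 := h₂ √ν (ν * t') r x (Real.sqrt_pos.2 hν) (mul_pos hν ht')
    (by rw [Real.sq_sqrt hν.le]; nlinarith) hr hx
  have a0 : exp (-(c * ((r - x) ^ 2 / (ν * t')))) ≤ 1 := by
    rw [Real.exp_le_one_iff]
    have : 0 ≤ c * ((r - x) ^ 2 / (ν * t')) := by positivity
    linarith
  have b1 := layer_nonneg P (Real.sqrt_nonneg ν) x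
  have b2 := layer_nonneg P (Real.sqrt_nonneg (ν * t)) x
  rw [blWeight_of_pos P ν ht, blWeight_of_pos P ν ht, mul_add, mul_add, mul_one]
  have c1 := mul_nonneg hK₁.le b1
  have c2 := mul_nonneg hK₂.le b2
  nlinarith

/-- Completing the square, βu ≤ cu²/τ + β²τ/(4c). It pays for the weight e^{βx}, and is the reason
why the constants depend on upper bounds for ν and t. -/
lemma gauss_absorb {β c τ τ₀ u : ℝ} (hc : 0 < c) (hτ : 0 < τ) (hτ₀ : τ ≤ τ₀) :
    exp (-(c * (u ^ 2 / τ))) ≤ exp (β ^ 2 * τ₀ / (4 * c)) * exp (-(β * u)) := by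
  rw [← Real.exp_add]
  apply Real.exp_le_exp.2
  have h1 : β * u ≤ c * (u ^ 2 / τ) + β ^ 2 * τ / (4 * c) := by
    have : c * (u ^ 2 / τ) + β ^ 2 * τ / (4 * c) - β * u = (2 * c * u - β * τ) ^ 2 / (4 * c * τ) := by
      field_simp; ring
    have h2 : 0 ≤ (2 * c * u - β * τ) ^ 2 / (4 * c * τ) := by positivity
    linarith
  have h3 : β ^ 2 * τ / (4 * c) ≤ β ^ 2 * τ₀ / (4 * c) := by gcongr
  linarith

/-- The Gaussian majorant acts boundedly on the boundary layer weights. -/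
lemma exists_heatMaj_mul_weight_le {β P T ν₀ c : ℝ} (hP : 1 < P) (hT : 0 < T)
    (hc : 0 < c) : ∃ K : ℝ, 0 < K ∧ ∀ C ν t t' r x : ℝ, 0 ≤ C → 0 < ν → ν ≤ ν₀ → 0 < t' → t' ≤ t →
      t ≤ T → 0 < r → 0 < x → heatMaj (ν * t') C c r x * (exp (-(β * r)) * blWeight P ν t r) ≤
        C * K * (exp (-(β * x)) * blWeight P ν t x) *
          ((√(ν * t'))⁻¹ * exp (-(c / 4 * ((r - x) ^ 2 / (ν * t'))))) := by
  obtain ⟨K, hK, h⟩ := exists_gauss_mul_blWeight_le hP (c := c / 4) (by positivity) hT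
  refine ⟨exp (β ^ 2 * (ν₀ * T) / (4 * (c / 2))) * K, by positivity,
    fun C ν t t' r x hC hν hνν ht' htt htT hr hx => ?_⟩
  have hτ := mul_pos hν ht'
  have hτ₀ : ν * t' ≤ ν₀ * T := mul_le_mul hνν (htt.trans htT) ht'.le (hν.le.trans hνν)
  have h1 := h ν t t' r x hν ht' htt htT hr hx
  have h2 := gauss_absorb (β := β) (u := x - r) (c := c / 2) (by positivity) hτ hτ₀
  rw [show (x - r) ^ 2 = (r - x) ^ 2 by ring] at h2
  have hW := zero_le_one.trans (one_le_blWeight P ν t r)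
  -- Half of the Gaussian pays for the exponential weight, a quarter moves the layers, and a quarter
  -- is kept for the integration in r.
  have hsplit : exp (-(c * ((r - x) ^ 2 / (ν * t')))) = exp (-(c / 2 * ((r - x) ^ 2 / (ν * t')))) *
      exp (-(c / 4 * ((r - x) ^ 2 / (ν * t')))) * exp (-(c / 4 * ((r - x) ^ 2 / (ν * t')))) := by
    rw [← Real.exp_add, ← Real.exp_add]; congr 1; ring
  have he : exp (-(β * (x - r))) * exp (-(β * r)) = exp (-(β * x)) := by
    rw [← Real.exp_add]; congr 1; ring
  rw [heatMaj, hsplit]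
  set G := exp (-(c / 4 * ((r - x) ^ 2 / (ν * t'))))
  set D := exp (β ^ 2 * (ν₀ * T) / (4 * (c / 2)))
  calc _ = C * (√(ν * t'))⁻¹ * G * (exp (-(c / 2 * ((r - x) ^ 2 / (ν * t')))) * exp (-(β * r))) *
        (G * blWeight P ν t r) := by ring
    _ ≤ C * (√(ν * t'))⁻¹ * G * (D * exp (-(β * (x - r))) * exp (-(β * r))) *
        (K * blWeight P ν t x) := by gcongr
    _ = C * (√(ν * t'))⁻¹ * G * (D * (exp (-(β * (x - r))) * exp (-(β * r)))) *
        (K * blWeight P ν t x) := by ring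
    _ = _ := by rw [he]; ring

/-- The residual majorant acts boundedly on the boundary layer weights. -/
lemma exists_resMaj_mul_weight_le {β P T ν₀ c : ℝ} (hβ : 0 < β) (hP : 1 < P) (hT : 0 < T)
    (hc : 0 < c) : ∃ K : ℝ, 0 < K ∧ ∀ C a ν t t' r x : ℝ, 0 ≤ C → 0 ≤ a → 0 < ν → ν ≤ ν₀ → 0 < t' →
      t' ≤ t → t ≤ T → 0 < r → 0 < x →
      resMaj (ν * t') (a + (√(ν * t))⁻¹) C c r x * (exp (-(β * r)) * blWeight P ν t r) ≤
        C * K * (exp (-(β * x)) * blWeight P ν t x) *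
          ((a + (√(ν * t))⁻¹) * exp (-(c * ((a + (√(ν * t))⁻¹) * r)))) := by
  obtain ⟨K, hK, h⟩ := exists_exp_le_layer (by linarith : 0 ≤ P) hc
  refine ⟨exp (β ^ 2 * (ν₀ * T) / (4 * c)) * (1 + (1 + √T) * K), by positivity,
    fun C a ν t t' r x hC ha hν hνν ht' htt htT hr hx => ?_⟩
  have ht := ht'.trans_le htt
  have hτ := mul_pos hν ht'
  have hτ₀ : ν * t' ≤ ν₀ * T := mul_le_mul hνν (htt.trans htT) ht'.le (hν.le.trans hνν)
  set δ := √(ν * t) with hδd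
  have hδ : 0 < δ := Real.sqrt_pos.2 (mul_pos hν ht)
  have h2 := gauss_absorb (β := β) (u := r + x) hc hτ hτ₀
  have h3 := h δ x hδ hx.le
  have hδν : (√ν)⁻¹ ≤ √T * δ⁻¹ := by
    have : δ ≤ √T * √ν := by
      rw [hδd, ← Real.sqrt_mul hT.le]; apply Real.sqrt_le_sqrt; nlinarith
    have hs := Real.sqrt_pos.2 hν
    rw [inv_eq_one_div, inv_eq_one_div, mul_one_div, div_le_div_iff₀ hs hδ]; linarith
  -- The weight at r is simply replaced by its supremum; the factor e^{−cx/δ} of the majorant then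
  -- turns 1/δ into a layer at x.
  have hWr : blWeight P ν t r ≤ 1 + (1 + √T) * δ⁻¹ := by
    rw [blWeight_of_pos P ν ht]
    have b1 := layer_le_inv P (Real.sqrt_nonneg ν) (r : ℂ)
    have b2 := layer_le_inv P hδ.le (r : ℂ)
    linarith
  have hWx : exp (-(c * (δ⁻¹ * x))) * blWeight P ν t r ≤ (1 + (1 + √T) * K) * blWeight P ν t x := by
    have e1 : exp (-(c * (δ⁻¹ * x))) ≤ 1 := by
      rw [Real.exp_le_one_iff]
      have : 0 ≤ c * (δ⁻¹ * x) := by positivity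
      linarith
    have b1 := layer_nonneg P (Real.sqrt_nonneg ν) (x : ℂ)
    have b2 := layer_nonneg P hδ.le (x : ℂ)
    have b3 : layer P δ (x : ℂ) ≤ blWeight P ν t x := by
      rw [blWeight_of_pos P ν ht]; linarith
    calc _ ≤ exp (-(c * (δ⁻¹ * x))) * (1 + (1 + √T) * δ⁻¹) := by gcongr
      _ = exp (-(c * (δ⁻¹ * x))) + (1 + √T) * (δ⁻¹ * exp (-(c * (δ⁻¹ * x)))) := by ring
      _ ≤ blWeight P ν t x + (1 + √T) * (K * blWeight P ν t x) := by
          have := one_le_blWeight P ν t x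
          have h4 : δ⁻¹ * exp (-(c * (δ⁻¹ * x))) ≤ K * blWeight P ν t x :=
            h3.trans (by gcongr)
          gcongr
          linarith
      _ = _ := by ring
  set μ := a + δ⁻¹ with hμ
  -- The four factors pay for e^{βx}, are discarded (≤ 1), rebuild the layer at x, and give
  -- convergence in r.
  have hsplit : exp (-(c * (μ * (r + x) + (r + x) ^ 2 / (ν * t')))) =
      exp (-(c * ((r + x) ^ 2 / (ν * t')))) * exp (-(c * (a * x))) * exp (-(c * (δ⁻¹ * x))) *
        exp (-(c * (μ * r))) := by
    rw [← Real.exp_add, ← Real.exp_add, ← Real.exp_add, hμ]; congr 1; ring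
  have hax : exp (-(c * (a * x))) ≤ 1 := by
    rw [Real.exp_le_one_iff]
    have : 0 ≤ c * (a * x) := by positivity
    linarith
  have hbr : exp (-(β * (r + x))) * exp (-(β * r)) ≤ exp (-(β * x)) := by
    rw [← Real.exp_add]; apply Real.exp_le_exp.2; nlinarith
  have hW := zero_le_one.trans (one_le_blWeight P ν t r)
  have hμ0 : 0 ≤ μ := by positivity
  rw [resMaj, hsplit]
  set D := exp (β ^ 2 * (ν₀ * T) / (4 * c))
  calc _ = C * μ * exp (-(c * (μ * r))) * exp (-(c * (a * x))) *
        (exp (-(c * ((r + x) ^ 2 / (ν * t')))) * exp (-(β * r))) *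
        (exp (-(c * (δ⁻¹ * x))) * blWeight P ν t r) := by ring
    _ ≤ C * μ * exp (-(c * (μ * r))) * 1 * (D * exp (-(β * (r + x))) * exp (-(β * r))) *
        ((1 + (1 + √T) * K) * blWeight P ν t x) := by gcongr
    _ = C * μ * exp (-(c * (μ * r))) * (D * (exp (-(β * (r + x))) * exp (-(β * r)))) *
        ((1 + (1 + √T) * K) * blWeight P ν t x) := by ring
    _ ≤ C * μ * exp (-(c * (μ * r))) * (D * exp (-(β * x))) *
        ((1 + (1 + √T) * K) * blWeight P ν t x) := by
          have := zero_le_one.trans (one_le_blWeight P ν t x)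
          gcongr
    _ = _ := by ring

end

noncomputable section

/-! ### Estimates in a single Fourier mode -/

lemma enorm_le_blModeNorm {β P ν t σ θ r : ℝ} (g : ℂ → ℂ) (hθ : |θ| < σ) (hr : 0 < r) :
    ‖g (branch θ r)‖ₑ ≤
      ENNReal.ofReal (exp (-(β * r)) * blWeight P ν t r) * blModeNorm β P ν t σ g := by
  have h1 : ENNReal.ofReal (‖g (branch θ r)‖ * exp (β * r) * (blWeight P ν t r)⁻¹) ≤
      blModeNorm β P ν t σ g := by
    have := le_iSup₂ (f := fun z (_ : z ∈ pencil σ) =>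
      ENNReal.ofReal (‖g z‖ * exp (β * z.re) * (blWeight P ν t z)⁻¹)) _ (branch_mem_pencil hθ hr)
    rwa [← blWeight_re] at this
  have hW := zero_lt_one.trans_le (one_le_blWeight P ν t r)
  refine le_trans (le_of_eq ?_) (mul_le_mul_right h1 _)
  rw [← ENNReal.ofReal_mul (by positivity), ← ofReal_norm]
  congr 1
  rw [Real.exp_neg]
  field_simp

lemma blModeNorm_le {β P ν t σ : ℝ} (hσ : 0 < σ) {g : ℂ → ℂ} {N : ℝ≥0∞}
    (h : ∀ θ x, |θ| < σ → 0 < x →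
      ‖g (branch θ x)‖ₑ ≤ ENNReal.ofReal (exp (-(β * x)) * blWeight P ν t x) * N) :
    blModeNorm β P ν t σ g ≤ N := by
  refine iSup₂_le fun z hz => ?_
  obtain ⟨θ, hθ, hze⟩ := exists_branch hσ hz
  have hx := pencil_re_pos hσ hz
  have hW := zero_lt_one.trans_le (one_le_blWeight P ν t z)
  have h1 := h θ z.re hθ hx
  rw [← hze, blWeight_re] at h1
  rw [mul_assoc, mul_comm, ENNReal.ofReal_mul (by positivity), ofReal_norm]
  refine (mul_le_mul_right h1 _).trans (le_of_eq ?_)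
  rw [← mul_assoc, ← ENNReal.ofReal_mul (by positivity)]
  have : exp (β * z.re) * (blWeight P ν t z)⁻¹ * (exp (-(β * z.re)) * blWeight P ν t z) = 1 := by
    rw [Real.exp_neg]; field_simp
  rw [this]; simp

lemma arcDensity_le {θ : ℝ} (h0 : 0 ≤ θ) (h1 : θ < 1) (r : ℝ) : arcDensity θ r ≤ 2 := by
  unfold arcDensity
  split_ifs
  · rw [Real.sqrt_le_iff]; constructor <;> nlinarith
  · norm_num

/-- The 4 counts two branches, with arc length density at most 2. -/
lemma l1ModeNorm_le {σ : ℝ} (hσ1 : σ < 1) {g : ℂ → ℂ} (hg : ContinuousOn g (pencil σ)) {N : ℝ≥0∞}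
    (h : ∀ θ, |θ| < σ → ∫⁻ x in Ioi (0 : ℝ), ‖g (branch θ x)‖ₑ ≤ N) : l1ModeNorm σ g ≤ 4 * N := by
  refine iSup₂_le fun θ hθ => ?_
  have hθ1 : |θ| < σ := by rw [abs_of_nonneg hθ.1]; exact hθ.2
  have hθ2 : |-θ| < σ := by rwa [abs_neg]
  calc _ ≤ ∫⁻ r in Ioi (0 : ℝ), 2 * (‖g (branch θ r)‖ₑ + ‖g (branch (-θ) r)‖ₑ) := by
        refine lintegral_mono fun r => ?_
        rw [mul_comm, ENNReal.ofReal_mul (zero_le_one.trans (one_le_arcDensity θ r)),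
          ENNReal.ofReal_add (norm_nonneg _) (norm_nonneg _), ofReal_norm, ofReal_norm]
        gcongr
        exact (ENNReal.ofReal_le_ofReal (arcDensity_le hθ.1 (hθ.2.trans hσ1) r)).trans (by simp)
    _ = 2 * ((∫⁻ r in Ioi (0 : ℝ), ‖g (branch θ r)‖ₑ) + ∫⁻ r in Ioi (0 : ℝ), ‖g (branch (-θ) r)‖ₑ) := by
        rw [lintegral_const_mul' _ _ (by norm_num), lintegral_add_left']
        exact ((continuousOn_comp_branch hg hθ1).aestronglyMeasurable measurableSet_Ioi).enorm
    _ ≤ 2 * (N + N) := by gcongr; exacts [h θ hθ1, h (-θ) hθ2]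
    _ = 4 * N := by ring

/-- Schur's test for a weighted sup norm: the majorant moves the weight from r to x and leaves an
integrable kernel J behind. -/
lemma lintegral_maj_le_blModeNorm {β P ν t σ θ x K I : ℝ} {m J : ℝ → ℝ} (hK : 0 ≤ K)
    (hθ : |θ| < σ) (hm0 : ∀ r, 0 < r → 0 ≤ m r) (hJm : Measurable J)
    (hm : ∀ r, 0 < r → m r * (exp (-(β * r)) * blWeight P ν t r) ≤
      K * (exp (-(β * x)) * blWeight P ν t x) * J r)
    (hJ : ∫⁻ r in Ioi (0 : ℝ), ENNReal.ofReal (J r) ≤ ENNReal.ofReal I) (g : ℂ → ℂ) :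
    ∫⁻ r in Ioi (0 : ℝ), ENNReal.ofReal (m r) * ‖g (branch θ r)‖ₑ ≤
      ENNReal.ofReal (exp (-(β * x)) * blWeight P ν t x) *
        (ENNReal.ofReal (K * I) * blModeNorm β P ν t σ g) := by
  set N := blModeNorm β P ν t σ g
  set w := exp (-(β * x)) * blWeight P ν t x
  have hw : 0 ≤ w := mul_nonneg (exp_nonneg _) (zero_le_one.trans (one_le_blWeight P ν t x))
  have h1 : ∀ r ∈ Ioi (0 : ℝ), ENNReal.ofReal (m r) * ‖g (branch θ r)‖ₑ ≤
      ENNReal.ofReal (K * w) * N * ENNReal.ofReal (J r) := by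
    intro r hr
    calc _ ≤ ENNReal.ofReal (m r) * (ENNReal.ofReal (exp (-(β * r)) * blWeight P ν t r) * N) := by
          gcongr; exact enorm_le_blModeNorm g hθ hr
      _ = ENNReal.ofReal (m r * (exp (-(β * r)) * blWeight P ν t r)) * N := by
          rw [← mul_assoc, ← ENNReal.ofReal_mul (hm0 r hr)]
      _ ≤ ENNReal.ofReal (K * w * J r) * N :=
          mul_le_mul_left (ENNReal.ofReal_le_ofReal (hm r hr)) _
      _ = _ := by rw [ENNReal.ofReal_mul (by positivity)]; ring
  calc _ ≤ ∫⁻ r in Ioi (0 : ℝ), ENNReal.ofReal (K * w) * N * ENNReal.ofReal (J r) :=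
        setLIntegral_mono' measurableSet_Ioi h1
    _ = ENNReal.ofReal (K * w) * N * ∫⁻ r in Ioi (0 : ℝ), ENNReal.ofReal (J r) :=
        lintegral_const_mul _ hJm.ennreal_ofReal
    _ ≤ ENNReal.ofReal (K * w) * N * ENNReal.ofReal I := by gcongr
    _ = _ := by rw [ENNReal.ofReal_mul hK, ENNReal.ofReal_mul hK]; ring

lemma aemeasurable_maj_mul_branch {σ θ : ℝ} (hθ : |θ| < σ) {M : ℝ → ℝ → ℝ}
    (hM : Measurable (Function.uncurry M)) {g : ℂ → ℂ} (hg : ContinuousOn g (pencil σ)) :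
    AEMeasurable (fun p : ℝ × ℝ => ENNReal.ofReal (M p.2 p.1) * ‖g (branch θ p.2)‖ₑ)
      ((volume.restrict (Ioi 0)).prod (volume.restrict (Ioi 0))) := by
  have h1 : AEMeasurable (fun p : ℝ × ℝ => ENNReal.ofReal (M p.2 p.1))
      ((volume.restrict (Ioi 0)).prod (volume.restrict (Ioi 0))) :=
    (hM.comp measurable_swap).ennreal_ofReal.aemeasurable
  have h2 : AEMeasurable (fun p : ℝ × ℝ => ‖g (branch θ p.2)‖ₑ)
      ((volume.restrict (Ioi 0)).prod (volume.restrict (Ioi 0))) :=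
    (((continuousOn_comp_branch hg hθ).aestronglyMeasurable
      measurableSet_Ioi).enorm).comp_quasiMeasurePreserving Measure.quasiMeasurePreserving_snd
  exact h1.mul h2

/-- Schur's test in L¹: by Tonelli only the mass of the majorant in the target variable x matters.
-/
lemma lintegral_maj_le_l1ModeNorm {σ θ K : ℝ} (hθ : |θ| < σ) {M : ℝ → ℝ → ℝ}
    (hM : Measurable (Function.uncurry M))
    (hMi : ∀ r, 0 < r → ∫⁻ x in Ioi (0 : ℝ), ENNReal.ofReal (M r x) ≤ ENNReal.ofReal K)
    {g : ℂ → ℂ} (hg : ContinuousOn g (pencil σ)) :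
    ∫⁻ x in Ioi (0 : ℝ), ∫⁻ r in Ioi (0 : ℝ), ENNReal.ofReal (M r x) * ‖g (branch θ r)‖ₑ ≤
      ENNReal.ofReal K * l1ModeNorm σ g := by
  rw [lintegral_lintegral_swap (aemeasurable_maj_mul_branch hθ hM hg)]
  calc _ ≤ ∫⁻ r in Ioi (0 : ℝ), ENNReal.ofReal K * ‖g (branch θ r)‖ₑ := by
        refine setLIntegral_mono' measurableSet_Ioi fun r hr => ?_
        rw [lintegral_mul_const _ (by
          exact (hM.comp measurable_prodMk_left).ennreal_ofReal)]
        gcongr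
        exact hMi r hr
    _ = ENNReal.ofReal K * ∫⁻ r in Ioi (0 : ℝ), ‖g (branch θ r)‖ₑ :=
        lintegral_const_mul' _ _ ENNReal.ofReal_ne_top
    _ ≤ _ := by gcongr; exact lintegral_branch_le g hθ

/-- Weighted sup bounds for the conormal derivatives of a phase operator. -/
lemma exists_enorm_phase_le_blModeNorm {ε : ℂ} (hε : ε = 1 ∨ ε = -1) (l : ℕ) (K : ℕ → ℝ)
    (hK : ∀ i, 0 ≤ K i) : ∃ C : ℝ, 0 ≤ C ∧ ∀ (β P ν t σ : ℝ) (E : ℂ → ℂ) (M : ℕ → ℝ → ℝ → ℝ)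
      (h : ℂ → ℂ), 0 < σ → σ < 1 → KernelBound σ ε E M → (∀ j ≤ l, PencilL1 σ (conD^[j] h)) →
      (∀ (i : ℕ) (θ x : ℝ) (g : ℂ → ℂ), |θ| < σ → 0 < x →
        ∫⁻ r in Ioi (0 : ℝ), ENNReal.ofReal (M i r x) * ‖g (branch θ r)‖ₑ ≤
          ENNReal.ofReal (exp (-(β * x)) * blWeight P ν t x) *
            (ENNReal.ofReal (K i) * blModeNorm β P ν t σ g)) → ∀ θ x, |θ| < σ → 0 < x →
      ‖conD^[l] (intOp (phaseKer ε (fun _ _ => 1) E 0) h) (branch θ x)‖ₑ ≤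
        ENNReal.ofReal (exp (-(β * x)) * blWeight P ν t x) *
          (ENNReal.ofReal C * ∑ j ∈ Finset.range (l + 1), blModeNorm β P ν t σ (conD^[j] h)) := by
  obtain ⟨C, hC, hb⟩ := exists_enorm_iterate_conD_intOp_le hε l (IsCoef.const 1)
  refine ⟨C * ∑ i ∈ Finset.range (l + 1), K i,
    mul_nonneg hC (Finset.sum_nonneg fun i _ => hK i),
    fun β P ν t σ E M h hσ hσ1 hE hh hM θ x hθ hx => ?_⟩
  refine (hb σ E M 0 h hσ hσ1 hE hh θ x hθ hx).trans ?_
  rw [ENNReal.ofReal_mul hC, ENNReal.ofReal_sum_of_nonneg (fun i _ => hK i)]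
  refine le_trans (mul_le_mul_right (Finset.sum_le_sum fun i _ => Finset.sum_le_sum fun j _ =>
    hM (0 + i) θ x (conD^[j] h) hθ hx) _) (le_of_eq ?_)
  simp only [zero_add, ← Finset.mul_sum, ← Finset.sum_mul]
  ring

/-- `L¹` bounds for the conormal derivatives of a phase operator. -/
lemma exists_lintegral_phase_le_l1ModeNorm {ε : ℂ} (hε : ε = 1 ∨ ε = -1) (l : ℕ) (K : ℕ → ℝ)
    (hK : ∀ i, 0 ≤ K i) : ∃ C : ℝ, 0 ≤ C ∧ ∀ (σ : ℝ) (E : ℂ → ℂ) (M : ℕ → ℝ → ℝ → ℝ)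
      (h : ℂ → ℂ), 0 < σ → σ < 1 → KernelBound σ ε E M → (∀ j ≤ l, PencilL1 σ (conD^[j] h)) →
      (∀ i, Measurable (Function.uncurry (M i))) →
      (∀ i r, 0 < r → ∫⁻ x in Ioi (0 : ℝ), ENNReal.ofReal (M i r x) ≤ ENNReal.ofReal (K i)) →
      ∀ θ, |θ| < σ →
      ∫⁻ x in Ioi (0 : ℝ), ‖conD^[l] (intOp (phaseKer ε (fun _ _ => 1) E 0) h) (branch θ x)‖ₑ ≤
        ENNReal.ofReal C * ∑ j ∈ Finset.range (l + 1), l1ModeNorm σ (conD^[j] h) := by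
  obtain ⟨C, hC, hb⟩ := exists_enorm_iterate_conD_intOp_le hε l (IsCoef.const 1)
  refine ⟨C * ∑ i ∈ Finset.range (l + 1), K i,
    mul_nonneg hC (Finset.sum_nonneg fun i _ => hK i),
    fun σ E M h hσ hσ1 hE hh hMm hM θ hθ => ?_⟩
  have hg : ∀ j ∈ Finset.range (l + 1), ContinuousOn (conD^[j] h) (pencil σ) := fun j hj =>
    (hh j (Nat.lt_succ_iff.1 (Finset.mem_range.1 hj))).holo.continuousOn
  have hae : ∀ i, ∀ j ∈ Finset.range (l + 1), AEMeasurable (fun x => ∫⁻ r in Ioi (0 : ℝ),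
      ENNReal.ofReal (M (0 + i) r x) * ‖conD^[j] h (branch θ r)‖ₑ) (volume.restrict (Ioi 0)) :=
    fun i j hj => (aemeasurable_maj_mul_branch hθ (hMm _) (hg j hj)).lintegral_prod_right'
  refine (setLIntegral_mono' measurableSet_Ioi fun x hx =>
    hb σ E M 0 h hσ hσ1 hE hh θ x hθ hx).trans ?_
  rw [lintegral_const_mul' _ _ ENNReal.ofReal_ne_top, ENNReal.ofReal_mul hC,
    ENNReal.ofReal_sum_of_nonneg (fun i _ => hK i), lintegral_finsetSum' _ (fun i _ =>
      Finset.aemeasurable_fun_sum _ fun j hj => hae i j hj), mul_assoc, Finset.sum_mul_sum]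
  refine mul_le_mul_right (Finset.sum_le_sum fun i _ => ?_) _
  rw [lintegral_finsetSum' _ fun j hj => hae i j hj]
  refine Finset.sum_le_sum fun j hj => ?_
  simp only [zero_add]
  exact lintegral_maj_le_l1ModeNorm hθ (hMm i) (hM i) (hg j hj)

end

noncomputable section

/-! ### The Stokes kernel in a single Fourier mode -/

lemma stokesGreen_eq_phaseKer (ν : ℝ) (α : ℤ) (t : ℝ) : stokesGreen ν α t = fun y z =>
    (phaseKer (-1) (fun _ _ => 1) (heatE ν α t) 0 y z +
      phaseKer 1 (fun _ _ => 1) (heatE ν α t) 0 y z) +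
      phaseKer 1 (fun _ _ => 1) (resE ν α t) 0 y z := by
  funext y z
  simp [stokesGreen_eq, phaseKer, sub_eq_add_neg]

lemma isPencilKernel_heat {ν t σ : ℝ} (hν : 0 < ν) (ht : 0 < t) (hσ : 0 < σ) (hσ1 : σ < 1) (α : ℤ)
    {ε : ℂ} (hε : ε = 1 ∨ ε = -1) :
    IsPencilKernel σ (phaseKer ε (fun _ _ => 1) (heatE ν α t) 0) := by
  obtain ⟨C, c, -, -, h⟩ := exists_kernelBound_heatE hσ hσ1
  exact isPencilKernel_phaseKer hσ hσ1 hε (IsCoef.const 1) (h ν t σ α ε hν ht hσ le_rfl hε) 0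

lemma isPencilKernel_res {ν t σ : ℝ} (hν : 0 < ν) (ht : 0 < t) (hσ : 0 < σ) (hσ1 : σ < 1) (α : ℤ) :
    IsPencilKernel σ (phaseKer 1 (fun _ _ => 1) (resE ν α t) 0) := by
  obtain ⟨C, c, -, -, h⟩ := exists_kernelBound_resE hσ hσ1
  have hτ := mul_pos hν ht
  exact isPencilKernel_phaseKer hσ hσ1 (Or.inl rfl) (IsCoef.const 1)
    (h ν t √(ν * t) σ α hν ht (Real.sqrt_pos.2 hτ) (Real.sq_sqrt hτ.le).ge hσ le_rfl) 0

lemma isPencilKernel_stokesGreen {ν t σ : ℝ} (hν : 0 < ν) (ht : 0 < t) (hσ : 0 < σ) (hσ1 : σ < 1)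
    (α : ℤ) : IsPencilKernel σ (stokesGreen ν α t) := by
  rw [stokesGreen_eq_phaseKer]
  exact ((isPencilKernel_heat hν ht hσ hσ1 α (Or.inr rfl)).add
    (isPencilKernel_heat hν ht hσ hσ1 α (Or.inl rfl))).add (isPencilKernel_res hν ht hσ hσ1 α)

lemma iterate_conD_intOp_stokesGreen {ν t σ : ℝ} (hν : 0 < ν) (ht : 0 < t) (hσ : 0 < σ)
    (hσ1 : σ < 1) (α : ℤ) (l : ℕ) {h : ℂ → ℂ} (hh : PencilL1 σ h) :
    EqOn (conD^[l] (intOp (stokesGreen ν α t) h)) (fun z =>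
      (conD^[l] (intOp (phaseKer (-1) (fun _ _ => 1) (heatE ν α t) 0) h) z +
      conD^[l] (intOp (phaseKer 1 (fun _ _ => 1) (heatE ν α t) 0) h) z) +
      conD^[l] (intOp (phaseKer 1 (fun _ _ => 1) (resE ν α t) 0) h) z) (pencil σ) := by
  have k1 := isPencilKernel_heat hν ht hσ hσ1 α (Or.inr rfl)
  have k2 := isPencilKernel_heat hν ht hσ hσ1 α (Or.inl rfl)
  have k3 := isPencilKernel_res hν ht hσ hσ1 α
  have d1 := k1.differentiableOn_intOp hσ hh
  have d2 := k2.differentiableOn_intOp hσ hh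
  have d3 := k3.differentiableOn_intOp hσ hh
  have e : EqOn (intOp (stokesGreen ν α t) h) (fun z =>
      (intOp (phaseKer (-1) (fun _ _ => 1) (heatE ν α t) 0) h z +
      intOp (phaseKer 1 (fun _ _ => 1) (heatE ν α t) 0) h z) +
      intOp (phaseKer 1 (fun _ _ => 1) (resE ν α t) 0) h z) (pencil σ) := fun z hz => by
    simp only [stokesGreen_eq_phaseKer]
    rw [intOp_add hσ (k1.add k2) k3 hh hz, intOp_add hσ k1 k2 hh hz]
  intro z hz
  rw [iterate_conD_eqOn l e hz, iterate_conD_add hσ l (d1.fun_add d2) d3 hz]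
  simp only
  rw [iterate_conD_add hσ l d1 d2 hz]

/-- The Stokes semigroup in the weighted sup norm of a single mode. -/
lemma exists_blModeNorm_stokes_le {β P T ν₀ σ₀ : ℝ} (hβ : 0 < β) (hP : 1 < P) (hT : 0 < T)
    (hσ₀ : 0 < σ₀) (hσ₀1 : σ₀ < 1) (l : ℕ) : ∃ C : ℝ, 0 ≤ C ∧ ∀ (ν σ t' t : ℝ) (α : ℤ) (h : ℂ → ℂ),
      0 < ν → ν ≤ ν₀ → 0 < σ → σ ≤ σ₀ → 0 < t' → t' ≤ t → t ≤ T →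
      (∀ j ≤ l, PencilL1 σ (conD^[j] h)) →
      blModeNorm β P ν t σ (conD^[l] (intOp (stokesGreen ν α t') h)) ≤
        ENNReal.ofReal C * ∑ j ∈ Finset.range (l + 1), blModeNorm β P ν t σ (conD^[j] h) := by
  obtain ⟨C₁, c₁, hC₁, hc₁, kb₁⟩ := exists_kernelBound_heatE hσ₀ hσ₀1
  obtain ⟨C₂, c₂, hC₂, hc₂, kb₂⟩ := exists_kernelBound_resE hσ₀ hσ₀1
  choose K₁ hK₁ hw₁ using fun i => exists_heatMaj_mul_weight_le (β := β) (ν₀ := ν₀) hP hT (hc₁ i)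
  choose K₂ hK₂ hw₂ using fun i => exists_resMaj_mul_weight_le (ν₀ := ν₀) hβ hP hT (hc₂ i)
  have p₁ : ∀ i, 0 ≤ C₁ i * K₁ i * √(π / (c₁ i / 4)) := fun i => by
    have := hC₁ i; have := hK₁ i; positivity
  have p₂ : ∀ i, 0 ≤ C₂ i * K₂ i * (c₂ i)⁻¹ := fun i => by
    have := hC₂ i; have := hK₂ i; have := hc₂ i; positivity
  obtain ⟨D₁, hD₁, hb₁⟩ := exists_enorm_phase_le_blModeNorm (Or.inr rfl) l _ p₁
  obtain ⟨D₂, hD₂, hb₂⟩ := exists_enorm_phase_le_blModeNorm (Or.inl rfl) l _ p₁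
  obtain ⟨D₃, hD₃, hb₃⟩ := exists_enorm_phase_le_blModeNorm (Or.inl rfl) l _ p₂
  refine ⟨D₁ + D₂ + D₃, by positivity, fun ν σ t' t α h hν hνν hσ hσσ ht' htt htT hh => ?_⟩
  have hσ1 := hσσ.trans_lt hσ₀1
  have ht := ht'.trans_le htt
  have hτ := mul_pos hν ht'
  have hδ : 0 < √(ν * t) := Real.sqrt_pos.2 (mul_pos hν ht)
  have m₁ : ∀ (i : ℕ) (θ x : ℝ) (g : ℂ → ℂ), |θ| < σ → 0 < x →
      ∫⁻ r in Ioi (0 : ℝ), ENNReal.ofReal (heatMaj (ν * t') (C₁ i) (c₁ i) r x) *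
        ‖g (branch θ r)‖ₑ ≤ ENNReal.ofReal (exp (-(β * x)) * blWeight P ν t x) *
          (ENNReal.ofReal (C₁ i * K₁ i * √(π / (c₁ i / 4))) * blModeNorm β P ν t σ g) :=
    fun i θ x g hθ hx => lintegral_maj_le_blModeNorm (mul_nonneg (hC₁ i).le (hK₁ i).le) hθ
      (fun r _ => by have := hC₁ i; unfold heatMaj; positivity) (by fun_prop)
      (fun r hr => hw₁ i _ ν t t' r x (hC₁ i).le hν hνν ht' htt htT hr hx)
      (lintegral_gauss_le hτ (by have := hc₁ i; positivity) x) g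
  have m₂ : ∀ (i : ℕ) (θ x : ℝ) (g : ℂ → ℂ), |θ| < σ → 0 < x →
      ∫⁻ r in Ioi (0 : ℝ), ENNReal.ofReal
        (resMaj (ν * t') (|(α : ℝ)| + (√(ν * t))⁻¹) (C₂ i) (c₂ i) r x) * ‖g (branch θ r)‖ₑ ≤
        ENNReal.ofReal (exp (-(β * x)) * blWeight P ν t x) *
          (ENNReal.ofReal (C₂ i * K₂ i * (c₂ i)⁻¹) * blModeNorm β P ν t σ g) :=
    fun i θ x g hθ hx => lintegral_maj_le_blModeNorm (mul_nonneg (hC₂ i).le (hK₂ i).le) hθ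
      (fun r _ => by have := hC₂ i; unfold resMaj; positivity) (by fun_prop)
      (fun r hr => hw₂ i _ _ ν t t' r x (hC₂ i).le (abs_nonneg _) hν hνν ht' htt htT hr hx)
      (lintegral_exp_le (by positivity) (hc₂ i)) g
  refine blModeNorm_le hσ fun θ x hθ hx => ?_
  rw [iterate_conD_intOp_stokesGreen hν ht' hσ hσ1 α l (h := h) (hh 0 (Nat.zero_le _))
    (branch_mem_pencil hθ hx)]
  have b₁ := hb₁ β P ν t σ _ _ h hσ hσ1 (kb₁ ν t' σ α (-1) hν ht' hσ hσσ (Or.inr rfl)) hh m₁ θ x hθ hx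
  have b₂ := hb₂ β P ν t σ _ _ h hσ hσ1 (kb₁ ν t' σ α 1 hν ht' hσ hσσ (Or.inl rfl)) hh m₁ θ x hθ hx
  -- The free parameter δ is taken at the time t of the weight, which is admissible since t' ≤ t;
  -- the residual kernel then decays on the scale of the layer to be reproduced.
  have b₃ := hb₃ β P ν t σ _ _ h hσ hσ1 (kb₂ ν t' √(ν * t) σ α hν ht' hδ
    (by rw [Real.sq_sqrt (by positivity)]; gcongr) hσ hσσ) hh m₂ θ x hθ hx
  rw [ENNReal.ofReal_add (by positivity) hD₃, ENNReal.ofReal_add hD₁ hD₂, add_mul, add_mul, mul_add,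
    mul_add]
  exact (enorm_add_le _ _).trans (add_le_add ((enorm_add_le _ _).trans (add_le_add b₁ b₂)) b₃)

lemma lintegral_heatMaj_le {τ C c : ℝ} (hτ : 0 < τ) (hC : 0 ≤ C) (hc : 0 < c) (r : ℝ) :
    ∫⁻ x in Ioi (0 : ℝ), ENNReal.ofReal (heatMaj τ C c r x) ≤ ENNReal.ofReal (C * √(π / c)) := by
  have e : ∀ x, ENNReal.ofReal (heatMaj τ C c r x) = ENNReal.ofReal C *
      ENNReal.ofReal ((√τ)⁻¹ * exp (-(c * ((x - r) ^ 2 / τ)))) := fun x => by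
    rw [← ENNReal.ofReal_mul hC, heatMaj, show (x - r) ^ 2 = (r - x) ^ 2 by ring, mul_assoc]
  simp only [e]
  rw [lintegral_const_mul' _ _ ENNReal.ofReal_ne_top, ENNReal.ofReal_mul hC]
  gcongr
  exact lintegral_gauss_le hτ hc r

lemma lintegral_resMaj_le {τ μ C c r : ℝ} (hτ : 0 < τ) (hμ : 0 < μ) (hC : 0 ≤ C) (hc : 0 < c)
    (hr : 0 ≤ r) :
    ∫⁻ x in Ioi (0 : ℝ), ENNReal.ofReal (resMaj τ μ C c r x) ≤ ENNReal.ofReal (C * c⁻¹) := by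
  have e : ∀ x ∈ Ioi (0 : ℝ), ENNReal.ofReal (resMaj τ μ C c r x) ≤ ENNReal.ofReal C *
      ENNReal.ofReal (μ * exp (-(c * (μ * x)))) := fun x hx => by
    rw [← ENNReal.ofReal_mul hC, resMaj, mul_assoc]
    have h1 : μ * x ≤ μ * (r + x) + (r + x) ^ 2 / τ := by
      have : 0 ≤ μ * r + (r + x) ^ 2 / τ := by positivity
      linarith
    gcongr
  refine (setLIntegral_mono' measurableSet_Ioi e).trans ?_
  rw [lintegral_const_mul' _ _ ENNReal.ofReal_ne_top, ENNReal.ofReal_mul hC]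
  gcongr
  exact lintegral_exp_le hμ hc

/-- The Stokes semigroup in the `L¹` norm of a single mode. -/
lemma exists_l1ModeNorm_stokes_le {σ₀ : ℝ} (hσ₀ : 0 < σ₀) (hσ₀1 : σ₀ < 1) (l : ℕ) :
    ∃ C : ℝ, 0 ≤ C ∧ ∀ (ν σ t : ℝ) (α : ℤ) (h : ℂ → ℂ), 0 < ν → 0 < σ → σ ≤ σ₀ → 0 < t →
      (∀ j ≤ l, PencilL1 σ (conD^[j] h)) →
      l1ModeNorm σ (conD^[l] (intOp (stokesGreen ν α t) h)) ≤
        ENNReal.ofReal C * ∑ j ∈ Finset.range (l + 1), l1ModeNorm σ (conD^[j] h) := by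
  obtain ⟨C₁, c₁, hC₁, hc₁, kb₁⟩ := exists_kernelBound_heatE hσ₀ hσ₀1
  obtain ⟨C₂, c₂, hC₂, hc₂, kb₂⟩ := exists_kernelBound_resE hσ₀ hσ₀1
  have p₁ : ∀ i, 0 ≤ C₁ i * √(π / c₁ i) := fun i => by have := hC₁ i; positivity
  have p₂ : ∀ i, 0 ≤ C₂ i * (c₂ i)⁻¹ := fun i => by have := hC₂ i; have := hc₂ i; positivity
  obtain ⟨D₁, hD₁, hb₁⟩ := exists_lintegral_phase_le_l1ModeNorm (Or.inr rfl) l _ p₁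
  obtain ⟨D₂, hD₂, hb₂⟩ := exists_lintegral_phase_le_l1ModeNorm (Or.inl rfl) l _ p₁
  obtain ⟨D₃, hD₃, hb₃⟩ := exists_lintegral_phase_le_l1ModeNorm (Or.inl rfl) l _ p₂
  refine ⟨4 * (D₁ + D₂ + D₃), by positivity, fun ν σ t α h hν hσ hσσ ht hh => ?_⟩
  have hσ1 := hσσ.trans_lt hσ₀1
  have hτ := mul_pos hν ht
  have hδ : 0 < √(ν * t) := Real.sqrt_pos.2 hτ
  have hh0 : PencilL1 σ h := hh 0 (Nat.zero_le _)
  have hd : ∀ {k}, IsPencilKernel σ k → ContinuousOn (conD^[l] (intOp k h)) (pencil σ) := fun hk =>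
    (iterate_conD_differentiableOn hσ l (hk.differentiableOn_intOp hσ hh0)).continuousOn
  have d₁ := hd (isPencilKernel_heat hν ht hσ hσ1 α (Or.inr rfl))
  have d₂ := hd (isPencilKernel_heat hν ht hσ hσ1 α (Or.inl rfl))
  have mm : ∀ {g : ℂ → ℂ} {θ : ℝ}, ContinuousOn g (pencil σ) → |θ| < σ →
      AEMeasurable (fun x => ‖g (branch θ x)‖ₑ) (volume.restrict (Ioi 0)) := fun hg hθ =>
    ((continuousOn_comp_branch hg hθ).aestronglyMeasurable measurableSet_Ioi).enorm
  rw [ENNReal.ofReal_mul (by norm_num), ENNReal.ofReal_ofNat, mul_assoc]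
  refine l1ModeNorm_le hσ1 (hd (isPencilKernel_stokesGreen hν ht hσ hσ1 α)) fun θ hθ => ?_
  have b₁ := hb₁ σ _ _ h hσ hσ1 (kb₁ ν t σ α (-1) hν ht hσ hσσ (Or.inr rfl)) hh
    (fun i => by unfold heatMaj Function.uncurry; fun_prop)
    (fun i r _ => lintegral_heatMaj_le hτ (hC₁ i).le (hc₁ i) r) θ hθ
  have b₂ := hb₂ σ _ _ h hσ hσ1 (kb₁ ν t σ α 1 hν ht hσ hσσ (Or.inl rfl)) hh
    (fun i => by unfold heatMaj Function.uncurry; fun_prop)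
    (fun i r _ => lintegral_heatMaj_le hτ (hC₁ i).le (hc₁ i) r) θ hθ
  have b₃ := hb₃ σ _ _ h hσ hσ1 (kb₂ ν t √(ν * t) σ α hν ht hδ (Real.sq_sqrt hτ.le).ge hσ hσσ) hh
    (fun i => by unfold resMaj Function.uncurry; fun_prop)
    (fun i r hr => lintegral_resMaj_le hτ (by positivity) (hC₂ i).le (hc₂ i) hr.le) θ hθ
  rw [ENNReal.ofReal_add (by positivity) hD₃, ENNReal.ofReal_add hD₁ hD₂, add_mul, add_mul]
  calc _ ≤ ∫⁻ x in Ioi (0 : ℝ),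
        ((‖conD^[l] (intOp (phaseKer (-1) (fun _ _ => 1) (heatE ν α t) 0) h) (branch θ x)‖ₑ +
        ‖conD^[l] (intOp (phaseKer 1 (fun _ _ => 1) (heatE ν α t) 0) h) (branch θ x)‖ₑ) +
        ‖conD^[l] (intOp (phaseKer 1 (fun _ _ => 1) (resE ν α t) 0) h) (branch θ x)‖ₑ) := by
        refine setLIntegral_mono' measurableSet_Ioi fun x hx => ?_
        rw [iterate_conD_intOp_stokesGreen hν ht hσ hσ1 α l hh0 (branch_mem_pencil hθ hx)]
        exact (enorm_add_le _ _).trans (add_le_add_left (enorm_add_le _ _) _)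
    _ ≤ _ := by
        rw [lintegral_add_left' ((mm d₁ hθ).fun_add (mm d₂ hθ)), lintegral_add_left' (mm d₁ hθ)]
        exact add_le_add (add_le_add b₁ b₂) b₃

end

noncomputable section

/-! ### The boundary operator in a single Fourier mode -/

lemma branch_at_zero (θ : ℝ) : branch θ 0 = 0 := by
  apply Complex.ext <;> simp [branch]

/-- For a source at y = 0 the two heat kernels coincide by evenness, hence the coefficient 2. -/
lemma stokesGreen_zero_eq (ν : ℝ) (α : ℤ) (t : ℝ) : stokesGreen ν α t 0 = fun z =>
    phaseKer 1 (fun _ _ => 2) (heatE ν α t) 0 0 z + phaseKer 1 (fun _ _ => 1) (resE ν α t) 0 0 z := by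
  funext z
  simp [stokesGreen_eq, phaseKer, heatE_even]
  ring

lemma exists_norm_iterate_conD_stokesGreen_zero_le (l : ℕ) : ∃ C : ℝ, 0 ≤ C ∧
    ∀ (ν t σ : ℝ) (α : ℤ) (M M' : ℕ → ℝ → ℝ → ℝ), 0 < σ → KernelBound σ 1 (heatE ν α t) M →
      KernelBound σ 1 (resE ν α t) M' → ∀ θ x, |θ| < σ → 0 < x →
      ‖conD^[l] (stokesGreen ν α t 0) (branch θ x)‖ ≤
        C * ∑ i ∈ Finset.range (l + 1), (M i 0 x + M' i 0 x) := by
  obtain ⟨C₁, hC₁, h₁⟩ := exists_norm_iterate_conD_boundary_le l (IsCoef.const 2)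
  obtain ⟨C₂, hC₂, h₂⟩ := exists_norm_iterate_conD_boundary_le l (IsCoef.const 1)
  refine ⟨C₁ + C₂, by positivity, fun ν t σ α M M' hσ hM hM' θ x hθ hx => ?_⟩
  have hz := branch_mem_pencil hθ hx
  have b : ∀ {E : ℂ → ℂ} {M}, KernelBound σ 1 E M → ∀ i, ‖eul^[i] E (branch θ x)‖ ≤ M i 0 x :=
    fun hM i => by simpa [branch_at_zero] using hM.le i θ 0 x hθ le_rfl hx
  have d : ∀ {E : ℂ → ℂ} (c : ℂ), Differentiable ℂ E →
      DifferentiableOn ℂ (phaseKer 1 (fun _ _ => c) E 0 0) (pencil σ) := fun {E} c hE => by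
    have e : phaseKer 1 (fun _ _ => c) E 0 0 = fun z => c * E z := by
      funext z; simp [phaseKer]
    rw [e]
    exact (hE.const_mul c).differentiableOn
  have e : ‖conD^[l] (stokesGreen ν α t 0) (branch θ x)‖ ≤
      C₁ * ∑ i ∈ Finset.range (l + 1), M i 0 x + C₂ * ∑ i ∈ Finset.range (l + 1), M' i 0 x := by
    rw [stokesGreen_zero_eq, iterate_conD_add hσ l (d 2 hM.entire) (d 1 hM'.entire) hz]
    refine (norm_add_le _ _).trans (add_le_add ?_ ?_)
    · refine (h₁ σ _ 0 hσ hM.entire _ hz).trans (mul_le_mul_of_nonneg_left ?_ hC₁)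
      simpa using Finset.sum_le_sum fun i _ => b hM i
    · refine (h₂ σ _ 0 hσ hM'.entire _ hz).trans (mul_le_mul_of_nonneg_left ?_ hC₂)
      simpa using Finset.sum_le_sum fun i _ => b hM' i
  have n : ∀ {E : ℂ → ℂ} {M}, KernelBound σ 1 E M → 0 ≤ ∑ i ∈ Finset.range (l + 1), M i 0 x :=
    fun hM => Finset.sum_nonneg fun i _ => (norm_nonneg _).trans (b hM i)
  rw [Finset.sum_add_distrib]
  nlinarith [n hM, n hM', mul_nonneg hC₁ (n hM'), mul_nonneg hC₂ (n hM)]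

lemma layer_le_blWeight (P ν : ℝ) {t : ℝ} (ht : 0 < t) (z : ℂ) :
    layer P √(ν * t) z ≤ blWeight P ν t z ∧ layer P √ν z ≤ blWeight P ν t z := by
  rw [blWeight_of_pos P ν ht]
  have h1 := layer_nonneg P (Real.sqrt_nonneg ν) z
  have h2 := layer_nonneg P (Real.sqrt_nonneg (ν * t)) z
  constructor <;> linarith

/-- The amplitude (νt')^{-1/2} is √(t/t') times the one of the layer at time t, while the Gaussian
of variance νt' lies below the wider one of variance νt. Half of the Gaussian pays for e^{βx}. -/
lemma exists_heatMaj_zero_le {β P T ν₀ c : ℝ} (hP : 1 < P) (hc : 0 < c) :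
    ∃ K : ℝ, 0 < K ∧ ∀ C ν t t' x : ℝ, 0 ≤ C → 0 < ν → ν ≤ ν₀ → 0 < t' → t' ≤ t → t ≤ T → 0 < x →
      heatMaj (ν * t') C c 0 x ≤ C * K * √(t / t') * (exp (-(β * x)) * blWeight P ν t x) := by
  obtain ⟨K, hK, h⟩ := exists_gauss_le_layer (by linarith : 0 ≤ P) (c := c / 2) (by positivity)
  refine ⟨exp (β ^ 2 * (ν₀ * T) / (4 * (c / 2))) * K, by positivity,
    fun C ν t t' x hC hν hνν ht' htt htT hx => ?_⟩
  have ht := ht'.trans_le htt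
  have hτ := mul_pos hν ht'
  have hτ₀ : ν * t' ≤ ν₀ * T := mul_le_mul hνν (htt.trans htT) ht'.le (hν.le.trans hνν)
  have h2 := gauss_absorb (β := β) (u := x) (c := c / 2) (by positivity) hτ hτ₀
  have h1 := h √(ν * t) x (Real.sqrt_pos.2 (mul_pos hν ht)) hx.le
  rw [Real.sq_sqrt (mul_pos hν ht).le] at h1
  have h3 := (layer_le_blWeight P ν ht (x : ℂ)).1
  have e : (√(ν * t'))⁻¹ = √(t / t') * (√(ν * t))⁻¹ := by
    rw [← Real.sqrt_inv, ← Real.sqrt_inv, ← Real.sqrt_mul (by positivity)]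
    congr 1; field_simp
  have hsplit : exp (-(c * (x ^ 2 / (ν * t')))) = exp (-(c / 2 * (x ^ 2 / (ν * t')))) *
      exp (-(c / 2 * (x ^ 2 / (ν * t')))) := by
    rw [← Real.exp_add]; congr 1; ring
  have hm : exp (-(c / 2 * (x ^ 2 / (ν * t')))) ≤ exp (-(c / 2 * (x ^ 2 / (ν * t)))) := by
    gcongr
  rw [heatMaj, show (0 - x) ^ 2 = x ^ 2 by ring, hsplit, e]
  set D := exp (β ^ 2 * (ν₀ * T) / (4 * (c / 2)))
  calc _ ≤ C * (√(t / t') * (√(ν * t))⁻¹) * (D * exp (-(β * x)) * exp (-(c / 2 * (x ^ 2 / (ν * t))))) := by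
        refine mul_le_mul_of_nonneg_left ?_ (by positivity)
        exact mul_le_mul h2 hm (exp_nonneg _) (by positivity)
    _ = C * D * √(t / t') * exp (-(β * x)) * ((√(ν * t))⁻¹ * exp (-(c / 2 * (x ^ 2 / (ν * t))))) := by
        ring
    _ ≤ C * D * √(t / t') * exp (-(β * x)) * (K * blWeight P ν t x) :=
        mul_le_mul_of_nonneg_left (h1.trans (mul_le_mul_of_nonneg_left h3 hK.le)) (by positivity)
    _ = _ := by ring

/-- The amplitude a + 1/δ splits: 1/δ is matched by the layer of thickness δ = √(νt), and a = (√ν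
a)/√ν by the layer of thickness √ν, whose decay is available because δ ≤ √T √ν. The factor √ν a
becomes the lost tangential derivative. -/
lemma exists_resMaj_zero_le {β P T ν₀ c : ℝ} (hP : 1 < P) (hT : 0 < T) (hc : 0 < c) :
    ∃ K : ℝ, 0 < K ∧ ∀ C a ν t t' x : ℝ, 0 ≤ C → 0 ≤ a → 0 < ν → ν ≤ ν₀ → 0 < t' → t' ≤ t → t ≤ T →
      0 < x → resMaj (ν * t') (a + (√(ν * t))⁻¹) C c 0 x ≤
        C * K * (1 + √ν * a) * (exp (-(β * x)) * blWeight P ν t x) := by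
  obtain ⟨K₁, hK₁, h₁⟩ := exists_exp_le_layer (by linarith : 0 ≤ P) hc
  have hsT := Real.sqrt_pos.2 hT
  obtain ⟨K₂, hK₂, h₂⟩ := exists_exp_le_layer (by linarith : 0 ≤ P) (c := c / √T) (by positivity)
  refine ⟨exp (β ^ 2 * (ν₀ * T) / (4 * c)) * (K₁ + K₂), by positivity,
    fun C a ν t t' x hC ha hν hνν ht' htt htT hx => ?_⟩
  have ht := ht'.trans_le htt
  have hτ := mul_pos hν ht'
  have hτ₀ : ν * t' ≤ ν₀ * T := mul_le_mul hνν (htt.trans htT) ht'.le (hν.le.trans hνν)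
  have hg := gauss_absorb (β := β) (u := x) hc hτ hτ₀
  have hsν := Real.sqrt_pos.2 hν
  obtain ⟨l1, l2⟩ := layer_le_blWeight P ν ht (x : ℂ)
  set δ := √(ν * t) with hδd
  have hδ : 0 < δ := Real.sqrt_pos.2 (mul_pos hν ht)
  have hδν : (√T)⁻¹ * (√ν)⁻¹ ≤ δ⁻¹ := by
    rw [← mul_inv]
    apply inv_anti₀ hδ
    rw [hδd, ← Real.sqrt_mul hT.le]; apply Real.sqrt_le_sqrt; nlinarith
  have a1 := (h₁ δ x hδ hx.le).trans (mul_le_mul_of_nonneg_left l1 hK₁.le)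
  have a2 := (h₂ √ν x hsν hx.le).trans (mul_le_mul_of_nonneg_left l2 hK₂.le)
  have hW := zero_le_one.trans (one_le_blWeight P ν t x)
  have m1 : exp (-(c * ((a + δ⁻¹) * x))) ≤ exp (-(c * (δ⁻¹ * x))) := by
    gcongr; linarith
  have m2 : exp (-(c * ((a + δ⁻¹) * x))) ≤ exp (-(c / √T * ((√ν)⁻¹ * x))) := by
    apply Real.exp_le_exp.2
    have : c / √T * ((√ν)⁻¹ * x) = c * ((√T)⁻¹ * (√ν)⁻¹ * x) := by field_simp
    rw [this]
    have : (√T)⁻¹ * (√ν)⁻¹ * x ≤ (a + δ⁻¹) * x := by gcongr; linarith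
    nlinarith
  have key : (a + δ⁻¹) * exp (-(c * ((a + δ⁻¹) * x))) ≤
      (K₁ + K₂) * (1 + √ν * a) * blWeight P ν t x := by
    have e : a = √ν * a * (√ν)⁻¹ := by field_simp
    have q : 0 ≤ √ν * a := by positivity
    calc _ = δ⁻¹ * exp (-(c * ((a + δ⁻¹) * x))) +
          √ν * a * ((√ν)⁻¹ * exp (-(c * ((a + δ⁻¹) * x)))) := by
          rw [← mul_assoc (√ν * a), ← e]; ring
      _ ≤ δ⁻¹ * exp (-(c * (δ⁻¹ * x))) +
          √ν * a * ((√ν)⁻¹ * exp (-(c / √T * ((√ν)⁻¹ * x)))) := by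
          refine add_le_add (mul_le_mul_of_nonneg_left m1 (by positivity))
            (mul_le_mul_of_nonneg_left (mul_le_mul_of_nonneg_left m2 (by positivity)) q)
      _ ≤ K₁ * blWeight P ν t x + √ν * a * (K₂ * blWeight P ν t x) :=
          add_le_add a1 (mul_le_mul_of_nonneg_left a2 q)
      _ ≤ _ := by
          have := mul_nonneg hK₂.le hW
          have := mul_nonneg q (mul_nonneg hK₁.le hW)
          nlinarith
  have hsplit : exp (-(c * ((a + δ⁻¹) * (0 + x) + (0 + x) ^ 2 / (ν * t')))) =
      exp (-(c * (x ^ 2 / (ν * t')))) * exp (-(c * ((a + δ⁻¹) * x))) := by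
    rw [← Real.exp_add]; congr 1; ring
  rw [resMaj, hsplit]
  set D := exp (β ^ 2 * (ν₀ * T) / (4 * c))
  calc _ = C * exp (-(c * (x ^ 2 / (ν * t')))) * ((a + δ⁻¹) * exp (-(c * ((a + δ⁻¹) * x)))) := by ring
    _ ≤ C * (D * exp (-(β * x))) * ((K₁ + K₂) * (1 + √ν * a) * blWeight P ν t x) := by
        refine mul_le_mul (mul_le_mul_of_nonneg_left hg hC) key (by positivity) (by positivity)
    _ = _ := by ring

/-- The boundary operator in the weighted sup norm of a single mode. -/
lemma exists_blModeNorm_boundary_le {β P T ν₀ σ₀ : ℝ} (hP : 1 < P) (hT : 0 < T)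
    (hσ₀ : 0 < σ₀) (hσ₀1 : σ₀ < 1) (l : ℕ) : ∃ C : ℝ, 0 ≤ C ∧ ∀ (ν σ t' t : ℝ) (α : ℤ),
      0 < ν → ν ≤ ν₀ → 0 < σ → σ ≤ σ₀ → 0 < t' → t' ≤ t → t ≤ T →
      blModeNorm β P ν t σ (conD^[l] (stokesGreen ν α t' 0)) ≤
        ENNReal.ofReal (C * (√(t / t') + √ν * |(α : ℝ)|)) := by
  obtain ⟨C₁, c₁, hC₁, hc₁, kb₁⟩ := exists_kernelBound_heatE hσ₀ hσ₀1
  obtain ⟨C₂, c₂, hC₂, hc₂, kb₂⟩ := exists_kernelBound_resE hσ₀ hσ₀1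
  choose K₁ hK₁ hw₁ using fun i =>
    exists_heatMaj_zero_le (β := β) (ν₀ := ν₀) (T := T) hP (hc₁ i)
  choose K₂ hK₂ hw₂ using fun i =>
    exists_resMaj_zero_le (β := β) (ν₀ := ν₀) hP hT (hc₂ i)
  obtain ⟨D, hD, hd⟩ := exists_norm_iterate_conD_stokesGreen_zero_le l
  have hKn : ∀ i, 0 ≤ C₁ i * K₁ i + C₂ i * K₂ i := fun i => by
    have := hC₁ i; have := hK₁ i; have := hC₂ i; have := hK₂ i; positivity
  refine ⟨D * ∑ i ∈ Finset.range (l + 1), (C₁ i * K₁ i + C₂ i * K₂ i),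
    mul_nonneg hD (Finset.sum_nonneg fun i _ => hKn i),
    fun ν σ t' t α hν hνν hσ hσσ ht' htt htT => ?_⟩
  have ht := ht'.trans_le htt
  have hδ : 0 < √(ν * t) := Real.sqrt_pos.2 (mul_pos hν ht)
  have h1 : 1 ≤ √(t / t') := by rw [Real.one_le_sqrt, one_le_div ht']; exact htt
  refine blModeNorm_le hσ fun θ x hθ hx => ?_
  have hW := zero_le_one.trans (one_le_blWeight P ν t x)
  rw [← ofReal_norm, ← ENNReal.ofReal_mul (by positivity)]
  apply ENNReal.ofReal_le_ofReal
  refine (hd ν t' σ α _ _ hσ (kb₁ ν t' σ α 1 hν ht' hσ hσσ (Or.inl rfl)) (kb₂ ν t' √(ν * t) σ α hν ht'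
    hδ (by rw [Real.sq_sqrt (by positivity)]; gcongr) hσ hσσ) θ x hθ hx).trans ?_
  set w := exp (-(β * x)) * blWeight P ν t x with hw
  have hw0 : 0 ≤ w := by positivity
  have q : 0 ≤ √ν * |(α : ℝ)| := by positivity
  calc _ ≤ D * ∑ i ∈ Finset.range (l + 1),
        (C₁ i * K₁ i + C₂ i * K₂ i) * (w * (√(t / t') + √ν * |(α : ℝ)|)) := by
        refine mul_le_mul_of_nonneg_left (Finset.sum_le_sum fun i _ => ?_) hD
        have b1 := hw₁ i (C₁ i) ν t t' x (hC₁ i).le hν hνν ht' htt htT hx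
        have b2 := hw₂ i (C₂ i) |(α : ℝ)| ν t t' x (hC₂ i).le (abs_nonneg _) hν hνν ht' htt htT hx
        have p1 := mul_nonneg (hC₁ i).le (hK₁ i).le
        have p2 := mul_nonneg (hC₂ i).le (hK₂ i).le
        calc _ ≤ C₁ i * K₁ i * √(t / t') * w + C₂ i * K₂ i * (1 + √ν * |(α : ℝ)|) * w :=
              add_le_add b1 b2
          _ ≤ C₁ i * K₁ i * (√(t / t') + √ν * |(α : ℝ)|) * w +
              C₂ i * K₂ i * (√(t / t') + √ν * |(α : ℝ)|) * w := by
              gcongr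
              linarith
          _ = _ := by ring
    _ = _ := by rw [← Finset.sum_mul]; ring

lemma differentiable_stokesGreen_zero {ν t : ℝ} (hν : 0 < ν) (ht : 0 < t) (α : ℤ) :
    Differentiable ℂ (stokesGreen ν α t 0) := by
  simpa using (isStokesGreen_stokesGreen hν α).holo t ht 0 le_rfl

/-- The boundary operator in the `L¹` norm of a single mode. -/
lemma exists_l1ModeNorm_boundary_le {σ₀ : ℝ} (hσ₀ : 0 < σ₀) (hσ₀1 : σ₀ < 1) (l : ℕ) :
    ∃ C : ℝ, 0 ≤ C ∧ ∀ (ν σ t : ℝ) (α : ℤ), 0 < ν → 0 < σ → σ ≤ σ₀ → 0 < t →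
      l1ModeNorm σ (conD^[l] (stokesGreen ν α t 0)) ≤ ENNReal.ofReal C := by
  obtain ⟨C₁, c₁, hC₁, hc₁, kb₁⟩ := exists_kernelBound_heatE hσ₀ hσ₀1
  obtain ⟨C₂, c₂, hC₂, hc₂, kb₂⟩ := exists_kernelBound_resE hσ₀ hσ₀1
  obtain ⟨D, hD, hd⟩ := exists_norm_iterate_conD_stokesGreen_zero_le l
  have hKn : ∀ i, 0 ≤ C₁ i * √(π / c₁ i) + C₂ i * (c₂ i)⁻¹ := fun i => by
    have := hC₁ i; have := hC₂ i; have := hc₂ i; positivity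
  refine ⟨4 * (D * ∑ i ∈ Finset.range (l + 1), (C₁ i * √(π / c₁ i) + C₂ i * (c₂ i)⁻¹)),
    mul_nonneg (by norm_num) (mul_nonneg hD (Finset.sum_nonneg fun i _ => hKn i)),
    fun ν σ t α hν hσ hσσ ht => ?_⟩
  have hτ := mul_pos hν ht
  have hδ : 0 < √(ν * t) := Real.sqrt_pos.2 hτ
  have hn : ∀ i x, 0 ≤ heatMaj (ν * t) (C₁ i) (c₁ i) 0 x := fun i x => by
    have := hC₁ i; unfold heatMaj; positivity
  have hn' : ∀ i x, 0 ≤ resMaj (ν * t) (|(α : ℝ)| + (√(ν * t))⁻¹) (C₂ i) (c₂ i) 0 x := fun i x => by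
    have := hC₂ i; unfold resMaj; positivity
  rw [ENNReal.ofReal_mul (by norm_num), ENNReal.ofReal_ofNat]
  refine l1ModeNorm_le (hσσ.trans_lt hσ₀1) (iterate_conD_differentiableOn hσ l
    (differentiable_stokesGreen_zero hν ht α).differentiableOn).continuousOn fun θ hθ => ?_
  calc _ ≤ ∫⁻ x in Ioi (0 : ℝ), ENNReal.ofReal D * ∑ i ∈ Finset.range (l + 1),
        (ENNReal.ofReal (heatMaj (ν * t) (C₁ i) (c₁ i) 0 x) +
        ENNReal.ofReal (resMaj (ν * t) (|(α : ℝ)| + (√(ν * t))⁻¹) (C₂ i) (c₂ i) 0 x)) := by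
        refine setLIntegral_mono' measurableSet_Ioi fun x hx => ?_
        simp only [← ENNReal.ofReal_add (hn _ _) (hn' _ _)]
        rw [← ofReal_norm, ← ENNReal.ofReal_sum_of_nonneg fun i _ => add_nonneg (hn i x) (hn' i x),
          ← ENNReal.ofReal_mul hD]
        exact ENNReal.ofReal_le_ofReal (hd ν t σ α _ _ hσ (kb₁ ν t σ α 1 hν ht hσ hσσ (Or.inl rfl))
          (kb₂ ν t √(ν * t) σ α hν ht hδ (Real.sq_sqrt hτ.le).ge hσ hσσ) θ x hθ hx)
    _ ≤ _ := by
        rw [lintegral_const_mul' _ _ ENNReal.ofReal_ne_top, ENNReal.ofReal_mul hD,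
          lintegral_finsetSum _ fun i _ => by unfold heatMaj resMaj; fun_prop,
          ENNReal.ofReal_sum_of_nonneg fun i _ => hKn i]
        refine mul_le_mul_right (Finset.sum_le_sum fun i _ => ?_) _
        have p1 := mul_nonneg (hC₁ i).le (Real.sqrt_nonneg (π / c₁ i))
        have p2 := mul_nonneg (hC₂ i).le (inv_nonneg.2 (hc₂ i).le)
        rw [lintegral_add_left (by unfold heatMaj; fun_prop), ENNReal.ofReal_add p1 p2]
        exact add_le_add (lintegral_heatMaj_le hτ (hC₁ i).le (hc₁ i) 0)
          (lintegral_resMaj_le hτ (by positivity) (hC₂ i).le (hc₂ i) le_rfl)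

/-! ### Bounds at fixed parameters -/

/-- A crude bound, not uniform in ν and t. It only serves the convergence of the Fourier series,
where linear growth in α is harmless. -/
lemma exists_norm_stokesGreen_le {ν t σ : ℝ} (hν : 0 < ν) (ht : 0 < t) (hσ : 0 < σ) (hσ1 : σ < 1) :
    ∃ K : ℝ, 0 ≤ K ∧ ∀ (α : ℤ) (y : ℝ), 0 ≤ y → ∀ z ∈ pencil σ,
      ‖stokesGreen ν α t y z‖ ≤ K * (1 + |(α : ℝ)|) := by
  have hτ := mul_pos hν ht
  set A := (√(ν * t))⁻¹ * exp (1 / (4 * (ν * t)))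
  set B := 2 * √(2 / (1 - σ ^ 2))
  have hA : 0 ≤ A := by positivity
  refine ⟨2 * A + B, by positivity, fun α y hy z hz => ?_⟩
  have him := (pencil_im_lt hz).trans hσ1
  have hx := pencil_re_pos hσ hz
  have hcone : (y : ℂ) + z ∈ cone σ := by
    have h1 : |z.im| < σ * z.re := lt_of_lt_of_le hz (min_le_left _ _)
    show |((y : ℂ) + z).im| ≤ σ * ((y : ℂ) + z).re
    simp only [Complex.add_im, Complex.ofReal_im, zero_add, Complex.add_re, Complex.ofReal_re]
    nlinarith
  have hh : ∀ ζ : ℂ, ζ.im ^ 2 ≤ 1 → ‖heatE ν α t ζ‖ ≤ A := fun ζ hζ => by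
    refine (norm_heatE_le hν ht α ζ).trans (mul_le_mul_of_nonneg_left ?_ (by positivity))
    apply Real.exp_le_exp.2
    gcongr
    nlinarith
  have hsq : z.im ^ 2 ≤ 1 := by rw [← sq_abs]; nlinarith [abs_nonneg z.im]
  have h1 := hh (y - z) (by simpa using hsq)
  have h2 := hh (y + z) (by simpa using hsq)
  have h3 : ‖resE ν α t (y + z)‖ ≤ B * |(α : ℝ)| := by
    refine (norm_resE_cone_le hν ht α hσ hσ1 hcone).trans ?_
    have h1s : 0 ≤ 1 - σ ^ 2 := by nlinarith
    have hre := cone_re_nonneg hσ hcone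
    have : exp (-((1 - σ ^ 2) * (|(α : ℝ)| * (y + z : ℂ).re / 2 +
        (y + z : ℂ).re ^ 2 / (8 * (ν * t))))) ≤ 1 := by
      rw [Real.exp_le_one_iff, neg_nonpos]; positivity
    calc _ ≤ 2 * |(α : ℝ)| * √(2 / (1 - σ ^ 2)) * 1 := mul_le_mul_of_nonneg_left this (by positivity)
      _ = _ := by simp only [B]; ring
  rw [stokesGreen_eq]
  calc _ ≤ A + A + B * |(α : ℝ)| := (norm_add_le _ _).trans
        (add_le_add ((norm_add_le _ _).trans (add_le_add h1 h2)) h3)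
    _ ≤ _ := by
        have : 0 ≤ B := by positivity
        nlinarith [abs_nonneg (α : ℝ), mul_nonneg hA (abs_nonneg (α : ℝ))]

lemma exists_enorm_intOp_stokesGreen_le {ν t σ : ℝ} (hν : 0 < ν) (ht : 0 < t) (hσ : 0 < σ)
    (hσ1 : σ < 1) : ∃ K : ℝ, 0 ≤ K ∧ ∀ (α : ℤ) (h : ℂ → ℂ), ∀ z ∈ pencil σ,
      ‖intOp (stokesGreen ν α t) h z‖ₑ ≤ ENNReal.ofReal (K * (1 + |(α : ℝ)|)) * l1ModeNorm σ h := by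
  obtain ⟨K, hK, hb⟩ := exists_norm_stokesGreen_le hν ht hσ hσ1
  refine ⟨K, hK, fun α h z hz => (enorm_integral_le_lintegral_enorm _).trans ?_⟩
  calc _ ≤ ∫⁻ y in Ioi (0 : ℝ), ENNReal.ofReal (K * (1 + |(α : ℝ)|)) * ‖h y‖ₑ := by
        refine setLIntegral_mono' measurableSet_Ioi fun y hy => ?_
        rw [enorm_mul]
        gcongr
        rw [← ofReal_norm]
        exact ENNReal.ofReal_le_ofReal (hb α y (mem_Ioi.1 hy).le z hz)
    _ = ENNReal.ofReal (K * (1 + |(α : ℝ)|)) * ∫⁻ y in Ioi (0 : ℝ), ‖h y‖ₑ :=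
        lintegral_const_mul' _ _ ENNReal.ofReal_ne_top
    _ ≤ _ := by
        gcongr
        simpa [branch_zero] using lintegral_branch_le (σ := σ) h (θ := 0) (by simpa using hσ)

/-- At fixed parameters the layers are bounded and e^{−βr} is integrable. Finite weighted sup norm
thus implies finite L¹ norm, so well-definedness needs to be treated in L¹ only. -/
lemma exists_l1ModeNorm_le_blModeNorm {β P ν s σ : ℝ} (hβ : 0 < β) (hσ1 : σ < 1) :
    ∃ K : ℝ, 0 ≤ K ∧ ∀ g : ℂ → ℂ, ContinuousOn g (pencil σ) →
      l1ModeNorm σ g ≤ ENNReal.ofReal K * blModeNorm β P ν s σ g := by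
  set W := 1 + (√(ν * s))⁻¹ + (√ν)⁻¹
  have hW : ∀ r : ℝ, blWeight P ν s r ≤ W := fun r => by
    have h1 := layer_le_inv P (Real.sqrt_nonneg (ν * s)) (r : ℂ)
    have h2 := layer_le_inv P (Real.sqrt_nonneg ν) (r : ℂ)
    have h3 : 0 ≤ (√(ν * s))⁻¹ := by positivity
    simp only [blWeight, W]
    split_ifs <;> linarith
  have hW0 : 0 ≤ W := by positivity
  refine ⟨4 * (W * β⁻¹), by positivity, fun g hg => ?_⟩
  rw [ENNReal.ofReal_mul (by norm_num), ENNReal.ofReal_ofNat, mul_assoc]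
  refine l1ModeNorm_le hσ1 hg fun θ hθ => ?_
  calc _ ≤ ∫⁻ r in Ioi (0 : ℝ), ENNReal.ofReal W * blModeNorm β P ν s σ g *
        ENNReal.ofReal (1 * exp (-(β * (1 * r)))) := by
        refine setLIntegral_mono' measurableSet_Ioi fun r hr =>
          (enorm_le_blModeNorm (β := β) (P := P) (ν := ν) (t := s) g hθ hr).trans ?_
        rw [one_mul, one_mul, mul_right_comm, ← ENNReal.ofReal_mul hW0]
        refine mul_le_mul_left (ENNReal.ofReal_le_ofReal ?_) _
        rw [mul_comm]
        exact mul_le_mul_of_nonneg_right (hW r) (exp_nonneg _)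
    _ = ENNReal.ofReal W * blModeNorm β P ν s σ g *
        ∫⁻ r in Ioi (0 : ℝ), ENNReal.ofReal (1 * exp (-(β * (1 * r)))) :=
        lintegral_const_mul _ (by fun_prop)
    _ ≤ ENNReal.ofReal W * blModeNorm β P ν s σ g * ENNReal.ofReal β⁻¹ := by
        gcongr; exact lintegral_exp_le one_pos hβ
    _ = _ := by rw [ENNReal.ofReal_mul hW0]; ring

end

noncomputable section

/-! ### Fourier series with values in holomorphic functions -/

lemma lt_top_of_expSum {ρ : ℝ} {b : ℤ → ℝ≥0∞} (h : expSum ρ b < ⊤) (α : ℤ) : b α < ⊤ := by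
  have h1 := (ENNReal.le_tsum (f := fun α : ℤ => ENNReal.ofReal (exp (ρ * |(α : ℝ)|)) * b α) α).trans_lt h
  by_contra hb
  rw [not_lt, top_le_iff] at hb
  simp only [hb] at h1
  rw [ENNReal.mul_top (by simp [exp_pos])] at h1
  exact lt_irrefl _ h1

lemma expSum_mono {ρ : ℝ} {a b : ℤ → ℝ≥0∞} (h : ∀ α, a α ≤ b α) : expSum ρ a ≤ expSum ρ b :=
  ENNReal.tsum_le_tsum fun α => mul_le_mul_right (h α) _

lemma expSum_const_mul (ρ : ℝ) (c : ℝ≥0∞) (b : ℤ → ℝ≥0∞) :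
    expSum ρ (fun α => c * b α) = c * expSum ρ b := by
  simp only [expSum, ← ENNReal.tsum_mul_left]
  exact tsum_congr fun α => by ring

lemma expSum_add (ρ : ℝ) (a b : ℤ → ℝ≥0∞) :
    expSum ρ (fun α => a α + b α) = expSum ρ a + expSum ρ b := by
  simp only [expSum, mul_add]
  exact ENNReal.tsum_add

lemma expSum_finset_sum {ι : Type*} (s : Finset ι) (ρ : ℝ) (b : ι → ℤ → ℝ≥0∞) :
    expSum ρ (fun α => ∑ i ∈ s, b i α) = ∑ i ∈ s, expSum ρ (b i) := by
  simp only [expSum, Finset.mul_sum]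
  exact Summable.tsum_finsetSum fun i _ => ENNReal.summable

/-- A family of holomorphic functions on the pencil, bounded by `K (1 + |α|) b_α` with
`∑ e^{ρ|α|} b_α < ∞`. -/
structure ModeFamily (ρ σ : ℝ) (a : ℤ → ℂ → ℂ) (b : ℤ → ℝ≥0∞) : Prop where
  holo : ∀ α, DifferentiableOn ℂ (a α) (pencil σ)
  bound : ∃ K : ℝ, 0 ≤ K ∧ ∀ α, ∀ z ∈ pencil σ, ‖a α z‖ₑ ≤ ENNReal.ofReal (K * (1 + |(α : ℝ)|)) * b α
  fin : expSum ρ b < ⊤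

namespace ModeFamily

variable {ρ σ : ℝ} {a : ℤ → ℂ → ℂ} {b : ℤ → ℝ≥0∞}

/-- The weight e^{ρ|α|} absorbs the factor 1 + |α| and any further power, giving a summable majorant
uniform in z for the Weierstrass test. -/
lemma exists_norm_le (hρ : 0 < ρ) (h : ModeFamily ρ σ a b) : ∃ u : ℤ → ℝ,
    (∀ j : ℕ, Summable fun α : ℤ => |(α : ℝ)| ^ j * u α) ∧ ∀ α, ∀ z ∈ pencil σ, ‖a α z‖ ≤ u α := by
  obtain ⟨K, hK, hb⟩ := h.bound
  have hr : RapidDecay fun α => ((b α).toReal : ℂ) := by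
    refine rapidDecay_of_expSum hρ (lt_of_eq_of_lt ?_ h.fin)
    congr 1
    funext α
    rw [Complex.norm_real, Real.norm_of_nonneg ENNReal.toReal_nonneg,
      ENNReal.ofReal_toReal (lt_top_of_expSum h.fin α).ne]
  refine ⟨fun α => K * (1 + |(α : ℝ)|) * (b α).toReal, fun j => ?_, fun α z hz => ?_⟩
  · refine (((hr j).add (hr (j + 1))).mul_left K).congr fun α => ?_
    rw [Complex.norm_real, Real.norm_of_nonneg ENNReal.toReal_nonneg]; ring
  · have h1 := ENNReal.toReal_mono (ENNReal.mul_ne_top ENNReal.ofReal_ne_top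
      (lt_top_of_expSum h.fin α).ne) (hb α z hz)
    rwa [toReal_enorm, ENNReal.toReal_mul, ENNReal.toReal_ofReal (by positivity)] at h1

lemma rapidDecay (hρ : 0 < ρ) (h : ModeFamily ρ σ a b) {z : ℂ} (hz : z ∈ pencil σ) :
    RapidDecay fun α => a α z := by
  obtain ⟨u, hu, hb⟩ := h.exists_norm_le hρ
  intro j
  exact Summable.of_nonneg_of_le (fun _ => by positivity)
    (fun α => mul_le_mul_of_nonneg_left (hb α z hz) (by positivity)) (hu j)

lemma isHoloOn (hρ : 0 < ρ) (h : ModeFamily ρ σ a b) :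
    IsHoloOn σ fun x z => ∑' α : ℤ, chr α x * a α z where
  periodic z _ := periodic_tsum_chr fun α => a α z
  cont := by
    obtain ⟨u, hu, hb⟩ := h.exists_norm_le hρ
    refine continuousOn_tsum (u := u) (fun α => ?_) (by simpa using hu 0) fun α p hp => ?_
    · exact ((continuous_chr α).comp continuous_fst).continuousOn.mul
        ((h.holo α).continuousOn.comp continuousOn_snd fun p hp => hp.2)
    · rw [norm_mul, norm_chr, one_mul]; exact hb α p.2 hp.2
  holo x := by
    obtain ⟨u, hu, hb⟩ := h.exists_norm_le hρ
    refine Complex.differentiableOn_tsum_of_summable_norm (u := u) (by simpa using hu 0)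
      (fun α => (h.holo α).const_mul _) (isOpen_pencil σ) fun α z hz => ?_
    rw [norm_mul, norm_chr, one_mul]; exact hb α z hz

lemma mode_eq (hρ : 0 < ρ) (h : ModeFamily ρ σ a b) {z : ℂ} (hz : z ∈ pencil σ) (α : ℤ) :
    mode (fun x z => ∑' α : ℤ, chr α x * a α z) α z = a α z :=
  coeff_tsum_chr (h.rapidDecay hρ hz).summable α

lemma hasDerivAt (hρ : 0 < ρ) (h : ModeFamily ρ σ a b) {z : ℂ} (hz : z ∈ pencil σ) (x : ℝ) :
    HasDerivAt (fun x => ∑' α : ℤ, chr α x * a α z)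
      (∑' α : ℤ, chr α x * (Complex.I * α * a α z)) x :=
  hasDerivAt_tsum_chr (by simpa using h.rapidDecay hρ hz 1) (h.rapidDecay hρ hz).summable x

end ModeFamily

variable {ν t ρ σ : ℝ} {f : ℝ → ℂ → ℂ}

lemma pencilL1_mode (hf : IsHoloOn σ f) (hfin : l1Norm ρ σ f < ⊤) (α : ℤ) :
    PencilL1 σ (mode f α) :=
  ⟨hf.mode_differentiableOn α, lt_top_of_expSum hfin α⟩

lemma modeFamily_semigroup (hν : 0 < ν) (ht : 0 < t) (hσ : 0 < σ) (hσ1 : σ < 1)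
    (hf : IsHoloOn σ f) (hfin : l1Norm ρ σ f < ⊤) :
    ModeFamily ρ σ (fun α => intOp (stokesGreen ν α t) (mode f α))
      fun α => l1ModeNorm σ (mode f α) where
  holo α := (isPencilKernel_stokesGreen hν ht hσ hσ1 α).differentiableOn_intOp hσ
    (pencilL1_mode hf hfin α)
  bound := by
    obtain ⟨K, hK, h⟩ := exists_enorm_intOp_stokesGreen_le hν ht hσ hσ1
    exact ⟨K, hK, fun α z hz => h α _ z hz⟩
  fin := hfin

lemma modeFamily_boundary (hν : 0 < ν) (ht : 0 < t) (hσ : 0 < σ) (hσ1 : σ < 1) {g : ℝ → ℂ}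
    (hfin : bdryNorm ρ g < ⊤) :
    ModeFamily ρ σ (fun α z => stokesGreen ν α t 0 z * coeff g α)
      fun α => ENNReal.ofReal ‖coeff g α‖ where
  holo α := (differentiable_stokesGreen_zero hν ht α).differentiableOn.mul_const _
  bound := by
    obtain ⟨K, hK, h⟩ := exists_norm_stokesGreen_le hν ht hσ hσ1
    refine ⟨K, hK, fun α z hz => ?_⟩
    rw [enorm_mul, ofReal_norm]
    refine mul_le_mul_left ?_ _
    rw [← ofReal_norm]
    exact ENNReal.ofReal_le_ofReal (by simpa using h α 0 le_rfl z hz)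
  fin := hfin

/-- A finite L¹ norm yields, by Tonelli, decay of the coefficients only at almost every point of a
branch. This suffices under integrals. -/
lemma ae_rapidDecay_branch (hρ : 0 < ρ) (hf : IsHoloOn σ f) (hfin : l1Norm ρ σ f < ⊤) {θ : ℝ}
    (hθ : |θ| < σ) :
    ∀ᵐ r ∂volume.restrict (Ioi (0 : ℝ)), RapidDecay fun α => mode f α (branch θ r) := by
  have hm : ∀ α : ℤ, AEMeasurable (fun r => ENNReal.ofReal (exp (ρ * |(α : ℝ)|)) *
      ENNReal.ofReal ‖mode f α (branch θ r)‖) (volume.restrict (Ioi 0)) := fun α => by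
    have := ((continuousOn_comp_branch (hf.mode_differentiableOn α).continuousOn
      hθ).aestronglyMeasurable (μ := volume) measurableSet_Ioi).enorm
    simp only [ofReal_norm]
    exact this.const_mul _
  have h1 : ∫⁻ r in Ioi (0 : ℝ), expSum ρ (fun α => ENNReal.ofReal ‖mode f α (branch θ r)‖) < ⊤ := by
    simp only [expSum]
    rw [lintegral_tsum hm]
    refine lt_of_le_of_lt (ENNReal.tsum_le_tsum fun α => ?_) hfin
    rw [lintegral_const_mul' _ _ ENNReal.ofReal_ne_top]
    simp only [ofReal_norm]
    gcongr
    exact lintegral_branch_le _ hθ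
  have h2 : AEMeasurable (fun r => expSum ρ (fun α => ENNReal.ofReal ‖mode f α (branch θ r)‖))
      (volume.restrict (Ioi 0)) := by
    simp only [expSum]
    exact AEMeasurable.tsum hm
  filter_upwards [ae_lt_top' h2 h1.ne] with r hr using rapidDecay_of_expSum hρ hr

/-- The modes of ∂_x f are identified for almost every y ∈ ℝ₊ only; the exceptional set is invisible
to the integral. -/
lemma stokesSemigroup_dX (hρ : 0 < ρ) (hσ : 0 < σ) (hf : IsHoloOn σ f)
    (hfin : l1Norm ρ σ f < ⊤) (x : ℝ) (z : ℂ) :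
    stokesSemigroup ν t (dX f) x z =
      ∑' α : ℤ, chr α x * (Complex.I * α * intOp (stokesGreen ν α t) (mode f α) z) := by
  refine tsum_congr fun α => ?_
  rw [chr, intOp, ← integral_const_mul (Complex.I * α)]
  refine congrArg (Complex.exp (Complex.I * α * x) * ·) (integral_congr_ae ?_)
  filter_upwards [ae_rapidDecay_branch hρ hf hfin (θ := 0) (by simpa using hσ),
    ae_restrict_mem measurableSet_Ioi] with y hy hy0
  simp only [branch_zero] at hy
  have := hf.mode_iterate_dX (ofReal_mem_pencil hσ hy0) hy 1 α
  simp only [Function.iterate_one, pow_one] at this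
  rw [this]; ring

lemma l1Norm_lt_top_of_blNorm {β P s : ℝ} (hβ : 0 < β) (hσ1 : σ < 1) (hf : IsHoloOn σ f)
    (h : blNorm β P ν s ρ σ f < ⊤) : l1Norm ρ σ f < ⊤ := by
  obtain ⟨K, hK, hb⟩ := exists_l1ModeNorm_le_blModeNorm (β := β) (P := P) (ν := ν) (s := s) hβ hσ1
  refine lt_of_le_of_lt (expSum_mono fun α => hb _ (hf.mode_differentiableOn α).continuousOn) ?_
  rw [expSum_const_mul]
  exact ENNReal.mul_lt_top ENNReal.ofReal_lt_top h

/-- The Stokes semigroup is well defined and commutes with `∂_x`. -/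
lemma stokesSemigroup_isHoloOn_and_hasDerivAt (hν : 0 < ν) (ht : 0 < t) (hρ : 0 < ρ) (hσ : 0 < σ)
    (hσ1 : σ < 1) (hf : IsHoloOn σ f) (hfin : l1Norm ρ σ f < ⊤) :
    IsHoloOn σ (stokesSemigroup ν t f) ∧ ∀ x : ℝ, ∀ z ∈ pencil σ,
      HasDerivAt (fun x' => stokesSemigroup ν t f x' z) (stokesSemigroup ν t (dX f) x z) x := by
  have h := modeFamily_semigroup hν ht hσ hσ1 hf hfin
  refine ⟨h.isHoloOn hρ, fun x z hz => ?_⟩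
  rw [stokesSemigroup_dX hρ hσ hf hfin]
  exact h.hasDerivAt hρ hz x

/-- The boundary operator is well defined and commutes with `∂_x`. -/
lemma stokesBoundary_isHoloOn_and_hasDerivAt (hν : 0 < ν) (ht : 0 < t) (hρ : 0 < ρ) (hσ : 0 < σ)
    (hσ1 : σ < 1) {g : ℝ → ℂ} (hg : Continuous g) (hp : Function.Periodic g (2 * π))
    (hfin : bdryNorm ρ g < ⊤) :
    IsHoloOn σ (stokesBoundary ν t g) ∧ ∀ x : ℝ, ∀ z ∈ pencil σ,
      HasDerivAt (fun x' => stokesBoundary ν t g x' z) (stokesBoundary ν t (deriv g) x z) x := by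
  have h := modeFamily_boundary hν ht hσ hσ1 hfin
  refine ⟨h.isHoloOn hρ, fun x z hz => ?_⟩
  have e : stokesBoundary ν t (deriv g) x z =
      ∑' α : ℤ, chr α x * (Complex.I * α * (stokesGreen ν α t 0 z * coeff g α)) := by
    refine tsum_congr fun α => ?_
    rw [RapidDecay.coeff_deriv hg hp (rapidDecay_of_expSum hρ hfin), chr]; ring
  rw [e]
  exact h.hasDerivAt hρ hz x

end

noncomputable section

/-! ### From single modes to the conormal norms -/

/-- A norm of functions on the pencil that is compatible with Fourier series. -/
structure IsModeNorm (ρ σ : ℝ) (N : (ℂ → ℂ) → ℝ≥0∞) : Prop where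
  congr : ∀ {g h : ℂ → ℂ}, EqOn g h (pencil σ) → N g = N h
  mul_const : ∀ (g : ℂ → ℂ) (c : ℂ), N (fun z => g z * c) = N g * ENNReal.ofReal ‖c‖
  dX : ∀ {f : ℝ → ℂ → ℂ}, IsHoloOn σ f → expSum ρ (fun α => N (mode f α)) < ⊤ → ∀ (j : ℕ) (α : ℤ),
    N (mode (dX^[j] f) α) = ENNReal.ofReal (|(α : ℝ)| ^ j) * N (mode f α)

lemma norm_I_mul_pow (α : ℤ) (j : ℕ) : ‖(Complex.I * α) ^ j‖ = |(α : ℝ)| ^ j := by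
  rw [norm_pow, norm_mul, Complex.norm_I, one_mul, Complex.norm_intCast]

lemma blModeNorm_congr {β P ν t σ : ℝ} {g h : ℂ → ℂ} (e : EqOn g h (pencil σ)) :
    blModeNorm β P ν t σ g = blModeNorm β P ν t σ h :=
  biSup_congr fun z hz => by rw [e hz]

lemma blModeNorm_mul_const (β P ν t σ : ℝ) (g : ℂ → ℂ) (c : ℂ) :
    blModeNorm β P ν t σ (fun z => g z * c) = blModeNorm β P ν t σ g * ENNReal.ofReal ‖c‖ := by
  simp only [blModeNorm, ENNReal.iSup_mul]
  refine biSup_congr fun z hz => ?_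
  have := zero_lt_one.trans_le (one_le_blWeight P ν t z)
  rw [← ENNReal.ofReal_mul (by positivity), norm_mul]
  congr 1; ring

lemma isModeNorm_blModeNorm {ρ σ : ℝ} (hρ : 0 < ρ) (hσ : 0 < σ) (β P ν t : ℝ) :
    IsModeNorm ρ σ (blModeNorm β P ν t σ) where
  congr := blModeNorm_congr
  mul_const := blModeNorm_mul_const β P ν t σ
  dX := by
    intro f hf hfin j α
    rw [mul_comm, ← norm_I_mul_pow, ← blModeNorm_mul_const]
    refine blModeNorm_congr fun z hz => ?_
    rw [hf.mode_iterate_dX hz _ j α, mul_comm]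
    obtain ⟨θ, hθ, hze⟩ := exists_branch hσ hz
    rw [hze]
    refine rapidDecay_of_expSum hρ (lt_of_le_of_lt (expSum_mono fun γ => ?_)
      ((expSum_const_mul ρ (ENNReal.ofReal (exp (-(β * z.re)) * blWeight P ν t z.re)) _).trans_lt
        (ENNReal.mul_lt_top ENNReal.ofReal_lt_top hfin)))
    rw [ofReal_norm]
    exact enorm_le_blModeNorm _ hθ (pencil_re_pos hσ hz)

/-- Equality almost everywhere on each branch is all that is available for modes of x-derivatives.
-/
lemma l1ModeNorm_congr_ae {σ : ℝ} {g h : ℂ → ℂ}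
    (e : ∀ θ, |θ| < σ → ∀ᵐ r ∂volume.restrict (Ioi (0 : ℝ)), g (branch θ r) = h (branch θ r)) :
    l1ModeNorm σ g = l1ModeNorm σ h := by
  refine biSup_congr fun θ hθ => lintegral_congr_ae ?_
  have hθ' : |θ| < σ := by rw [abs_of_nonneg hθ.1]; exact hθ.2
  filter_upwards [e θ hθ', e (-θ) (by rwa [abs_neg])] with r h1 h2
  rw [h1, h2]

lemma l1ModeNorm_mul_const (σ : ℝ) (g : ℂ → ℂ) (c : ℂ) :
    l1ModeNorm σ (fun z => g z * c) = l1ModeNorm σ g * ENNReal.ofReal ‖c‖ := by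
  simp only [l1ModeNorm, ENNReal.iSup_mul]
  refine biSup_congr fun θ hθ => ?_
  rw [← lintegral_mul_const' _ _ ENNReal.ofReal_ne_top]
  refine lintegral_congr fun r => ?_
  have := zero_le_one.trans (one_le_arcDensity θ r)
  rw [← ENNReal.ofReal_mul (by positivity), norm_mul, norm_mul]
  congr 1; ring

lemma isModeNorm_l1ModeNorm {ρ σ : ℝ} (hρ : 0 < ρ) : IsModeNorm ρ σ (l1ModeNorm σ) where
  congr e := l1ModeNorm_congr_ae fun θ hθ => by
    filter_upwards [ae_restrict_mem measurableSet_Ioi] with r hr using e (branch_mem_pencil hθ hr)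
  mul_const := l1ModeNorm_mul_const σ
  dX := by
    intro f hf hfin j α
    rw [mul_comm, ← norm_I_mul_pow, ← l1ModeNorm_mul_const]
    refine l1ModeNorm_congr_ae fun θ hθ => ?_
    filter_upwards [ae_rapidDecay_branch hρ hf hfin hθ, ae_restrict_mem measurableSet_Ioi]
      with r hr hr0
    rw [hf.mode_iterate_dX (branch_mem_pencil hθ hr0) hr j α, mul_comm]

/-! ### Conormal norms as sums over modes -/

/-- `∑_{j+ℓ ≤ k} ∑_α e^{ρ|α|} |α|^j A_{ℓ,α}`. -/
def modeSum (ρ : ℝ) (k : ℕ) (A : ℕ → ℤ → ℝ≥0∞) : ℝ≥0∞ :=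
  ∑ m ∈ Finset.range (k + 1), ∑ p ∈ Finset.HasAntidiagonal.antidiagonal m,
    expSum ρ fun α => ENNReal.ofReal (|(α : ℝ)| ^ p.1) * A p.2 α

lemma le_sum_antidiagonal {k i j : ℕ} (h : i + j ≤ k) (F : ℕ × ℕ → ℝ≥0∞) :
    F (i, j) ≤ ∑ m ∈ Finset.range (k + 1), ∑ p ∈ Finset.HasAntidiagonal.antidiagonal m, F p :=
  (Finset.single_le_sum (f := F) (fun _ _ => zero_le)
    (Finset.HasAntidiagonal.mem_antidiagonal.2 (rfl : (i, j).1 + (i, j).2 = i + j))).trans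
  (Finset.single_le_sum (f := fun m => ∑ p ∈ Finset.HasAntidiagonal.antidiagonal m, F p)
    (fun _ _ => zero_le) (Finset.mem_range.2 (Nat.lt_succ_of_le h)))

lemma sum_antidiagonal_le {k : ℕ} {F : ℕ × ℕ → ℝ≥0∞} {X : ℝ≥0∞}
    (h : ∀ i j, i + j ≤ k → F (i, j) ≤ X) :
    ∑ m ∈ Finset.range (k + 1), ∑ p ∈ Finset.HasAntidiagonal.antidiagonal m, F p ≤
      ENNReal.ofReal ((k + 1 : ℝ) ^ 2) * X := by
  have h1 : ∀ m ∈ Finset.range (k + 1),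
      ∑ p ∈ Finset.HasAntidiagonal.antidiagonal m, F p ≤ (k + 1) • X := fun m hm => by
    have hm' : m ≤ k := Nat.lt_succ_iff.1 (Finset.mem_range.1 hm)
    refine (Finset.sum_le_card_nsmul _ _ X fun p hp => ?_).trans ?_
    · rw [Finset.HasAntidiagonal.mem_antidiagonal] at hp
      exact h p.1 p.2 (by omega)
    · rw [Finset.Nat.card_antidiagonal]
      exact nsmul_le_nsmul_left zero_le (by omega)
  refine (Finset.sum_le_card_nsmul _ _ _ h1).trans (le_of_eq ?_)
  rw [Finset.card_range, ← mul_nsmul, nsmul_eq_mul, ← ENNReal.ofReal_natCast]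
  congr 2
  push_cast; ring

variable {ρ σ : ℝ} {N : (ℂ → ℂ) → ℝ≥0∞} {k : ℕ} {f : ℝ → ℂ → ℂ}

lemma IsModeNorm.expSum_conormal (hN : IsModeNorm ρ σ N) (hσ : 0 < σ) (hf : IsHoloOn σ f) (l : ℕ) :
    expSum ρ (fun α => N (mode (conormal^[l] f) α)) =
      expSum ρ fun α => N (conD^[l] (mode f α)) := by
  congr 1
  funext α
  exact hN.congr (hf.mode_iterate_conormal hσ α l)

/-- Only the purely conormal norms have to be finite: they give enough decay in α for ∂_x to act on
modes as multiplication by iα. -/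
lemma IsModeNorm.conormalSum_eq (hN : IsModeNorm ρ σ N) (hσ : 0 < σ) (hf : IsHoloOn σ f)
    (hfin : ∀ l ≤ k, expSum ρ (fun α => N (conD^[l] (mode f α))) < ⊤) :
    conormalSum k (fun f => expSum ρ fun α => N (mode f α)) f =
      modeSum ρ k fun l α => N (conD^[l] (mode f α)) := by
  refine Finset.sum_congr rfl fun m hm => Finset.sum_congr rfl fun p hp => ?_
  rw [Finset.HasAntidiagonal.mem_antidiagonal] at hp
  have hm' : m ≤ k := Nat.lt_succ_iff.1 (Finset.mem_range.1 hm)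
  have h1 := hfin p.2 (by omega)
  rw [← hN.expSum_conormal hσ hf] at h1
  beta_reduce
  congr 1
  funext α
  rw [hN.dX (hf.iterate_conormal hσ p.2) h1, hN.congr (hf.mode_iterate_conormal hσ α p.2)]

lemma IsModeNorm.lt_top_of_conormalSum (hN : IsModeNorm ρ σ N) (hσ : 0 < σ) (hf : IsHoloOn σ f)
    (h : conormalSum k (fun f => expSum ρ fun α => N (mode f α)) f < ⊤) (l : ℕ) (hl : l ≤ k) :
    expSum ρ (fun α => N (conD^[l] (mode f α))) < ⊤ := by
  rw [← hN.expSum_conormal hσ hf]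
  have h1 := le_sum_antidiagonal (i := 0) (j := l) (k := k) (by omega) fun p =>
    expSum ρ fun α => N (mode (_root_.dX^[p.1] (conormal^[p.2] f)) α)
  simp only [Function.iterate_zero, id] at h1
  exact lt_of_le_of_lt h1 h

/-- Multiplication by |α|^i commutes with the mode bounds. The cube counts at most (k+1)² index
pairs with at most k+1 terms each. -/
lemma modeSum_le_of_le {A B : ℕ → ℤ → ℝ≥0∞} {C : ℝ} (hC : 0 ≤ C)
    (h : ∀ l ≤ k, ∀ α, B l α ≤ ENNReal.ofReal C * ∑ j ∈ Finset.range (l + 1), A j α) :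
    modeSum ρ k B ≤ ENNReal.ofReal ((k + 1 : ℝ) ^ 3 * C) * modeSum ρ k A := by
  have e : (k + 1 : ℝ) ^ 3 * C = (k + 1 : ℝ) ^ 2 * (C * (k + 1)) := by ring
  rw [e, ENNReal.ofReal_mul (by positivity), mul_assoc]
  refine sum_antidiagonal_le fun i l hil => ?_
  calc _ ≤ expSum ρ (fun α => ENNReal.ofReal C * ∑ j ∈ Finset.range (l + 1),
        ENNReal.ofReal (|(α : ℝ)| ^ i) * A j α) := expSum_mono fun α => by
          rw [← Finset.mul_sum, mul_left_comm]
          exact mul_le_mul_right (h l (by omega) α) _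
    _ = ENNReal.ofReal C * ∑ j ∈ Finset.range (l + 1),
        expSum ρ (fun α => ENNReal.ofReal (|(α : ℝ)| ^ i) * A j α) := by
          rw [expSum_const_mul, expSum_finset_sum]
    _ ≤ ENNReal.ofReal C * ((l + 1) • modeSum ρ k A) := by
          refine mul_le_mul_right ((Finset.sum_le_card_nsmul _ _ (modeSum ρ k A) fun j hj => ?_).trans
            (by rw [Finset.card_range])) _
          have := Finset.mem_range.1 hj
          exact le_sum_antidiagonal (i := i) (j := j) (by omega) fun p =>
            expSum ρ fun α => ENNReal.ofReal (|(α : ℝ)| ^ p.1) * A p.2 α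
    _ ≤ _ := by
          rw [ENNReal.ofReal_mul hC, mul_assoc, nsmul_eq_mul, ← ENNReal.ofReal_natCast]
          refine mul_le_mul_right (mul_le_mul_left (ENNReal.ofReal_le_ofReal ?_) _) _
          have : (l : ℝ) ≤ k := by exact_mod_cast (by omega : l ≤ k)
          push_cast; linarith

/-- A bound for the semigroup in each mode gives the bound for the conormal norms. -/
lemma IsModeNorm.conormalSum_semigroup_le (hN : IsModeNorm ρ σ N) {ν t C : ℝ} (hν : 0 < ν)
    (ht : 0 < t) (hρ : 0 < ρ) (hσ : 0 < σ) (hσ1 : σ < 1) (hC : 0 ≤ C)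
    (hl1 : ∀ f, IsHoloOn σ f → expSum ρ (fun α => N (mode f α)) < ⊤ → l1Norm ρ σ f < ⊤)
    (hop : ∀ l ≤ k, ∀ (α : ℤ) (h : ℂ → ℂ), (∀ j ≤ l, PencilL1 σ (conD^[j] h)) →
      N (conD^[l] (intOp (stokesGreen ν α t) h)) ≤
        ENNReal.ofReal C * ∑ j ∈ Finset.range (l + 1), N (conD^[j] h))
    (hf : IsHoloOn σ f) :
    conormalSum k (fun f => expSum ρ fun α => N (mode f α)) (stokesSemigroup ν t f) ≤
      ENNReal.ofReal ((k + 1 : ℝ) ^ 3 * C + 1) *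
        conormalSum k (fun f => expSum ρ fun α => N (mode f α)) f := by
  by_cases hfin : conormalSum k (fun f => expSum ρ fun α => N (mode f α)) f < ⊤
  swap
  · rw [not_lt, top_le_iff] at hfin
    -- The + 1 in the constant keeps it nonzero, so that an infinite right-hand side stays infinite
    -- in [0, ∞].
    rw [hfin, ENNReal.mul_top (by rw [Ne, ENNReal.ofReal_eq_zero, not_le]; positivity)]
    exact le_top
  have hA := hN.lt_top_of_conormalSum hσ hf hfin
  have hL : ∀ l ≤ k, l1Norm ρ σ (conormal^[l] f) < ⊤ := fun l hl =>
    hl1 _ (hf.iterate_conormal hσ l) (by rw [hN.expSum_conormal hσ hf]; exact hA l hl)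
  have hP : ∀ l ≤ k, ∀ α, PencilL1 σ (conD^[l] (mode f α)) := fun l hl α =>
    ⟨iterate_conD_differentiableOn hσ l (hf.mode_differentiableOn α), by
      have h1 := hL l hl
      rw [l1Norm, (isModeNorm_l1ModeNorm hρ).expSum_conormal hσ hf] at h1
      exact lt_top_of_expSum h1 α⟩
  have hF := modeFamily_semigroup hν ht hσ hσ1 hf (hL 0 (Nat.zero_le _))
  have hFh : IsHoloOn σ (stokesSemigroup ν t f) := hF.isHoloOn hρ
  have hb : ∀ l ≤ k, ∀ α, N (conD^[l] (mode (stokesSemigroup ν t f) α)) ≤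
      ENNReal.ofReal C * ∑ j ∈ Finset.range (l + 1), N (conD^[j] (mode f α)) := fun l hl α => by
    have e : EqOn (mode (stokesSemigroup ν t f) α) (intOp (stokesGreen ν α t) (mode f α))
      (pencil σ) := fun z hz => hF.mode_eq hρ hz α
    rw [hN.congr (iterate_conD_eqOn l e)]
    exact hop l hl α _ fun j hj => hP j (hj.trans hl) α
  -- Finiteness of the output must come first, since it is what permits rewriting its x-derivatives
  -- mode by mode.
  have hBfin : ∀ l ≤ k, expSum ρ (fun α => N (conD^[l] (mode (stokesSemigroup ν t f) α))) < ⊤ :=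
    fun l hl => by
    refine lt_of_le_of_lt (expSum_mono (hb l hl)) ?_
    rw [expSum_const_mul, expSum_finset_sum]
    refine ENNReal.mul_lt_top ENNReal.ofReal_lt_top (ENNReal.sum_lt_top.2 fun j hj => hA j ?_)
    have := Finset.mem_range.1 hj
    omega
  rw [hN.conormalSum_eq hσ hFh hBfin, hN.conormalSum_eq hσ hf hA]
  exact (modeSum_le_of_le hC hb).trans
    (mul_le_mul_left (ENNReal.ofReal_le_ofReal (by linarith)) _)

/-- A bound for the boundary operator in each mode gives the bound for the conormal norms. -/
lemma IsModeNorm.conormalSum_boundary_le (hN : IsModeNorm ρ σ N) {ν t A B : ℝ} (hν : 0 < ν)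
    (ht : 0 < t) (hρ : 0 < ρ) (hσ : 0 < σ) (hσ1 : σ < 1) (hA : 0 < A) (hB : 0 ≤ B)
    (hop : ∀ l ≤ k, ∀ α : ℤ,
      N (conD^[l] (stokesGreen ν α t 0)) ≤ ENNReal.ofReal (A + B * |(α : ℝ)|))
    {g : ℝ → ℂ} (hg : Continuous g) (hp : Function.Periodic g (2 * π)) :
    conormalSum k (fun f => expSum ρ fun α => N (mode f α)) (stokesBoundary ν t g) ≤
      ENNReal.ofReal ((k + 1 : ℝ) ^ 2 * A) * bdryNormK ρ k g +
        ENNReal.ofReal ((k + 1 : ℝ) ^ 2 * B) * bdryNormK ρ (k + 1) g := by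
  rw [ENNReal.ofReal_mul (by positivity), ENNReal.ofReal_mul (by positivity), mul_assoc, mul_assoc,
    ← mul_add]
  have hterm : ∀ {k j : ℕ}, j ≤ k → bdryNorm ρ (deriv^[j] g) ≤ bdryNormK ρ k g := fun hj =>
    Finset.single_le_sum (f := fun j => bdryNorm ρ (deriv^[j] g)) (fun _ _ => zero_le)
      (Finset.mem_range.2 (Nat.lt_succ_of_le hj))
  set X := ENNReal.ofReal A * bdryNormK ρ k g + ENNReal.ofReal B * bdryNormK ρ (k + 1) g with hX
  by_cases hfin : X < ⊤
  swap
  · rw [not_lt, top_le_iff] at hfin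
    rw [hfin, ENNReal.mul_top (by rw [Ne, ENNReal.ofReal_eq_zero, not_le]; positivity)]
    exact le_top
  -- A > 0 is what allows finiteness of the norm of g to be read off from X; B may be 0.
  have hA' : ENNReal.ofReal A ≠ 0 := by rw [Ne, ENNReal.ofReal_eq_zero, not_le]; exact hA
  have hgK : bdryNormK ρ k g < ⊤ := by
    by_contra h
    rw [not_lt, top_le_iff] at h
    rw [hX, h, ENNReal.mul_top hA', top_add] at hfin
    exact lt_irrefl _ hfin
  have hg0 : bdryNorm ρ g < ⊤ := (hterm (k := k) (j := 0) (Nat.zero_le _)).trans_lt hgK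
  have hr : RapidDecay (coeff g) := rapidDecay_of_expSum hρ hg0
  have hd : ∀ j, expSum ρ (fun α => ENNReal.ofReal (|(α : ℝ)| ^ j) * ENNReal.ofReal ‖coeff g α‖) =
      bdryNorm ρ (deriv^[j] g) := fun j => by
    rw [bdryNorm]
    congr 1
    funext α
    rw [RapidDecay.coeff_iterate_deriv j hg hp hr, norm_mul, norm_I_mul_pow,
      ENNReal.ofReal_mul (by positivity)]
  have hF := modeFamily_boundary hν ht hσ hσ1 hg0
  have hFh : IsHoloOn σ (stokesBoundary ν t g) := hF.isHoloOn hρ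
  have hb : ∀ i l, i + l ≤ k → expSum ρ (fun α => ENNReal.ofReal (|(α : ℝ)| ^ i) *
      N (conD^[l] (mode (stokesBoundary ν t g) α))) ≤ X := fun i l hil => by
    calc _ ≤ expSum ρ (fun α =>
          ENNReal.ofReal A * (ENNReal.ofReal (|(α : ℝ)| ^ i) * ENNReal.ofReal ‖coeff g α‖) +
          ENNReal.ofReal B * (ENNReal.ofReal (|(α : ℝ)| ^ (i + 1)) * ENNReal.ofReal ‖coeff g α‖)) := by
          refine expSum_mono fun α => ?_
          have e : EqOn (mode (stokesBoundary ν t g) α) (fun z => stokesGreen ν α t 0 z * coeff g α)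
            (pencil σ) := fun z hz => hF.mode_eq hρ hz α
          rw [hN.congr (iterate_conD_eqOn l e), iterate_conD_mul_const, hN.mul_const]
          calc _ ≤ ENNReal.ofReal (|(α : ℝ)| ^ i) *
                (ENNReal.ofReal (A + B * |(α : ℝ)|) * ENNReal.ofReal ‖coeff g α‖) :=
                mul_le_mul_right (mul_le_mul_left (hop l (by omega) α) _) _
            _ = _ := by
                rw [ENNReal.ofReal_add hA.le (by positivity), ENNReal.ofReal_mul hB, pow_succ,
                  ENNReal.ofReal_mul (by positivity)]
                ring
      _ = ENNReal.ofReal A * bdryNorm ρ (deriv^[i] g) +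
          ENNReal.ofReal B * bdryNorm ρ (deriv^[i + 1] g) := by
          rw [expSum_add, expSum_const_mul, expSum_const_mul, hd, hd]
      _ ≤ X := add_le_add (mul_le_mul_right (hterm (by omega)) _)
          (mul_le_mul_right (hterm (by omega)) _)
  have hBfin : ∀ l ≤ k, expSum ρ (fun α => N (conD^[l] (mode (stokesBoundary ν t g) α))) < ⊤ :=
    fun l hl => by
    have := hb 0 l (by omega)
    simp only [pow_zero, ENNReal.ofReal_one, one_mul] at this
    exact this.trans_lt hfin
  rw [hN.conormalSum_eq hσ hFh hBfin]
  exact sum_antidiagonal_le hb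

/-! ### Comparison of the weights at different times -/

/-- The weight stands in the denominator, so a larger weight means a smaller norm. -/
lemma blModeNorm_le_mul {β P ν s t σ c : ℝ} (hc : 0 ≤ c)
    (h : ∀ z : ℂ, blWeight P ν s z ≤ c * blWeight P ν t z) (g : ℂ → ℂ) :
    blModeNorm β P ν t σ g ≤ ENNReal.ofReal c * blModeNorm β P ν s σ g := by
  refine iSup₂_le fun z hz => ?_
  refine le_trans ?_ (mul_le_mul_right (le_iSup₂ (f := fun z (_ : z ∈ pencil σ) =>
    ENNReal.ofReal (‖g z‖ * exp (β * z.re) * (blWeight P ν s z)⁻¹)) z hz) _)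
  rw [← ENNReal.ofReal_mul hc]
  apply ENNReal.ofReal_le_ofReal
  have h1 := zero_lt_one.trans_le (one_le_blWeight P ν s z)
  have h2 := zero_lt_one.trans_le (one_le_blWeight P ν t z)
  have h3 : (blWeight P ν t z)⁻¹ ≤ c * (blWeight P ν s z)⁻¹ := by
    rw [← div_eq_mul_inv, le_div_iff₀ h1, ← div_eq_inv_mul, div_le_iff₀ h2]; exact h z
  calc _ ≤ ‖g z‖ * exp (β * z.re) * (c * (blWeight P ν s z)⁻¹) :=
        mul_le_mul_of_nonneg_left h3 (by positivity)
    _ = _ := by ring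

lemma blNormK_le_mul {β P ν s t c : ℝ} (hc : 0 ≤ c)
    (h : ∀ z : ℂ, blWeight P ν s z ≤ c * blWeight P ν t z) (ρ σ : ℝ) (k : ℕ) (f : ℝ → ℂ → ℂ) :
    blNormK β P ν t ρ σ k f ≤ ENNReal.ofReal c * blNormK β P ν s ρ σ k f := by
  simp only [blNormK, conormalSum, Finset.mul_sum]
  refine Finset.sum_le_sum fun m _ => Finset.sum_le_sum fun p _ => ?_
  rw [blNorm, blNorm, ← expSum_const_mul]
  exact expSum_mono fun α => blModeNorm_le_mul hc h _

end

noncomputable section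

/-! ### The main estimates -/

/-- The same weight time t stands on both sides, with an arbitrary kernel time t' ≤ t. Both sup
estimates of the theorem are instances followed by a comparison of weights. -/
lemma exists_blNormK_semigroup_le {β P T ν₀ σ₀ : ℝ} (hβ : 0 < β) (hP : 1 < P) (hT : 0 < T)
    (hσ₀ : 0 < σ₀) (hσ₀1 : σ₀ < 1) (k : ℕ) : ∃ C : ℝ, 0 < C ∧ ∀ (ν ρ σ t' t : ℝ) (f : ℝ → ℂ → ℂ),
      0 < ν → ν ≤ ν₀ → 0 < ρ → 0 < σ → σ ≤ σ₀ → 0 < t' → t' ≤ t → t ≤ T → IsHoloOn σ f →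
      blNormK β P ν t ρ σ k (stokesSemigroup ν t' f) ≤
        ENNReal.ofReal C * blNormK β P ν t ρ σ k f := by
  choose C hC h using fun l => exists_blModeNorm_stokes_le (ν₀ := ν₀) hβ hP hT hσ₀ hσ₀1 l
  have hS : 0 ≤ ∑ l ∈ Finset.range (k + 1), C l := Finset.sum_nonneg fun l _ => hC l
  refine ⟨(k + 1 : ℝ) ^ 3 * ∑ l ∈ Finset.range (k + 1), C l + 1, by positivity,
    fun ν ρ σ t' t f hν hνν hρ hσ hσσ ht' htt htT hf => ?_⟩
  have hσ1 := hσσ.trans_lt hσ₀1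
  refine (isModeNorm_blModeNorm hρ hσ β P ν t).conormalSum_semigroup_le hν ht' hρ hσ hσ1 hS
    (fun f hf hfin => l1Norm_lt_top_of_blNorm hβ hσ1 hf hfin) (fun l hl α g hg => ?_) hf
  refine (h l ν σ t' t α g hν hνν hσ hσσ ht' htt htT hg).trans
    (mul_le_mul_left (ENNReal.ofReal_le_ofReal ?_) _)
  exact Finset.single_le_sum (fun l _ => hC l) (Finset.mem_range.2 (Nat.lt_succ_of_le hl))

lemma exists_wNorm_semigroup_le {σ₀ : ℝ} (hσ₀ : 0 < σ₀) (hσ₀1 : σ₀ < 1) (k : ℕ) :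
    ∃ C : ℝ, 0 < C ∧ ∀ (ν ρ σ t : ℝ) (f : ℝ → ℂ → ℂ), 0 < ν → 0 < ρ → 0 < σ → σ ≤ σ₀ → 0 < t →
      IsHoloOn σ f → wNorm ρ σ k (stokesSemigroup ν t f) ≤ ENNReal.ofReal C * wNorm ρ σ k f := by
  choose C hC h using fun l => exists_l1ModeNorm_stokes_le hσ₀ hσ₀1 l
  have hS : 0 ≤ ∑ l ∈ Finset.range (k + 1), C l := Finset.sum_nonneg fun l _ => hC l
  refine ⟨(k + 1 : ℝ) ^ 3 * ∑ l ∈ Finset.range (k + 1), C l + 1, by positivity,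
    fun ν ρ σ t f hν hρ hσ hσσ ht hf => ?_⟩
  have hσ1 := hσσ.trans_lt hσ₀1
  refine (isModeNorm_l1ModeNorm hρ).conormalSum_semigroup_le hν ht hρ hσ hσ1 hS
    (fun f hf hfin => hfin) (fun l hl α g hg => ?_) hf
  refine (h l ν σ t α g hν hσ hσσ ht hg).trans (mul_le_mul_left (ENNReal.ofReal_le_ofReal ?_) _)
  exact Finset.single_le_sum (fun l _ => hC l) (Finset.mem_range.2 (Nat.lt_succ_of_le hl))

lemma exists_blNormK_boundary_le {β P T ν₀ σ₀ : ℝ} (hP : 1 < P) (hT : 0 < T)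
    (hσ₀ : 0 < σ₀) (hσ₀1 : σ₀ < 1) (k : ℕ) : ∃ C : ℝ, 0 < C ∧ ∀ (ν ρ σ t' t : ℝ) (g : ℝ → ℂ),
      0 < ν → ν ≤ ν₀ → 0 < ρ → 0 < σ → σ ≤ σ₀ → 0 < t' → t' ≤ t → t ≤ T → Continuous g →
      Function.Periodic g (2 * π) → blNormK β P ν t ρ σ k (stokesBoundary ν t' g) ≤
        ENNReal.ofReal (C * √(t / t')) * bdryNormK ρ k g +
          ENNReal.ofReal (C * √ν) * bdryNormK ρ (k + 1) g := by
  choose C hC h using fun l =>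
    exists_blModeNorm_boundary_le (β := β) (ν₀ := ν₀) hP hT hσ₀ hσ₀1 l
  -- The + 1 gives the strict positivity of the leading constant required by
  -- `IsModeNorm.conormalSum_boundary_le`.
  set S := ∑ l ∈ Finset.range (k + 1), C l + 1 with hSd
  have hS : 0 < S := add_pos_of_nonneg_of_pos (Finset.sum_nonneg fun l _ => hC l) one_pos
  refine ⟨(k + 1 : ℝ) ^ 2 * S, by positivity,
    fun ν ρ σ t' t g hν hνν hρ hσ hσσ ht' htt htT hg hp => ?_⟩
  have ht := ht'.trans_le htt
  rw [mul_assoc, mul_assoc]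
  refine (isModeNorm_blModeNorm hρ hσ β P ν t).conormalSum_boundary_le hν ht' hρ hσ
    (hσσ.trans_lt hσ₀1) (by positivity) (by positivity) (fun l hl α => ?_) hg hp
  refine (h l ν σ t' t α hν hνν hσ hσσ ht' htt htT).trans (ENNReal.ofReal_le_ofReal ?_)
  rw [mul_assoc, ← mul_add]
  refine mul_le_mul_of_nonneg_right ?_ (by positivity)
  exact (Finset.single_le_sum (fun l _ => hC l)
    (Finset.mem_range.2 (Nat.lt_succ_of_le hl))).trans (le_add_of_nonneg_right zero_le_one)

lemma exists_wNorm_boundary_le {σ₀ : ℝ} (hσ₀ : 0 < σ₀) (hσ₀1 : σ₀ < 1) (k : ℕ) :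
    ∃ C : ℝ, 0 < C ∧ ∀ (ν ρ σ t : ℝ) (g : ℝ → ℂ), 0 < ν → 0 < ρ → 0 < σ → σ ≤ σ₀ → 0 < t →
      Continuous g → Function.Periodic g (2 * π) →
      wNorm ρ σ k (stokesBoundary ν t g) ≤ ENNReal.ofReal C * bdryNormK ρ k g := by
  choose C hC h using fun l => exists_l1ModeNorm_boundary_le hσ₀ hσ₀1 l
  set S := ∑ l ∈ Finset.range (k + 1), C l + 1 with hSd
  have hS : 0 < S := add_pos_of_nonneg_of_pos (Finset.sum_nonneg fun l _ => hC l) one_pos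
  refine ⟨(k + 1 : ℝ) ^ 2 * S, by positivity, fun ν ρ σ t g hν hρ hσ hσσ ht hg hp => ?_⟩
  -- Applied with B = 0: in L¹ the mode bound is uniform in α, so the term with k + 1 derivatives
  -- disappears.
  have h1 := (isModeNorm_l1ModeNorm hρ).conormalSum_boundary_le (k := k) hν ht hρ hσ
    (hσσ.trans_lt hσ₀1) hS le_rfl (fun l hl α => by
      refine (h l ν σ t α hν hσ hσσ ht).trans (ENNReal.ofReal_le_ofReal ?_)
      rw [zero_mul, add_zero]
      exact (Finset.single_le_sum (fun l _ => hC l)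
        (Finset.mem_range.2 (Nat.lt_succ_of_le hl))).trans (le_add_of_nonneg_right zero_le_one)) hg hp
  rwa [mul_zero, ENNReal.ofReal_zero, zero_mul, add_zero] at h1

end

theorem mainTheorem3 :
    -- the kernel is the Green function of the Stokes problem
    (∀ ν : ℝ, 0 < ν → ∀ α : ℤ, IsStokesGreen ν α (stokesGreen ν α)) ∧
    -- `e^{νtB}` is well defined and commutes with `∂_x`
    (∀ ν t ρ σ : ℝ, 0 < ν → 0 < t → 0 < ρ → 0 < σ → σ < 1 →
      ∀ f : ℝ → ℂ → ℂ, IsHoloOn σ f →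
        (l1Norm ρ σ f < ⊤ ∨
          ∃ β P s : ℝ, 0 < β ∧ 1 < P ∧ 0 ≤ s ∧ blNorm β P ν s ρ σ f < ⊤) →
        IsHoloOn σ (stokesSemigroup ν t f) ∧
        ∀ x : ℝ, ∀ z ∈ pencil σ,
          HasDerivAt (fun x' => stokesSemigroup ν t f x' z) (stokesSemigroup ν t (dX f) x z) x) ∧
    -- `Γ(νt)` is well defined and commutes with `∂_x`
    (∀ ν t ρ σ : ℝ, 0 < ν → 0 < t → 0 < ρ → 0 < σ → σ < 1 →
      ∀ g : ℝ → ℂ, Continuous g → Function.Periodic g (2 * π) → bdryNorm ρ g < ⊤ →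
        IsHoloOn σ (stokesBoundary ν t g) ∧
        ∀ x : ℝ, ∀ z ∈ pencil σ,
          HasDerivAt (fun x' => stokesBoundary ν t g x' z) (stokesBoundary ν t (deriv g) x z) x) ∧
    -- bounds with a constant independent of `ν`, `ρ`, `σ`, `s`, `t`, `f`, `g`
    (∀ β P T ν₀ σ₀ : ℝ, 0 < β → 1 < P → 0 < T → 0 < ν₀ → 0 < σ₀ → σ₀ < 1 → ∀ k : ℕ,
      ∃ C : ℝ, 0 < C ∧ ∀ ν ρ σ : ℝ, 0 < ν → ν ≤ ν₀ → 0 < ρ → 0 < σ → σ ≤ σ₀ →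
        (∀ f : ℝ → ℂ → ℂ, IsHoloOn σ f → ∀ t : ℝ, 0 < t → t ≤ T →
          blNormK β P ν t ρ σ k (stokesSemigroup ν t f)
              ≤ ENNReal.ofReal C * blNormK β P ν 0 ρ σ k f ∧
          (∀ s : ℝ, 0 < s → s < t →
            blNormK β P ν t ρ σ k (stokesSemigroup ν (t - s) f)
              ≤ ENNReal.ofReal (C * √(t / s)) * blNormK β P ν s ρ σ k f) ∧
          wNorm ρ σ k (stokesSemigroup ν t f) ≤ ENNReal.ofReal C * wNorm ρ σ k f) ∧
        (∀ g : ℝ → ℂ, Continuous g → Function.Periodic g (2 * π) → ∀ t : ℝ, 0 < t → t ≤ T →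
          (∀ s : ℝ, 0 ≤ s → s < t →
            blNormK β P ν t ρ σ k (stokesBoundary ν (t - s) g)
              ≤ ENNReal.ofReal (C * √(t / (t - s))) * bdryNormK ρ k g
                + ENNReal.ofReal (C * √ν) * bdryNormK ρ (k + 1) g) ∧
          wNorm ρ σ k (stokesBoundary ν t g) ≤ ENNReal.ofReal C * bdryNormK ρ k g)) := by
  refine ⟨fun ν hν α => isStokesGreen_stokesGreen hν α, ?_, ?_, ?_⟩
  · intro ν t ρ σ hν ht hρ hσ hσ1 f hf hfin
    refine stokesSemigroup_isHoloOn_and_hasDerivAt hν ht hρ hσ hσ1 hf ?_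
    rcases hfin with h | ⟨β, P, s, hβ, -, -, h⟩
    · exact h
    · exact l1Norm_lt_top_of_blNorm hβ hσ1 hf h
  · intro ν t ρ σ hν ht hρ hσ hσ1 g hg hp hfin
    exact stokesBoundary_isHoloOn_and_hasDerivAt hν ht hρ hσ hσ1 hg hp hfin
  · intro β P T ν₀ σ₀ hβ hP hT hν₀ hσ₀ hσ₀1 k
    obtain ⟨C₁, hC₁, h₁⟩ := exists_blNormK_semigroup_le hβ hP hT hσ₀ hσ₀1 (ν₀ := ν₀) k
    obtain ⟨C₂, hC₂, h₂⟩ := exists_wNorm_semigroup_le hσ₀ hσ₀1 k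
    obtain ⟨C₃, hC₃, h₃⟩ := exists_blNormK_boundary_le hP hT hσ₀ hσ₀1 (β := β) (ν₀ := ν₀) k
    obtain ⟨C₄, hC₄, h₄⟩ := exists_wNorm_boundary_le hσ₀ hσ₀1 k
    have mono : ∀ {a b : ℝ} {X : ℝ≥0∞}, a ≤ b → ENNReal.ofReal a * X ≤ ENNReal.ofReal b * X :=
      fun h => mul_le_mul_left (ENNReal.ofReal_le_ofReal h) _
    refine ⟨C₁ + C₂ + C₃ + C₄, by positivity, fun ν ρ σ hν hνν hρ hσ hσσ => ⟨?_, ?_⟩⟩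
    · intro f hf t ht htT
      refine ⟨?_, fun s hs hst => ?_, ?_⟩
      -- Kernel time t' = t; the weight at time 0 lacks one layer, so its norm dominates the norm at
      -- time t.
      · refine (h₁ ν ρ σ t t f hν hνν hρ hσ hσσ ht le_rfl htT hf).trans ?_
        refine (mul_le_mul_right (blNormK_le_mul (s := 0) zero_le_one
          (fun z => by rw [one_mul]; exact blWeight_zero_le P ν t z) ρ σ k f) _).trans ?_
        rw [ENNReal.ofReal_one, one_mul]
        exact mono (by linarith)
      -- Kernel time t' = t − s with weights at time t; passing from t to s on the right-hand side
      -- produces √(t/s).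
      · refine (h₁ ν ρ σ (t - s) t f hν hνν hρ hσ hσσ (by linarith) (by linarith) htT hf).trans ?_
        refine (mul_le_mul_right (blNormK_le_mul (s := s) (Real.sqrt_nonneg (t / s))
          (blWeight_le_of_lt hP hν hs hst) ρ σ k f) _).trans ?_
        rw [← mul_assoc, ← ENNReal.ofReal_mul hC₁.le]
        exact mono (mul_le_mul_of_nonneg_right (by linarith) (Real.sqrt_nonneg _))
      · exact (h₂ ν ρ σ t f hν hρ hσ hσσ ht hf).trans (mono (by linarith))
    · intro g hg hp t ht htT
      refine ⟨fun s hs hst => ?_, ?_⟩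
      · refine (h₃ ν ρ σ (t - s) t g hν hνν hρ hσ hσσ (by linarith) (by linarith) htT hg hp).trans ?_
        exact add_le_add (mono (mul_le_mul_of_nonneg_right (by linarith) (Real.sqrt_nonneg _)))
          (mono (mul_le_mul_of_nonneg_right (by linarith) (Real.sqrt_nonneg _)))
      · exact (h₄ ν ρ σ t g hν hρ hσ hσσ ht hg hp).trans (mono (by linarith))
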